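/- Let $\mathbb K$ be a field and $m\ge 1$. Let $\mathcal Z_m\subseteq(0,2\pi)$ be an $\infty$-gon: accumulation points $0=p_0<p_1<\dots<p_{m-1}<p_m=2\pi$ are given (with $p_0$ and $p_m$ identified on the circle), and $\mathcal Z_m$ is the union of $m$ strictly increasing copies of $\mathbb Z$, the $i$-th lying in $(p_{i},p_{i+1})$ and accumulating exactly at its two ends; $z^+$ denotes the successor of $z\in\mathcal Z_m$ in its copy of $\mathbb Z$. Put $\kappa(t)=2\pi+z^+-s$ if the representative $s\in[0,2\pi)$ of $t$ modulo $2\pi$ lies in $[z,z^+)$ for some $z\in\mathcal Z_m$, and $\kappa(t)=2\pi$ if $s$ is an accumulation point. Regard $S^1=\mathbb R/2\pi\mathbb Z$ as a category whose morphisms $x\to y$ are the anticlockwise paths from $x$ to $y$, making any number $n\ge 0$ of additional full turns, and let $g_{xy}$ be the shortest one. A representation of $S^1$ is a functor from $S^1$ to $\mathbb K$-vector spaces. For a bounded interval $U\subseteq\mathbb R$, the string $\overline M_U$ is the representation whose value at $x$ has as basis the set of those $b\in U$ lying over $x$, a path of length $\ell$ sending $b$ to $b+\ell$ if $b+\ell\in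 U$ and to $0$ otherwise. Let $\mathrm{Rep}^{\mathrm{pwf}}(S^1,\kappa)$ be the full subcategory of the pointwise finite dimensional representations each of whose indecomposable direct summands is isomorphic to some $\overline M_U$ with $U$ a bounded interval and $U\subseteq[\inf U,\inf U+\kappa(\inf U)]$. Let $\mathrm{rep}(\mathcal Z_m,\kappa)$ be its full subcategory of those $M$ such that (1) $M(g_{xy})$ is an isomorphism whenever $z<x\le y\le z^+$ for some $z\in\mathcal Z_m$, and (2) for each accumulation point $p$ there are $a,b\in\mathcal Z_m$ with $a<p<b$ in cyclic order such that $M(g_{xy})$ is an isomorphism whenever $a<x\le y\le b$ in cyclic order. Then $\mathrm{rep}(\mathcal Z_m,\kappa)$, with the short exact sequences of representations whose terms lie in it, is a Frobenius subcategory of $\mathrm{Rep}^{\mathrm{pwf}}(S^1,\kappa)$: it is an additive subcategory, closed under extensions, every object has a projective cover and an injective envelope, and its projective and its injective objects coincide. Let $\mathcal C_{-1,m}$ be its stable category: it has the same objects, and its morphisms are the morphisms of $\mathrm{rep}(\mathcal Z_m,\kappa)$ modulo those factoring through a projective object. The following hold. (a) $\mathcal C_{-1,m}$ is a Krull--Schmidt,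 $\mathrm{Hom}$-finite, $\mathbb K$-linear triangulated category, with the triangulated structure induced by the exact structure. That is, choose for each object $a$ a short exact sequence $0\to a\xrightarrow{\iota_a}I_a\xrightarrow{\pi_a}\Sigma a\to 0$ with $I_a$ injective. Then the shift is, up to isomorphism, $a\mapsto\Sigma a$, acting on morphisms by extending them to morphisms of the chosen sequences. The distinguished triangles are, up to isomorphism, the $a\xrightarrow{[f]}e\xrightarrow{[g]}b\xrightarrow{[h]}\Sigma a$ where $0\to a\xrightarrow{f}e\xrightarrow{g}b\to0$ is exact in $\mathrm{rep}(\mathcal Z_m,\kappa)$ and $\varphi f=\iota_a$, $hg=\pi_a\varphi$ for some $\varphi\colon e\to I_a$. (b) $\mathcal C_{-1,m}$ is $(-1)$-Calabi--Yau: $\Sigma^{-1}$ is a Serre functor, i.e. it is a $\mathbb K$-linear autoequivalence and there are linear isomorphisms $\mathrm{Hom}(a,b)\cong\mathrm{Hom}_{\mathbb K}(\mathrm{Hom}(b,\Sigma^{-1}a),\mathbb K)$ natural in $a$ and $b$. (c) If $c\in\mathcal C_{-1,m}$ is indecomposable, then $\dim_{\mathbb K}\mathrm{Hom}(c,\Sigma^{-1}c)=1$.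 Let $a=a_1\oplus\dots\oplus a_n$ be a decomposition into indecomposable objects of $\mathcal C_{-1,m}$, and choose any linear isomorphisms $\theta_i\colon\mathrm{Hom}(a_i,\Sigma^{-1}a_i)\to\mathbb K$. For $f\colon a\to\Sigma^{-1}a$ with matrix entries $f_{i,j}\colon a_j\to\Sigma^{-1}a_i$ put $\mathrm{Tr}(f)=\sum_i\theta_i(f_{i,i})$. Then for every object $b$ the bilinear map $$\mathrm{Hom}(a,b)\times\mathrm{Hom}(b,\Sigma^{-1}a)\to\mathbb K,\qquad (f,g)\mapsto\mathrm{Tr}(gf),$$ is non-degenerate in both arguments. -/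

import Mathlib

open CategoryTheory CategoryTheory.Limits

universe u v w

namespace NakayamaCY

/-! ## Generalities on linear categories -/

section Linear

variable {C : Type w} [Category.{v} C] [Preadditive C]

/-- An object is indecomposable if it is nonzero and in every decomposition of it as a direct sum
of two objects one of the two summands is zero. -/
def IsIndecomposable (X : C) : Prop :=
  ¬ IsZero X ∧ ∀ (Y Z : C) (b : BinaryBicone Y Z), Nonempty b.IsBilimit → Nonempty (b.pt ≅ X) →
    IsZero Y ∨ IsZero Z

variable (C) in
/-- A Krull--Schmidt category: additive, and each object is a finite direct sum of objects with
local endomorphism rings. -/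
def IsKrullSchmidt : Prop :=
  HasFiniteBiproducts C ∧
    ∀ Y : C, ∃ (n : ℕ) (X : Fin n → C) (B : Bicone X),
      Nonempty B.IsBilimit ∧ Nonempty (B.pt ≅ Y) ∧ ∀ i, IsLocalRing (End (X i))

variable (K : Type u) [Field K] [Linear K C]

variable (C) in
/-- All the spaces of morphisms are finite dimensional. -/
def IsHomFinite : Prop :=
  ∀ X Y : C, FiniteDimensional K (X ⟶ Y)

/-- Linear isomorphisms `Hom(a, b) ≅ D Hom(b, S a)` natural in `a` and in `b`. -/
structure SerreDuality (S : C ⥤ C) where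
  iso : ∀ a b : C, (a ⟶ b) ≃ₗ[K] Module.Dual K (b ⟶ S.obj a)
  natural_left : ∀ {a' a b : C} (f : a' ⟶ a) (g : a ⟶ b) (h : b ⟶ S.obj a'),
    iso a' b (f ≫ g) h = iso a b g (h ≫ S.map f)
  natural_right : ∀ {a b b' : C} (g : a ⟶ b) (k : b ⟶ b') (h : b' ⟶ S.obj a),
    iso a b' (g ≫ k) h = iso a b g (k ≫ h)

/-- A Serre functor is an additive `K`-linear autoequivalence `S` together with natural
isomorphisms `Hom(a, b) ≅ D Hom(b, S a)`. -/
def IsSerreFunctor (S : C ⥤ C) : Prop :=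
  S.IsEquivalence ∧ (∃ _ : S.Additive, S.Linear K) ∧ Nonempty (SerreDuality K S)

/-- Given a decomposition `B` of an object into summands `X i` and coordinates `θ i` on the spaces
`Hom(X i, S (X i))`, the trace of `f : B.pt ⟶ S B.pt` is the sum of the diagonal entries
`f_{ii} : X i ⟶ S (X i)` of its matrix, read in the coordinates `θ i`. -/
def trace (S : C ⥤ C) {n : ℕ} {X : Fin n → C} (B : Bicone X)
    (θ : ∀ i, (X i ⟶ S.obj (X i)) ≃ₗ[K] K) : (B.pt ⟶ S.obj B.pt) →ₗ[K] K :=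
  ∑ i, (θ i).toLinearMap ∘ₗ Linear.rightComp K (X i) (S.map (B.π i)) ∘ₗ
    Linear.leftComp K (S.obj B.pt) (B.ι i)

/-- The bilinear map `Hom(a, b) × Hom(b, S a) → K`, `(f, g) ↦ Tr (g f)`, where `a = B.pt`. -/
def tracePairing (S : C ⥤ C) {n : ℕ} {X : Fin n → C} (B : Bicone X)
    (θ : ∀ i, (X i ⟶ S.obj (X i)) ≃ₗ[K] K) (b : C) :
    (B.pt ⟶ b) →ₗ[K] (b ⟶ S.obj B.pt) →ₗ[K] K :=
  (Linear.comp (S := K) B.pt b (S.obj B.pt)).compr₂ (trace K S B θ)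

end Linear

/-! ## Frobenius subcategories and their stable categories -/

section Frobenius

variable {A : Type w} [Category.{v} A] [Abelian A] (P : ObjectProperty A)

variable {P} in
/-- `0 ⟶ X ⟶ Y ⟶ Z ⟶ 0` is a short exact sequence of the ambient category `A` with terms in
the full subcategory `P`. -/
def IsConflation {X Y Z : P.FullSubcategory} (f : X ⟶ Y) (g : Y ⟶ Z) : Prop :=
  ∃ h : f.hom ≫ g.hom = 0, (ShortComplex.mk f.hom g.hom h).ShortExact

variable {P} in
/-- Projective objects of the exact category `P`. -/
def IsProj (X : P.FullSubcategory) : Prop :=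
  ∀ ⦃Y₁ Y₂ Y₃ : P.FullSubcategory⦄ (f : Y₁ ⟶ Y₂) (g : Y₂ ⟶ Y₃), IsConflation f g →
    ∀ h : X ⟶ Y₃, ∃ k : X ⟶ Y₂, k ≫ g = h

variable {P} in
/-- Injective objects of the exact category `P`. -/
def IsInj (X : P.FullSubcategory) : Prop :=
  ∀ ⦃Y₁ Y₂ Y₃ : P.FullSubcategory⦄ (f : Y₁ ⟶ Y₂) (g : Y₂ ⟶ Y₃), IsConflation f g →
    ∀ h : Y₁ ⟶ X, ∃ k : Y₂ ⟶ X, f ≫ k = h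

variable {P} in
/-- `p : Q ⟶ X` is a projective cover: the end of a conflation with `Q` projective, and right
minimal. -/
def IsProjectiveCover {Q X : P.FullSubcategory} (p : Q ⟶ X) : Prop :=
  IsProj Q ∧ (∃ (Y : P.FullSubcategory) (i : Y ⟶ Q), IsConflation i p) ∧
    ∀ e : Q ⟶ Q, e ≫ p = p → IsIso e

variable {P} in
/-- `i : X ⟶ I` is an injective envelope: the start of a conflation with `I` injective, and left
minimal. -/
def IsInjectiveEnvelope {X I : P.FullSubcategory} (i : X ⟶ I) : Prop :=
  IsInj I ∧ (∃ (Y : P.FullSubcategory) (p : I ⟶ Y), IsConflation i p) ∧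
    ∀ e : I ⟶ I, i ≫ e = i → IsIso e

/-- The full subcategory `P` is a Frobenius subcategory of the full subcategory `P'` of `A` (used
when `P'` is an abelian subcategory of `A`): it is an additive subcategory, closed under extensions
in `P'`, with projective covers and injective envelopes, and its projective objects are its
injective objects. -/
structure IsFrobeniusSubcategory (P' : ObjectProperty A) : Prop where
  le : P ≤ P'
  zero : ∀ X : A, IsZero X → P X
  iso : ∀ X Y : A, Nonempty (X ≅ Y) → P X → P Y
  biprod : ∀ X Y : A, P X → P Y → P (X ⊞ Y)
  summand : ∀ X Y : A, P (X ⊞ Y) → P X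
  extension : ∀ S : ShortComplex A, S.ShortExact → P S.X₁ → P S.X₃ → P' S.X₂ → P S.X₂
  projectiveCover : ∀ X : P.FullSubcategory,
    ∃ (Q : P.FullSubcategory) (p : Q ⟶ X), IsProjectiveCover p
  injectiveEnvelope : ∀ X : P.FullSubcategory,
    ∃ (I : P.FullSubcategory) (i : X ⟶ I), IsInjectiveEnvelope i
  proj_iff_inj : ∀ X : P.FullSubcategory, IsProj X ↔ IsInj X

/-- The group of morphisms `X ⟶ Y` which factor through a projective object. (The closure only
adds finite sums of such morphisms; if `P` has finite direct sums, as in a Frobenius subcategory,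
these again factor through a projective object.) -/
def projHom (X Y : P.FullSubcategory) : AddSubgroup (X ⟶ Y) :=
  AddSubgroup.closure {f | ∃ (Q : P.FullSubcategory) (a : X ⟶ Q) (b : Q ⟶ Y), IsProj Q ∧ f = a ≫ b}

/-- Two morphisms are identified if their difference factors through a projective object. -/
def stableRel : HomRel P.FullSubcategory := fun X Y f g => f - g ∈ projHom P X Y

lemma projHom_comp_left {X Y Z : P.FullSubcategory} (f : X ⟶ Y) {g : Y ⟶ Z}
    (hg : g ∈ projHom P Y Z) : f ≫ g ∈ projHom P X Z := by
  induction hg using AddSubgroup.closure_induction with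
  | mem x hx =>
    obtain ⟨Q, a, b, hQ, rfl⟩ := hx
    exact AddSubgroup.subset_closure ⟨Q, f ≫ a, b, hQ, by simp⟩
  | zero => simp
  | add x y _ _ hx hy => rw [Preadditive.comp_add]; exact add_mem hx hy
  | neg x _ hx => rw [Preadditive.comp_neg]; exact neg_mem hx

lemma projHom_comp_right {X Y Z : P.FullSubcategory} {f : X ⟶ Y} (g : Y ⟶ Z)
    (hf : f ∈ projHom P X Y) : f ≫ g ∈ projHom P X Z := by
  induction hf using AddSubgroup.closure_induction with
  | mem x hx =>
    obtain ⟨Q, a, b, hQ, rfl⟩ := hx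
    exact AddSubgroup.subset_closure ⟨Q, a, b ≫ g, hQ, by simp⟩
  | zero => simp
  | add x y _ _ hx hy => rw [Preadditive.add_comp]; exact add_mem hx hy
  | neg x _ hx => rw [Preadditive.neg_comp]; exact neg_mem hx

instance : Congruence (stableRel P) where
  equivalence :=
    { refl := fun f => by simp [stableRel]
      symm := fun {f g} h => by
        have := neg_mem h
        rwa [neg_sub] at this
      trans := fun {f g k} h h' => by
        have := add_mem h h'
        rwa [sub_add_sub_cancel] at this }
  comp_left := fun f _ _ h => by
    have := projHom_comp_left P f h
    rwa [Preadditive.comp_sub] at this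
  comp_right := fun g h => by
    have := projHom_comp_right P g h
    rwa [Preadditive.sub_comp] at this

/-- The stable category of `P`: the objects are those of `P`, and the morphisms are the morphisms
of `P` modulo those which factor through a projective object. -/
abbrev StableCategory := CategoryTheory.Quotient (stableRel P)

/-- The quotient functor onto the stable category. -/
abbrev stabilisation : P.FullSubcategory ⥤ StableCategory P :=
  CategoryTheory.Quotient.functor (stableRel P)

lemma stableRel_add ⦃X Y : P.FullSubcategory⦄ (f₁ f₂ g₁ g₂ : X ⟶ Y) (h : stableRel P f₁ f₂)
    (h' : stableRel P g₁ g₂) : stableRel P (f₁ + g₁) (f₂ + g₂) := by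
  have := add_mem h h'
  rwa [sub_add_sub_comm] at this

instance : Preadditive (StableCategory P) :=
  CategoryTheory.Quotient.preadditive (stableRel P) (stableRel_add P)

instance : (stabilisation P).Additive :=
  CategoryTheory.Quotient.functor_additive (stableRel P) (stableRel_add P)

variable {K : Type u} [Field K] [Linear K A]

lemma stableRel_smul (c : K) ⦃X Y : P.FullSubcategory⦄ (f g : X ⟶ Y) (h : stableRel P f g) :
    stableRel P (c • f) (c • g) := by
  have h1 : f - g ∈ projHom P X Y := h
  have h2 := projHom_comp_left P (c • 𝟙 X) h1
  rwa [Linear.smul_comp, Category.id_comp, smul_sub] at h2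

instance : Linear K (StableCategory P) :=
  CategoryTheory.Quotient.linear K (stableRel P) (fun c _ _ f g h => stableRel_smul P c f g h)

/-- A choice, for each object `X` of `P`, of a conflation `0 ⟶ X ⟶ I X ⟶ Σ X ⟶ 0` with
`I X` injective. -/
structure CosyzygyChoice where
  I : P.FullSubcategory → P.FullSubcategory
  cosyz : P.FullSubcategory → P.FullSubcategory
  ι : ∀ X, X ⟶ I X
  π : ∀ X, I X ⟶ cosyz X
  conflation : ∀ X, IsConflation (ι X) (π X)
  injective : ∀ X, IsInj (I X)

variable {P}

/-- A shift and a class of distinguished triangles on the stable category are induced by the exact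
structure of `P` if, up to isomorphisms `e X : (stable X)⟦1⟧ ≅ Σ X`:
* the shift sends the class of `f : X ⟶ Y` to the class of any `ψ : Σ X ⟶ Σ Y` completing `f` to a
  morphism from the chosen conflation of `X` to the one of `Y`;
* the distinguished triangles are the triangles isomorphic to some `X ⟶ Y ⟶ Z ⟶ Σ X`, the class
  of `(f, g, h)`, where `(f, g)` is a conflation and the morphism of conflations
  `(𝟙, φ, h) : (f, g) ⟶ (ι X, π X)` commutes. -/
def IsInducedTriangulation (D : CosyzygyChoice P) [HasZeroObject (StableCategory P)]
    [HasShift (StableCategory P) ℤ] [∀ n : ℤ, (shiftFunctor (StableCategory P) n).Additive]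
    [Pretriangulated (StableCategory P)] : Prop :=
  ∃ e : ∀ X : P.FullSubcategory,
      (shiftFunctor (StableCategory P) (1 : ℤ)).obj ((stabilisation P).obj X) ≅
        (stabilisation P).obj (D.cosyz X),
    (∀ (X Y : P.FullSubcategory) (f : X ⟶ Y) (φ : D.I X ⟶ D.I Y) (ψ : D.cosyz X ⟶ D.cosyz Y),
      D.ι X ≫ φ = f ≫ D.ι Y → D.π X ≫ ψ = φ ≫ D.π Y →
        (shiftFunctor (StableCategory P) (1 : ℤ)).map ((stabilisation P).map f) ≫ (e Y).hom =
          (e X).hom ≫ (stabilisation P).map ψ) ∧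
    ∀ T : Pretriangulated.Triangle (StableCategory P),
      T ∈ Pretriangulated.distinguishedTriangles ↔
        ∃ (X Y Z : P.FullSubcategory) (f : X ⟶ Y) (g : Y ⟶ Z) (φ : Y ⟶ D.I X)
          (h : Z ⟶ D.cosyz X),
          IsConflation f g ∧ f ≫ φ = D.ι X ∧ g ≫ h = φ ≫ D.π X ∧
            Nonempty (T ≅ Pretriangulated.Triangle.mk ((stabilisation P).map f)
              ((stabilisation P).map g) ((stabilisation P).map h ≫ (e X).inv))

end Frobenius

/-! ## Representations of the circle -/

/-- The circle `ℝ / 2πℤ` as the set of objects of a category. -/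
structure CircleCat where
  pt : AddCircle (2 * Real.pi)

/-- The morphisms `x ⟶ y` are the anticlockwise paths from `x` to `y`, encoded by their lengths;
composition is concatenation. The path `g_{xy}` is the one with length in `[0, 2π)`, and adding
`2πn` to the length amounts to composing with `n` full turns. -/
noncomputable instance : Category CircleCat where
  Hom x y := {l : ℝ // 0 ≤ l ∧ x.pt + (l : AddCircle (2 * Real.pi)) = y.pt}
  id x := ⟨0, le_refl _, by simp⟩
  comp {x y z} f g := ⟨f.1 + g.1, add_nonneg f.2.1 g.2.1, by
    rw [AddCircle.coe_add, ← add_assoc, f.2.2, g.2.2]⟩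
  id_comp f := Subtype.ext (zero_add _)
  comp_id f := Subtype.ext (add_zero _)
  assoc f g h := Subtype.ext (add_assoc _ _ _)

namespace CircleCat

/-- The image of a real number under the covering map `ℝ → S¹`. -/
noncomputable def ofReal (t : ℝ) : CircleCat := ⟨(t : AddCircle (2 * Real.pi))⟩

/-- The anticlockwise path of length `t - s` from the image of `s` to the image of `t`. -/
noncomputable def path {s t : ℝ} (h : s ≤ t) : ofReal s ⟶ ofReal t :=
  ⟨t - s, sub_nonneg.mpr h, by simp [ofReal]⟩

end CircleCat

/-- Representations of the circle over `K`. -/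
abbrev CircleRep (K : Type u) [Field K] := CircleCat ⥤ ModuleCat.{u} K

section String

variable (K : Type u) [Field K] (U : Set ℝ)

/-- The elements of the fibre of the covering map over `x` which belong to `U`. -/
abbrev Fibre (x : CircleCat) := {b : ℝ // b ∈ U ∧ CircleCat.ofReal b = x}

open Classical in
/-- The basis vector `b` is sent along a path of length `l` to the basis vector `b + l` if
`b + l ∈ U`, and to zero otherwise. -/
noncomputable def stringMap {x y : CircleCat} (f : x ⟶ y) : (Fibre U x →₀ K) →ₗ[K] (Fibre U y →₀ K) :=
  Finsupp.linearCombination K fun b : Fibre U x =>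
    if h : b.1 + f.1 ∈ U then
      Finsupp.single (⟨b.1 + f.1, h, by
        have h1 : (b.1 : AddCircle (2 * Real.pi)) = x.pt := congrArg CircleCat.pt b.2.2
        have h2 : x.pt + (f.1 : AddCircle (2 * Real.pi)) = y.pt := f.2.2
        cases y
        simp only [CircleCat.ofReal, AddCircle.coe_add, h1, h2]⟩ : Fibre U y) (1 : K)
    else 0

variable {U}

/-- The string representation of an interval `U`: its value at `x` is the vector space with basis
the fibre over `x` intersected with `U`. -/
noncomputable def stringRep (hU : U.OrdConnected) : CircleRep K where
  obj x := ModuleCat.of K (Fibre U x →₀ K)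
  map f := ModuleCat.ofHom (stringMap K U f)
  map_id x := by
    ext1
    refine Finsupp.lhom_ext' fun b => LinearMap.ext_ring ?_
    have h : b.1 + (𝟙 x : x ⟶ x).1 = b.1 := add_zero _
    simp [stringMap, h, b.2.1]
  map_comp {x y z} f g := by
    ext1
    refine Finsupp.lhom_ext' fun b => LinearMap.ext_ring ?_
    have h : b.1 + (f ≫ g).1 = b.1 + f.1 + g.1 := (add_assoc _ _ _).symm
    by_cases h2 : b.1 + f.1 + g.1 ∈ U
    · have h1 : b.1 + f.1 ∈ U :=
        hU.out b.2.1 h2 ⟨le_add_of_nonneg_right f.2.1, le_add_of_nonneg_right g.2.1⟩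
      simp [stringMap, h, h1, h2]
    · by_cases h1 : b.1 + f.1 ∈ U
      · simp [stringMap, h, h1, h2]
      · simp [stringMap, h, h1, h2]

end String

section Nakayama

variable {K : Type u} [Field K]

/-- Continuous Nakayama representations of `(S¹, κ)`: pointwise finite dimensional representations
each of whose indecomposable direct summands is a string of some bounded interval `U` contained in
`[inf U, inf U + κ (inf U)]`. -/
def IsContinuousNakayama (κ : ℝ → ℝ) : ObjectProperty (CircleRep K) := fun M =>
  (∀ x, FiniteDimensional K (M.obj x)) ∧
    ∀ N N' : CircleRep K, IsIndecomposable N → Nonempty (M ≅ N ⊞ N') →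
      ∃ (U : Set ℝ) (hU : U.OrdConnected), Bornology.IsBounded U ∧
        U ⊆ Set.Icc (sInf U) (sInf U + κ (sInf U)) ∧ Nonempty (N ≅ stringRep K hU)

end Nakayama

/-! ## The `∞`-gon and its representations -/

/-- An `∞`-gon with `m` two-sided accumulation points, seen in `[0, 2π]`. The accumulation points
are `0 = acc 0 < acc 1 < ⋯ < acc (m - 1)`, and `acc m = 2π` is the first of them again. For each
`p` a copy `point p` of `ℤ` lies between `acc p` and `acc (p + 1)` and accumulates exactly there. -/
structure InfinityGon (m : ℕ) where
  acc : Fin (m + 1) → ℝ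
  acc_strictMono : StrictMono acc
  acc_zero : acc 0 = 0
  acc_last : acc (Fin.last m) = 2 * Real.pi
  point : Fin m → ℤ → ℝ
  point_strictMono : ∀ p, StrictMono (point p)
  tendsto_atBot : ∀ p, Filter.Tendsto (point p) Filter.atBot (nhds (acc p.castSucc))
  tendsto_atTop : ∀ p, Filter.Tendsto (point p) Filter.atTop (nhds (acc p.succ))

namespace InfinityGon

/-- For every positive `m` there is an `∞`-gon with `m` accumulation points. -/
theorem nonempty {m : ℕ} (hm : 0 < m) : Nonempty (InfinityGon m) := by
  have hm' : (0 : ℝ) < m := by exact_mod_cast hm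
  have hpi := Real.pi_pos
  have key : ∀ p : Fin m, ∀ c : ℝ,
      2 * Real.pi / m * ((p : ℕ) + 1 / 2 + c / Real.pi)
        = 2 * Real.pi / m * ((p : ℕ) + 1 / 2) + 2 / m * c := by
    intro p c
    field_simp
  refine ⟨{
    acc := fun k => 2 * Real.pi / m * (k : ℕ)
    acc_strictMono := fun a b h => by
      have h' : ((a : ℕ) : ℝ) < (b : ℕ) := by exact_mod_cast h
      have : 0 < 2 * Real.pi / m := by positivity
      exact mul_lt_mul_of_pos_left h' this
    acc_zero := by simp
    acc_last := by simp only [Fin.val_last]; field_simp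
    point := fun p n => 2 * Real.pi / m * ((p : ℕ) + 1 / 2 + Real.arctan n / Real.pi)
    point_strictMono := fun p a b h => by
      have h' : (a : ℝ) < b := by exact_mod_cast h
      have h2 : 0 < 2 / (m : ℝ) := by positivity
      simp only [key]
      have := mul_lt_mul_of_pos_left (Real.arctan_strictMono h') h2
      linarith
    tendsto_atBot := fun p => ?_
    tendsto_atTop := fun p => ?_ }⟩
  · have h := (Real.tendsto_arctan_atBot.mono_right nhdsWithin_le_nhds).comp
      (tendsto_intCast_atBot_iff.2 Filter.tendsto_id)
    have h2 := (h.const_mul (2 / (m : ℝ))).const_add (2 * Real.pi / m * ((p : ℕ) + 1 / 2))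
    simp only [key]
    have e : 2 * Real.pi / m * ((p.castSucc : ℕ) : ℝ)
        = 2 * Real.pi / m * ((p : ℕ) + 1 / 2) + 2 / (m : ℝ) * (-(Real.pi / 2)) := by
      simp only [Fin.val_castSucc]
      field_simp
      ring
    rw [e]
    exact h2
  · have h := (Real.tendsto_arctan_atTop.mono_right nhdsWithin_le_nhds).comp
      (tendsto_intCast_atTop_atTop (R := ℝ))
    have h2 := (h.const_mul (2 / (m : ℝ))).const_add (2 * Real.pi / m * ((p : ℕ) + 1 / 2))
    simp only [key]
    have e : 2 * Real.pi / m * ((p.succ : ℕ) : ℝ)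
        = 2 * Real.pi / m * ((p : ℕ) + 1 / 2) + 2 / (m : ℝ) * (Real.pi / 2) := by
      have : ((p.succ : ℕ) : ℝ) = (p : ℕ) + 1 := by simp
      rw [this]
      field_simp
      ring
    rw [e]
    exact h2

variable {m : ℕ} (Z : InfinityGon m)

open Classical in
/-- The Kupisch function: `κ t = 2π + z⁺ - s` if the representative `s ∈ [0, 2π)` of `t` modulo
`2π` lies in `[z, z⁺)` for a point `z` with successor `z⁺`, and `κ t = 2π` if `s` is an accumulation
point. -/
noncomputable def kupisch (t : ℝ) : ℝ :=
  if h : ∃ q : Fin m × ℤ,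
      toIcoMod Real.two_pi_pos 0 t ∈ Set.Ico (Z.point q.1 q.2) (Z.point q.1 (q.2 + 1)) then
    2 * Real.pi + Z.point h.choose.1 (h.choose.2 + 1) - toIcoMod Real.two_pi_pos 0 t
  else 2 * Real.pi

/-- A real number whose image in the circle is a point of the `∞`-gon. -/
def IsLift (t : ℝ) : Prop :=
  ∃ (p : Fin m) (n : ℤ), CircleCat.ofReal t = CircleCat.ofReal (Z.point p n)

/-- The infinite discrete symmetric Nakayama representations: the continuous Nakayama
representations `M` of `(S¹, κ)` such that the maps `M (g_{xy})` are isomorphisms for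
`z < x ≤ y ≤ z⁺`, and, for each accumulation point `p`, also for `a < x ≤ y ≤ b`, where `a < p < b`
(in cyclic order) are suitable points of the `∞`-gon. Cyclically ordered points are lifted to
increasing real numbers within a full turn. -/
def rep (K : Type u) [Field K] : ObjectProperty (CircleRep K) := fun M =>
  IsContinuousNakayama Z.kupisch M ∧
    (∀ (p : Fin m) (n : ℤ) (x y : ℝ) (hxy : x ≤ y), Z.point p n < x → y ≤ Z.point p (n + 1) →
      IsIso (M.map (CircleCat.path hxy))) ∧
    ∀ p : Fin m, ∃ a b : ℝ, Z.IsLift a ∧ Z.IsLift b ∧ a < Z.acc p.castSucc ∧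
      Z.acc p.castSucc < b ∧ b < a + 2 * Real.pi ∧
      ∀ (x y : ℝ) (hxy : x ≤ y), a < x → y ≤ b → IsIso (M.map (CircleCat.path hxy))

end InfinityGon

/-- The category `C_{-1,m}`: the stable category of `rep(Z_m, κ)`. -/
abbrev NegCYCategory {m : ℕ} (Z : InfinityGon m) (K : Type u) [Field K] :=
  StableCategory (Z.rep K)

end NakayamaCY

open NakayamaCY

/-!
The theorem rests on an intrinsic description of `rep(Z_m, κ)`. Lift everything to the real line, so
that a path of the circle becomes a segment `[b, c]`, and call a representation *tame* if it is
pointwise finite dimensional and satisfies the two conditions on isomorphisms. Then the objects of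
`rep(Z_m, κ)` are the tame representations on which each path that starts at a point of the `∞`-gon
and is longer than a full turn acts as zero (`rep_iff`). This condition is inherited by kernels,
cokernels and direct sums, so `rep(Z_m, κ)` is an abelian category with exact inclusion; and
tameness passes to extensions, which is closure under extensions in the sense required. Each nonzero
object has a string of an interval `(i, j]` as a retract, where `i` and `j` are lifted points of the
`∞`-gon and `j ≤ i⁺ + 2π` (`IsDiscreteNakayama.exists_retract`): `j` is the last point on which `i⁺`
acts nontrivially, and `i⁺` the first point which acts nontrivially on `j`. Since spaces of
morphisms are finite dimensional, induction on the dimension of the endomorphism algebra splits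
every object into strings.

The strings of maximal length `(i, i⁺ + 2π]` represent the evaluation at `i⁺`, and corepresent the
dual of the evaluation at `i⁺ + 2π`, which is the same point of the circle. They are therefore
projective and injective, and every string is a quotient and a subobject of one of them. This gives
the Frobenius property, and minimality of the dimension of the endomorphism algebra together with
the Fitting decomposition gives projective covers and injective envelopes.

The stable category is triangulated by Happel's theorem, which is proved in the section on the
triangulation for any abelian Frobenius subcategory. The cosyzygy functor `Σ` is an autoequivalence;
a `ℤ`-shift whose unit is `Σ` comes from the reindexing of spectra, sequences with isomorphisms `Σ
(X n) ≅ X (n + 1)`.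

For Serre duality, send an endomorphism of the string of `(i, i⁺ + 2π]` to its coefficient from the
first to the last basis vector over `i⁺`. This is a symmetric form on the projective objects: it is
invariant under cyclic permutation, and it makes `Hom(Q, M)` and `Hom(M, Q)` dual to each other for
`Q` projective. For a conflation `X ⟶ I ⟶ Σ X` with maps `ι` and `π`, the form `(f, g) ↦ t (π f g
ι)` on `Hom(Σ X, B) × Hom(B, X)` has the stably trivial morphisms as its kernels on both sides
(`SymmetricForm.mem_projHom_left`, `SymmetricForm.mem_projHom_right`). So it induces a perfect
pairing of stable morphisms, whence `Σ⁻¹` is a Serre functor. The strings which are not of maximal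
length have scalar endomorphisms, so that indecomposable objects of the stable category have
one-dimensional endomorphism algebras; this yields the Krull--Schmidt property and `dim Hom(c, Σ⁻¹
c) = 1`. Any choice of the isomorphisms `θ_i` then differs from the Serre form by an automorphism of
the object, hence its trace pairing is nondegenerate as well.
-/

namespace NakayamaCY

/-! ### The `ℤ`-shift generated by an autoequivalence -/

section Spectra

variable {C : Type w} [Category.{v} C] (F : C ⥤ C)

/-- A spectrum for an endofunctor `F`: a sequence of objects `X n`, `n ∈ ℤ`, with isomorphisms
`F (X n) ≅ X (n + 1)`. The index `n + 1` is a variable `m`, so that reindexing is strict. -/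
structure Spectrum where
  X : ℤ → C
  φ : ∀ n m : ℤ, n + 1 = m → (F.obj (X n) ≅ X m)

namespace Spectrum

variable {F}

/-- A morphism of spectra is a sequence of morphisms which is compatible with the structure
isomorphisms. -/
@[ext]
structure Hom (S T : Spectrum F) where
  f : ∀ n, S.X n ⟶ T.X n
  comm : ∀ n m (h : n + 1 = m), F.map (f n) ≫ (T.φ n m h).hom = (S.φ n m h).hom ≫ f m

instance : Category (Spectrum F) where
  Hom := Hom
  id S := ⟨fun _ => 𝟙 _, by simp⟩
  comp a b := ⟨fun n => a.f n ≫ b.f n, fun n m h => by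
    rw [F.map_comp, Category.assoc, b.comm, ← Category.assoc, a.comm, Category.assoc]⟩
  id_comp _ := Hom.ext (funext fun _ => Category.id_comp _)
  comp_id _ := Hom.ext (funext fun _ => Category.comp_id _)
  assoc _ _ _ := Hom.ext (funext fun _ => Category.assoc _ _ _)

@[simp] lemma id_f (S : Spectrum F) (n : ℤ) : Hom.f (𝟙 S) n = 𝟙 _ := rfl

@[simp] lemma comp_f {S T U : Spectrum F} (a : S ⟶ T) (b : T ⟶ U) (n : ℤ) :
    Hom.f (a ≫ b) n = a.f n ≫ b.f n := rfl

@[ext] lemma hom_ext {S T : Spectrum F} {a b : S ⟶ T} (h : ∀ n, a.f n = b.f n) : a = b :=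
  Hom.ext (funext h)

lemma eqToHom_f {S T : Spectrum F} (h : S = T) (n : ℤ) :
    (eqToHom h).f n = eqToHom (by rw [h]) := by
  subst h; rfl

lemma map_eqToHom_comp_φ (S : Spectrum F) {n n' m m' : ℤ} (hn : n = n') (h : n + 1 = m)
    (h' : n' + 1 = m') :
    F.map (eqToHom (congrArg S.X hn)) ≫ (S.φ n' m' h').hom =
      (S.φ n m h).hom ≫ eqToHom (congrArg S.X (by omega)) := by
  subst hn h h'; simp

lemma f_eqToHom {S T : Spectrum F} (a : S ⟶ T) {n m : ℤ} (h : n = m) :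
    a.f n ≫ eqToHom (congrArg T.X h) = eqToHom (congrArg S.X h) ≫ a.f m := by
  subst h; simp

/-- An isomorphism of spectra given by equal objects. -/
@[simps]
def isoMk {S T : Spectrum F} (e : ∀ n, S.X n ≅ T.X n)
    (comm : ∀ n m (h : n + 1 = m),
      F.map (e n).hom ≫ (T.φ n m h).hom = (S.φ n m h).hom ≫ (e m).hom) : S ≅ T where
  hom := ⟨fun n => (e n).hom, comm⟩
  inv := ⟨fun n => (e n).inv, fun n m h => by
    rw [← cancel_mono (e m).hom, Category.assoc, Category.assoc, Iso.inv_hom_id, Category.comp_id,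
      ← comm n m h, ← F.map_comp_assoc, Iso.inv_hom_id, F.map_id, Category.id_comp]⟩
  hom_inv_id := by ext n; exact (e n).hom_inv_id
  inv_hom_id := by ext n; exact (e n).inv_hom_id

variable (F) in
/-- Reindexing a spectrum by `n ↦ n + k`. -/
@[simps]
def shift (k : ℤ) : Spectrum F ⥤ Spectrum F where
  obj S := ⟨fun n => S.X (n + k), fun n m h => S.φ (n + k) (m + k) (by omega)⟩
  map a := ⟨fun n => a.f (n + k), fun n m h => a.comm _ _ _⟩

variable (F) in
/-- Reindexing by the identity. -/
def shiftZero : shift F 0 ≅ 𝟭 _ :=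
  NatIso.ofComponents (fun S => isoMk (fun n => eqToIso (congrArg S.X (add_zero n)))
      (fun n m h => S.map_eqToHom_comp_φ (add_zero n) _ h))
    (fun a => by ext n; exact f_eqToHom a (add_zero n))

variable (F) in
/-- Reindexing twice. -/
def shiftAdd (k l : ℤ) : shift F (k + l) ≅ shift F k ⋙ shift F l :=
  NatIso.ofComponents (fun S =>
      isoMk (fun n => eqToIso (congrArg S.X (show n + (k + l) = n + l + k by ring)))
        (fun n m h => S.map_eqToHom_comp_φ (show n + (k + l) = n + l + k by ring) _ _))
    (fun a => by ext n; exact f_eqToHom a (show n + (k + l) = n + l + k by ring))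

lemma shiftAdd_hom_app_f (k l : ℤ) (S : Spectrum F) (n : ℤ) :
    ((shiftAdd F k l).hom.app S).f n =
      eqToHom (congrArg S.X (show n + (k + l) = n + l + k by ring)) := rfl

lemma shiftZero_inv_app_f (S : Spectrum F) (n : ℤ) :
    ((shiftZero F).inv.app S).f n = eqToHom (congrArg S.X (add_zero n).symm) := rfl

/-- Reindexing is strictly compatible with addition, and so all coherences are equalities of
objects. -/
noncomputable instance : HasShift (Spectrum F) ℤ :=
  hasShiftMk _ _
    { F := shift F
      zero := shiftZero F
      add := shiftAdd F
      assoc_hom_app := fun k l r S => by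
        ext n
        simp only [comp_f, shiftAdd_hom_app_f, eqToHom_f, shift_map_f]
        exact (eqToHom_trans _ _).trans
          (((eqToHom_trans _ _).symm.trans (congrArg _ (eqToHom_trans _ _).symm)))
      zero_add_hom_app := fun k S => by
        ext n
        simp only [comp_f, shiftAdd_hom_app_f, eqToHom_f, shift_map_f, shiftZero_inv_app_f]
        exact (eqToHom_trans _ _).symm
      add_zero_hom_app := fun k S => by
        ext n
        simp only [comp_f, shiftAdd_hom_app_f, eqToHom_f, shiftZero_inv_app_f]
        exact (eqToHom_trans _ _).symm }

variable (F) in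
/-- The zeroth term of a spectrum. -/
@[simps]
def eval : Spectrum F ⥤ C where
  obj S := S.X 0
  map a := a.f 0

/-- The terms of a morphism of spectra are determined by the zeroth one, upwards by the structure
isomorphisms and downwards since `F` is faithful. -/
instance [F.Faithful] : (eval F).Faithful where
  map_injective {S T} a b h := by
    have h0 : a.f 0 = b.f 0 := h
    have up : ∀ n : ℕ, a.f n = b.f n := by
      intro n
      induction n with
      | zero => exact h0
      | succ n ih =>
        have ha := a.comm n (n + 1 : ℕ) (by simp)
        have hb := b.comm n (n + 1 : ℕ) (by simp)
        rw [ih, hb] at ha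
        exact ((cancel_epi _).1 ha).symm
    have down : ∀ n : ℕ, a.f (-n) = b.f (-n) := by
      intro n
      induction n with
      | zero => simpa using h0
      | succ n ih =>
        have ha := a.comm (-(n + 1 : ℕ)) (-n) (by push_cast; ring)
        have hb := b.comm (-(n + 1 : ℕ)) (-n) (by push_cast; ring)
        rw [ih, ← hb] at ha
        exact F.map_injective ((cancel_mono _).1 ha)
    ext n
    obtain ⟨k, rfl | rfl⟩ := n.eq_nat_or_neg
    exacts [up k, down k]

/-- The terms of nonnegative index of the morphism of spectra extending a morphism of the zeroth
terms. -/
def extendNat (S T : Spectrum F) (a : S.X 0 ⟶ T.X 0) : ∀ n : ℕ, S.X (Int.ofNat n) ⟶ T.X (Int.ofNat n)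
  | 0 => a
  | n + 1 =>
      (S.φ (Int.ofNat n) (Int.ofNat (n + 1)) rfl).inv ≫ F.map (extendNat S T a n) ≫
        (T.φ (Int.ofNat n) (Int.ofNat (n + 1)) rfl).hom

/-- The terms of negative index of the morphism of spectra extending a morphism of the zeroth
terms. -/
noncomputable def extendNeg [F.Full] (S T : Spectrum F) (a : S.X 0 ⟶ T.X 0) :
    ∀ n : ℕ, S.X (Int.negSucc n) ⟶ T.X (Int.negSucc n)
  | 0 => F.preimage ((S.φ (Int.negSucc 0) 0 rfl).hom ≫ a ≫ (T.φ (Int.negSucc 0) 0 rfl).inv)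
  | n + 1 => F.preimage ((S.φ (Int.negSucc (n + 1)) (Int.negSucc n) rfl).hom ≫
      extendNeg S T a n ≫ (T.φ (Int.negSucc (n + 1)) (Int.negSucc n) rfl).inv)

/-- The terms of the morphism of spectra extending a morphism of the zeroth terms. -/
noncomputable def extend [F.Full] (S T : Spectrum F) (a : S.X 0 ⟶ T.X 0) : ∀ n : ℤ, S.X n ⟶ T.X n
  | Int.ofNat n => extendNat S T a n
  | Int.negSucc n => extendNeg S T a n

instance [F.Full] : (eval F).Full where
  map_surjective {S T} (a : S.X 0 ⟶ T.X 0) := by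
    refine ⟨⟨extend S T a, ?_⟩, by rfl⟩
    rintro (n | _ | n) m rfl
    · change F.map (extendNat S T a n) ≫ (T.φ (Int.ofNat n) (Int.ofNat (n + 1)) rfl).hom =
        (S.φ (Int.ofNat n) (Int.ofNat (n + 1)) rfl).hom ≫ extendNat S T a (n + 1)
      exact (Iso.hom_inv_id_assoc _ _).symm
    · change F.map (F.preimage _) ≫ (T.φ (Int.negSucc 0) 0 rfl).hom =
        (S.φ (Int.negSucc 0) 0 rfl).hom ≫ a
      rw [F.map_preimage, Category.assoc, Category.assoc, Iso.inv_hom_id,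
        Category.comp_id]
    · change F.map (F.preimage _) ≫
        (T.φ (Int.negSucc (n + 1)) (Int.negSucc n) rfl).hom =
        (S.φ (Int.negSucc (n + 1)) (Int.negSucc n) rfl).hom ≫ extendNeg S T a n
      rw [F.map_preimage, Category.assoc, Category.assoc, Iso.inv_hom_id,
        Category.comp_id]

variable (F) in
/-- The terms of nonnegative index of a spectrum with a given zeroth term. -/
def termNat (X : C) : ℕ → C
  | 0 => X
  | n + 1 => F.obj (termNat X n)

variable (F) in
/-- The terms of negative index of a spectrum with a given zeroth term. -/
noncomputable def termNeg [F.EssSurj] (X : C) : ℕ → C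
  | 0 => F.objPreimage X
  | n + 1 => F.objPreimage (termNeg X n)

variable (F) in
/-- The terms of a spectrum with a given zeroth term. -/
noncomputable def term [F.EssSurj] (X : C) : ℤ → C
  | Int.ofNat n => termNat F X n
  | Int.negSucc n => termNeg F X n

variable (F) in
/-- The structure isomorphisms of a spectrum with a given zeroth term. -/
noncomputable def termIso [F.EssSurj] (X : C) : ∀ n : ℤ, F.obj (term F X n) ≅ term F X (n + 1)
  | Int.ofNat n => Iso.refl (termNat F X (n + 1))
  | Int.negSucc 0 => F.objObjPreimageIso X
  | Int.negSucc (n + 1) => F.objObjPreimageIso (termNeg F X n)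

variable (F) in
/-- A spectrum with a given zeroth term. -/
noncomputable def mkOfObj [F.EssSurj] (X : C) : Spectrum F where
  X := term F X
  φ := fun n _ h => termIso F X n ≪≫ eqToIso (congrArg _ h)

instance [F.EssSurj] : (eval F).EssSurj where
  mem_essImage X := ⟨mkOfObj F X, ⟨Iso.refl X⟩⟩

instance [F.IsEquivalence] : (eval F).IsEquivalence where

end Spectrum

/-- The `ℤ`-shift on `C` obtained from the reindexing of spectra. -/
noncomputable abbrev hasShiftOfEquivalence [F.IsEquivalence] : HasShift C ℤ :=
  HasShift.induced (Spectrum.eval F) ℤ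
    (fun k => (Spectrum.eval F).inv ⋙ shiftFunctor (Spectrum F) k ⋙ Spectrum.eval F)
    (fun _ => (Functor.associator _ _ _).symm ≪≫
      Functor.isoWhiskerRight (Spectrum.eval F).asEquivalence.unitIso.symm _ ≪≫
        Functor.leftUnitor _)

/-- The shift by one of `hasShiftOfEquivalence` is the given equivalence. -/
noncomputable def shiftOneIso [F.IsEquivalence] :
    letI := hasShiftOfEquivalence F
    shiftFunctor C (1 : ℤ) ≅ F :=
  letI := hasShiftOfEquivalence F
  Functor.isoWhiskerLeft (Spectrum.eval F).inv
    (NatIso.ofComponents (fun S => (S.φ 0 (0 + 1) rfl).symm)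
      (fun {S T} a => by
        have := a.comm 0 (0 + 1) rfl
        exact (Iso.comp_inv_eq _).2
          ((((S.φ 0 (0 + 1) rfl).inv_comp_eq).2 this).symm.trans (Category.assoc _ _ _).symm)) :
      shiftFunctor (Spectrum F) (1 : ℤ) ⋙ Spectrum.eval F ≅ Spectrum.eval F ⋙ F) ≪≫
    (Functor.associator _ _ _).symm ≪≫
    Functor.isoWhiskerRight (Spectrum.eval F).asEquivalence.counitIso F ≪≫ Functor.leftUnitor _

end Spectra

/-! ### Conflations in an abelian Frobenius subcategory -/

section Conflations

variable {A : Type w} [Category.{v} A] [Abelian A] {P : ObjectProperty A}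

namespace IsConflation

variable {X Y Z : P.FullSubcategory} {f : X ⟶ Y} {g : Y ⟶ Z}

lemma comp_eq_zero (h : IsConflation f g) : f ≫ g = 0 := by
  obtain ⟨h, -⟩ := h
  exact ObjectProperty.hom_ext _ h

lemma mono (h : IsConflation f g) : Mono f.hom := by
  obtain ⟨h, hS⟩ := h
  exact hS.mono_f

lemma epi (h : IsConflation f g) : Epi g.hom := by
  obtain ⟨h, hS⟩ := h
  exact hS.epi_g

lemma cancel_left (h : IsConflation f g) {W : P.FullSubcategory} {a b : W ⟶ X}
    (hab : a ≫ f = b ≫ f) : a = b := by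
  have := h.mono
  exact ObjectProperty.hom_ext _ ((cancel_mono f.hom).1 (congrArg (·.hom) hab))

lemma cancel_right (h : IsConflation f g) {W : P.FullSubcategory} {a b : Z ⟶ W}
    (hab : g ≫ a = g ≫ b) : a = b := by
  have := h.epi
  exact ObjectProperty.hom_ext _ ((cancel_epi g.hom).1 (congrArg (·.hom) hab))

lemma exists_lift (h : IsConflation f g) {W : P.FullSubcategory} (a : W ⟶ Y) (ha : a ≫ g = 0) :
    ∃ b : W ⟶ X, b ≫ f = a := by
  obtain ⟨h, hS⟩ := h
  have := hS.mono_f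
  obtain ⟨l, hl⟩ := KernelFork.IsLimit.lift' hS.exact.fIsKernel a.hom (congrArg (·.hom) ha)
  exact ⟨ObjectProperty.homMk l, ObjectProperty.hom_ext _ hl⟩

lemma exists_desc (h : IsConflation f g) {W : P.FullSubcategory} (a : Y ⟶ W) (ha : f ≫ a = 0) :
    ∃ b : Z ⟶ W, g ≫ b = a := by
  obtain ⟨h, hS⟩ := h
  have := hS.epi_g
  obtain ⟨l, hl⟩ := CokernelCofork.IsColimit.desc' hS.exact.gIsCokernel a.hom
    (congrArg (·.hom) ha)
  exact ⟨ObjectProperty.homMk l, ObjectProperty.hom_ext _ hl⟩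

/-- Exactness at the middle term, tested on arbitrary objects of the ambient category. -/
lemma exists_refinement (h : IsConflation f g) {W : A} (y : W ⟶ Y.obj) (hy : y ≫ g.hom = 0) :
    ∃ x : W ⟶ X.obj, x ≫ f.hom = y := by
  obtain ⟨h, hS⟩ := h
  have := hS.mono_f
  obtain ⟨l, hl⟩ := KernelFork.IsLimit.lift' hS.exact.fIsKernel y hy
  exact ⟨l, hl⟩

/-- A conflation is recognised on generalised elements of the ambient category. -/
lemma of_refinements (h0 : f ≫ g = 0) [Mono f.hom] [Epi g.hom]
    (h : ∀ (W : A) (y : W ⟶ Y.obj), y ≫ g.hom = 0 →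
      ∃ (W' : A) (p : W' ⟶ W) (_ : Epi p) (x : W' ⟶ X.obj), p ≫ y = x ≫ f.hom) :
    IsConflation f g :=
  ⟨congrArg (·.hom) h0, .mk' (((ShortComplex.mk f.hom g.hom
    (congrArg (·.hom) h0)).exact_iff_exact_up_to_refinements).2 h) ‹_› ‹_›⟩

end IsConflation

lemma projHom_of_isProj_left {X Y : P.FullSubcategory} (hX : IsProj X) (f : X ⟶ Y) :
    f ∈ projHom P X Y := AddSubgroup.subset_closure ⟨X, 𝟙 X, f, hX, by simp⟩

lemma projHom_of_fac {X Q Y : P.FullSubcategory} (hQ : IsProj Q) (a : X ⟶ Q) (b : Q ⟶ Y) :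
    a ≫ b ∈ projHom P X Y := AddSubgroup.subset_closure ⟨Q, a, b, hQ, rfl⟩

/-- Stably trivial morphisms lift along deflations. -/
lemma IsConflation.exists_lifting {X Y Z W : P.FullSubcategory} {i : X ⟶ Y} {p : Y ⟶ Z}
    (h : IsConflation i p) {f : W ⟶ Z} (hf : f ∈ projHom P W Z) :
    ∃ c ∈ projHom P W Y, c ≫ p = f := by
  induction hf using AddSubgroup.closure_induction with
  | mem f hf =>
    obtain ⟨Q, a, b, hQ, rfl⟩ := hf
    obtain ⟨k, hk⟩ := hQ i p h b
    exact ⟨a ≫ k, projHom_of_fac hQ a k, by rw [Category.assoc, hk]⟩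
  | zero => exact ⟨0, zero_mem _, zero_comp⟩
  | add f f' _ _ hf hf' =>
    obtain ⟨c, hc, rfl⟩ := hf
    obtain ⟨c', hc', rfl⟩ := hf'
    exact ⟨c + c', add_mem hc hc', Preadditive.add_comp _ _ _ _ _ _⟩
  | neg f _ hf =>
    obtain ⟨c, hc, rfl⟩ := hf
    exact ⟨-c, neg_mem hc, Preadditive.neg_comp _ _⟩

/-- In a morphism `(f, χ, k)` of conflations whose source has a projective middle term, `f` is
stably trivial if `k` is. -/
lemma projHom_first {X I S X' I' S' : P.FullSubcategory} {i : X ⟶ I} {p : I ⟶ S} {i' : X' ⟶ I'}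
    {p' : I' ⟶ S'} (h : IsConflation i p) (h' : IsConflation i' p') (hI : IsProj I)
    {f : X ⟶ X'} {χ : I ⟶ I'} {k : S ⟶ S'} (hk : k ∈ projHom P S S') (h1 : i ≫ χ = f ≫ i')
    (h2 : p ≫ k = χ ≫ p') : f ∈ projHom P X X' := by
  obtain ⟨c, -, rfl⟩ := h'.exists_lifting hk
  obtain ⟨d, hd⟩ := h'.exists_lift (χ - p ≫ c) (by simp [h2])
  have : f = i ≫ d := h'.cancel_left (by
    rw [Category.assoc, hd, Preadditive.comp_sub, ← Category.assoc i p, h.comp_eq_zero, zero_comp,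
      sub_zero, h1])
  rw [this]
  exact projHom_of_fac hI i d

lemma stab_map_eq_iff {X Y : P.FullSubcategory} (f g : X ⟶ Y) :
    (stabilisation P).map f = (stabilisation P).map g ↔ f - g ∈ projHom P X Y :=
  CategoryTheory.Quotient.functor_map_eq_iff _ _ _

lemma stab_map_eq_zero_iff {X Y : P.FullSubcategory} (f : X ⟶ Y) :
    (stabilisation P).map f = 0 ↔ f ∈ projHom P X Y := by
  rw [← (stabilisation P).map_zero, stab_map_eq_iff, sub_zero]

/-- A morphism of the first terms extends to a morphism of conflations. -/
lemma exists_third {X I S X' I' S' : P.FullSubcategory} {i : X ⟶ I} {p : I ⟶ S} {i' : X' ⟶ I'}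
    {p' : I' ⟶ S'} (h : IsConflation i p) (h' : IsConflation i' p') (hI' : IsInj I')
    (f : X ⟶ X') : ∃ (χ : I ⟶ I') (k : S ⟶ S'), i ≫ χ = f ≫ i' ∧ p ≫ k = χ ≫ p' := by
  obtain ⟨χ, hχ⟩ := hI' i p h (f ≫ i')
  obtain ⟨k, hk⟩ := h.exists_desc (χ ≫ p') (by
    rw [← Category.assoc, hχ, Category.assoc, h'.comp_eq_zero, comp_zero])
  exact ⟨χ, k, hχ, hk⟩

namespace CosyzygyChoice

variable (D : CosyzygyChoice P)

lemma exists_maps {X Y : P.FullSubcategory} (f : X ⟶ Y) :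
    ∃ (χ : D.I X ⟶ D.I Y) (k : D.cosyz X ⟶ D.cosyz Y),
      D.ι X ≫ χ = f ≫ D.ι Y ∧ D.π X ≫ k = χ ≫ D.π Y :=
  exists_third (D.conflation X) (D.conflation Y) (D.injective Y) f

/-- A chosen extension of a morphism to the injective objects of the chosen conflations. -/
noncomputable def mapI {X Y : P.FullSubcategory} (f : X ⟶ Y) : D.I X ⟶ D.I Y :=
  (D.exists_maps f).choose

/-- A chosen morphism induced on the cosyzygies. -/
noncomputable def mapCosyz {X Y : P.FullSubcategory} (f : X ⟶ Y) : D.cosyz X ⟶ D.cosyz Y :=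
  (D.exists_maps f).choose_spec.choose

lemma ι_mapI {X Y : P.FullSubcategory} (f : X ⟶ Y) : D.ι X ≫ D.mapI f = f ≫ D.ι Y :=
  (D.exists_maps f).choose_spec.choose_spec.1

lemma π_mapCosyz {X Y : P.FullSubcategory} (f : X ⟶ Y) :
    D.π X ≫ D.mapCosyz f = D.mapI f ≫ D.π Y :=
  (D.exists_maps f).choose_spec.choose_spec.2

end CosyzygyChoice

variable (P) in
/-- `P` is a full abelian subcategory of `A` with an exact inclusion. -/
class IsAbelianSubcategory : Prop where
  zero : ∃ X : A, IsZero X ∧ P X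
  biprod : ∀ X Y : A, P X → P Y → P (X ⊞ Y)
  kernel : ∀ S : ShortComplex A, S.ShortExact → P S.X₂ → P S.X₃ → P S.X₁
  cokernel : ∀ S : ShortComplex A, S.ShortExact → P S.X₁ → P S.X₂ → P S.X₃

variable (P) in
/-- `P` is a full abelian subcategory of `A` with an exact inclusion, and it is a Frobenius
category: there are enough projective and enough injective objects, and these coincide. -/
class IsFrobeniusAbelian : Prop extends IsAbelianSubcategory P where
  enough_projectives : ∀ X : P.FullSubcategory, ∃ (K Q : P.FullSubcategory) (i : K ⟶ Q) (p : Q ⟶ X),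
    IsProj Q ∧ IsConflation i p
  enough_injectives : ∀ X : P.FullSubcategory, ∃ (I Y : P.FullSubcategory) (i : X ⟶ I) (p : I ⟶ Y),
    IsInj I ∧ IsConflation i p
  proj_iff_inj : ∀ X : P.FullSubcategory, IsProj X ↔ IsInj X

section AbelianSubcategory

variable [hP : IsAbelianSubcategory P]

lemma exists_conflation_of_mono {X Y : P.FullSubcategory} (f : X ⟶ Y) [Mono f.hom] :
    ∃ (Z : P.FullSubcategory) (g : Y ⟶ Z), IsConflation f g := by
  have hS : (ShortComplex.mk f.hom (Limits.cokernel.π f.hom) (by simp)).ShortExact :=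
    .mk' (ShortComplex.exact_cokernel f.hom) ‹_› inferInstance
  exact ⟨⟨_, hP.cokernel _ hS X.2 Y.2⟩, ObjectProperty.homMk (Limits.cokernel.π f.hom), _, hS⟩

lemma exists_conflation_of_epi {Y Z : P.FullSubcategory} (g : Y ⟶ Z) [Epi g.hom] :
    ∃ (X : P.FullSubcategory) (f : X ⟶ Y), IsConflation f g := by
  have hS : (ShortComplex.mk (Limits.kernel.ι g.hom) g.hom (by simp)).ShortExact :=
    .mk' (ShortComplex.exact_kernel g.hom) inferInstance ‹_›
  exact ⟨⟨_, hP.kernel _ hS Y.2 Z.2⟩, ObjectProperty.homMk (Limits.kernel.ι g.hom), _, hS⟩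

instance hasZeroObject_fullSubcategory : HasZeroObject P.FullSubcategory := by
  obtain ⟨X, hX, h⟩ := hP.zero
  refine ⟨⟨X, h⟩, (IsZero.iff_id_eq_zero _).2 (ObjectProperty.hom_ext _ ?_)⟩
  exact (IsZero.iff_id_eq_zero _).1 hX

instance hasBinaryBiproducts_fullSubcategory : HasBinaryBiproducts P.FullSubcategory where
  has_binary_biproduct X Y := by
    let b : BinaryBicone X Y :=
      { pt := ⟨X.obj ⊞ Y.obj, hP.biprod _ _ X.2 Y.2⟩
        fst := ObjectProperty.homMk biprod.fst
        snd := ObjectProperty.homMk biprod.snd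
        inl := ObjectProperty.homMk biprod.inl
        inr := ObjectProperty.homMk biprod.inr
        inl_fst := ObjectProperty.hom_ext _ biprod.inl_fst
        inl_snd := ObjectProperty.hom_ext _ biprod.inl_snd
        inr_fst := ObjectProperty.hom_ext _ biprod.inr_fst
        inr_snd := ObjectProperty.hom_ext _ biprod.inr_snd }
    exact .mk ⟨b, isBinaryBilimitOfTotal b (ObjectProperty.hom_ext _ biprod.total)⟩

lemma IsProj.biprod {X Y : P.FullSubcategory} (hX : IsProj X) (hY : IsProj Y) :
    IsProj (X ⊞ Y) := fun _ _ _ f g hfg h => by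
  obtain ⟨a, ha⟩ := hX f g hfg (biprod.inl ≫ h)
  obtain ⟨b, hb⟩ := hY f g hfg (biprod.inr ≫ h)
  exact ⟨biprod.desc a b, biprod.hom_ext' _ _ (by simp [ha]) (by simp [hb])⟩

lemma IsInj.biprod {X Y : P.FullSubcategory} (hX : IsInj X) (hY : IsInj Y) :
    IsInj (X ⊞ Y) := fun _ _ _ f g hfg h => by
  obtain ⟨a, ha⟩ := hX f g hfg (h ≫ biprod.fst)
  obtain ⟨b, hb⟩ := hY f g hfg (h ≫ biprod.snd)
  exact ⟨biprod.lift a b, biprod.hom_ext _ _ (by simp [ha]) (by simp [hb])⟩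

end AbelianSubcategory

variable [hP : IsFrobeniusAbelian P]

/-- Stably trivial morphisms extend along inflations. -/
lemma IsConflation.exists_extension {X Y Z W : P.FullSubcategory} {i : X ⟶ Y} {p : Y ⟶ Z}
    (h : IsConflation i p) {f : X ⟶ W} (hf : f ∈ projHom P X W) :
    ∃ c ∈ projHom P Y W, i ≫ c = f := by
  induction hf using AddSubgroup.closure_induction with
  | mem f hf =>
    obtain ⟨Q, a, b, hQ, rfl⟩ := hf
    obtain ⟨k, hk⟩ := (hP.proj_iff_inj Q).1 hQ i p h a
    exact ⟨k ≫ b, projHom_of_fac hQ k b, by rw [← Category.assoc, hk]⟩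
  | zero => exact ⟨0, zero_mem _, comp_zero⟩
  | add f f' _ _ hf hf' =>
    obtain ⟨c, hc, rfl⟩ := hf
    obtain ⟨c', hc', rfl⟩ := hf'
    exact ⟨c + c', add_mem hc hc', Preadditive.comp_add _ _ _ _ _ _⟩
  | neg f _ hf =>
    obtain ⟨c, hc, rfl⟩ := hf
    exact ⟨-c, neg_mem hc, Preadditive.comp_neg _ _⟩

/-- In a morphism `(f, χ, k)` of conflations whose target has a projective middle term, `k` is
stably trivial if `f` is. -/
lemma projHom_third {X I S X' I' S' : P.FullSubcategory} {i : X ⟶ I} {p : I ⟶ S} {i' : X' ⟶ I'}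
    {p' : I' ⟶ S'} (h : IsConflation i p) (h' : IsConflation i' p') (hI' : IsProj I')
    {f : X ⟶ X'} {χ : I ⟶ I'} {k : S ⟶ S'} (hf : f ∈ projHom P X X') (h1 : i ≫ χ = f ≫ i')
    (h2 : p ≫ k = χ ≫ p') : k ∈ projHom P S S' := by
  obtain ⟨c, -, rfl⟩ := h.exists_extension hf
  obtain ⟨d, hd⟩ := h.exists_desc (χ - c ≫ i') (by simp [h1])
  have : k = d ≫ p' := h.cancel_right (by
    rw [← Category.assoc, hd, Preadditive.sub_comp, Category.assoc, h'.comp_eq_zero, comp_zero,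
      sub_zero, h2])
  rw [this]
  exact projHom_of_fac hI' d p'

/-- The third component of a morphism of conflations into one with a projective middle term is
stably determined by the first one. -/
lemma third_unique {X I S X' I' S' : P.FullSubcategory} {i : X ⟶ I} {p : I ⟶ S} {i' : X' ⟶ I'}
    {p' : I' ⟶ S'} (h : IsConflation i p) (h' : IsConflation i' p') (hI' : IsProj I')
    {f f' : X ⟶ X'} {χ χ' : I ⟶ I'} {k k' : S ⟶ S'} (hf : f - f' ∈ projHom P X X')
    (h1 : i ≫ χ = f ≫ i') (h2 : p ≫ k = χ ≫ p') (h1' : i ≫ χ' = f' ≫ i')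
    (h2' : p ≫ k' = χ' ≫ p') : (stabilisation P).map k = (stabilisation P).map k' :=
  (CategoryTheory.Quotient.functor_map_eq_iff _ _ _).2
    (projHom_third h h' hI' hf (χ := χ - χ') (by simp [h1, h1']) (by simp [h2, h2']))

/-- The third terms of two conflations with the same first term and projective middle terms are
stably isomorphic. -/
noncomputable def thirdIso {X I S I' S' : P.FullSubcategory} {i : X ⟶ I} {p : I ⟶ S} {i' : X ⟶ I'}
    {p' : I' ⟶ S'} (h : IsConflation i p) (h' : IsConflation i' p') (hI : IsInj I)
    (hI' : IsInj I') : (stabilisation P).obj S ≅ (stabilisation P).obj S' :=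
  have h1 := exists_third h h' hI' (𝟙 X)
  have h2 := exists_third h' h hI (𝟙 X)
  { hom := (stabilisation P).map h1.choose_spec.choose
    inv := (stabilisation P).map h2.choose_spec.choose
    hom_inv_id := by
      obtain ⟨a, a'⟩ := h1.choose_spec.choose_spec
      obtain ⟨b, b'⟩ := h2.choose_spec.choose_spec
      rw [← (stabilisation P).map_comp, ← (stabilisation P).map_id]
      refine third_unique h h ((hP.proj_iff_inj _).2 hI) (f := 𝟙 X) (f' := 𝟙 X)
        (χ := h1.choose ≫ h2.choose) (χ' := 𝟙 _) ?_ ?_ ?_ ?_ ?_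
      · simp
      · rw [← Category.assoc, a, Category.assoc, b]; simp
      · rw [← Category.assoc, a', Category.assoc, b', Category.assoc]
      · simp
      · simp
    inv_hom_id := by
      obtain ⟨a, a'⟩ := h1.choose_spec.choose_spec
      obtain ⟨b, b'⟩ := h2.choose_spec.choose_spec
      rw [← (stabilisation P).map_comp, ← (stabilisation P).map_id]
      refine third_unique h' h' ((hP.proj_iff_inj _).2 hI') (f := 𝟙 X) (f' := 𝟙 X)
        (χ := h2.choose ≫ h1.choose) (χ' := 𝟙 _) ?_ ?_ ?_ ?_ ?_
      · simp
      · rw [← Category.assoc, b, Category.assoc, a]; simp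
      · rw [← Category.assoc, b', Category.assoc, a', Category.assoc]
      · simp
      · simp }

/-! ### The cosyzygy functor on the stable category -/

namespace CosyzygyChoice

variable (D : CosyzygyChoice P)

lemma isProj_I (X : P.FullSubcategory) : IsProj (D.I X) := (hP.proj_iff_inj _).2 (D.injective X)

/-- The morphism induced on the cosyzygies is stably well defined. -/
lemma stab_map_eq_mapCosyz {X Y : P.FullSubcategory} {f : X ⟶ Y} {χ : D.I X ⟶ D.I Y}
    {k : D.cosyz X ⟶ D.cosyz Y} (h1 : D.ι X ≫ χ = f ≫ D.ι Y) (h2 : D.π X ≫ k = χ ≫ D.π Y) :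
    (stabilisation P).map k = (stabilisation P).map (D.mapCosyz f) :=
  third_unique (D.conflation X) (D.conflation Y) (D.isProj_I Y) (by simp) h1 h2 (D.ι_mapI f)
    (D.π_mapCosyz f)

/-- The cosyzygy functor on the stable category. -/
noncomputable def sigma : StableCategory P ⥤ StableCategory P :=
  CategoryTheory.Quotient.lift _
    { obj := fun X => (stabilisation P).obj (D.cosyz X)
      map := fun f => (stabilisation P).map (D.mapCosyz f)
      map_id := fun X => by
        rw [← (stabilisation P).map_id]
        exact (D.stab_map_eq_mapCosyz (χ := 𝟙 _) (by simp) (by simp)).symm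
      map_comp := fun f g => by
        rw [← (stabilisation P).map_comp]
        refine (D.stab_map_eq_mapCosyz (χ := D.mapI f ≫ D.mapI g) ?_ ?_).symm
        · rw [← Category.assoc, D.ι_mapI, Category.assoc, D.ι_mapI, Category.assoc]
        · rw [← Category.assoc, D.π_mapCosyz, Category.assoc, D.π_mapCosyz, Category.assoc] }
    (fun X Y f g h => third_unique (D.conflation X) (D.conflation Y) (D.isProj_I Y) h
      (D.ι_mapI f) (D.π_mapCosyz f) (D.ι_mapI g) (D.π_mapCosyz g))

lemma sigma_map {X Y : P.FullSubcategory} (f : X ⟶ Y) :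
    D.sigma.map ((stabilisation P).map f) = (stabilisation P).map (D.mapCosyz f) := rfl

instance : D.sigma.Additive where
  map_add {X Y f g} := by
    obtain ⟨f, rfl⟩ := (stabilisation P).map_surjective f
    obtain ⟨g, rfl⟩ := (stabilisation P).map_surjective g
    rw [← (stabilisation P).map_add]
    exact (D.stab_map_eq_mapCosyz (f := f + g) (χ := D.mapI f + D.mapI g)
      (k := D.mapCosyz f + D.mapCosyz g) (by simp [D.ι_mapI]) (by simp [D.π_mapCosyz])).symm

instance {K : Type u} [Field K] [Linear K A] : D.sigma.Linear K where
  map_smul {X Y} f c := by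
    obtain ⟨f, rfl⟩ := (stabilisation P).map_surjective f
    exact (D.stab_map_eq_mapCosyz (f := c • f) (χ := c • D.mapI f) (k := c • D.mapCosyz f)
      (by simp [D.ι_mapI]) (by simp [D.π_mapCosyz])).symm

instance : D.sigma.Faithful where
  map_injective {X Y} f g h := by
    obtain ⟨f, rfl⟩ := (stabilisation P).map_surjective f
    obtain ⟨g, rfl⟩ := (stabilisation P).map_surjective g
    refine (stab_map_eq_iff _ _).2 (projHom_first (D.conflation X.as) (D.conflation Y.as)
      (D.isProj_I _) ((stab_map_eq_iff _ _).1 h) (χ := D.mapI f - D.mapI g) ?_ ?_)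
    · simp [D.ι_mapI]
    · simp [D.π_mapCosyz]

instance : D.sigma.Full where
  map_surjective {X Y} k := by
    obtain ⟨k, rfl⟩ := (stabilisation P).map_surjective k
    obtain ⟨χ, hχ⟩ := D.isProj_I X.as _ _ (D.conflation Y.as) (D.π X.as ≫ k)
    obtain ⟨f, hf⟩ := (D.conflation Y.as).exists_lift (D.ι X.as ≫ χ) (by
      rw [Category.assoc, hχ, ← Category.assoc, (D.conflation _).comp_eq_zero, zero_comp])
    exact ⟨(stabilisation P).map f, (D.stab_map_eq_mapCosyz hf.symm hχ.symm).symm⟩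

instance : D.sigma.EssSurj where
  mem_essImage X := by
    obtain ⟨K, Q, i, p, hQ, h⟩ := hP.enough_projectives X.as
    exact ⟨(stabilisation P).obj K, ⟨thirdIso (D.conflation K) h (D.injective K)
      ((hP.proj_iff_inj _).1 hQ)⟩⟩

instance : D.sigma.IsEquivalence where

end CosyzygyChoice

end Conflations

/-! ### Rotating triangles backwards -/

section Rotation

open Pretriangulated

variable {C : Type w} [Category.{v} C] [Preadditive C] [HasShift C ℤ]

/-- Exactness of `Hom(B, -)` on a triangle is invariant under isomorphisms. -/
lemma exact_of_iso {T S : Triangle C} (i : T ≅ S) {B : C}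
    (exact : ∀ a : B ⟶ S.obj₂, a ≫ S.mor₂ = 0 → ∃ b : B ⟶ S.obj₁, b ≫ S.mor₁ = a)
    (a : B ⟶ T.obj₂) (ha : a ≫ T.mor₂ = 0) : ∃ b : B ⟶ T.obj₁, b ≫ T.mor₁ = a := by
  obtain ⟨b, hb⟩ := exact (a ≫ i.hom.hom₂) (by
    rw [Category.assoc, ← i.hom.comm₂, ← Category.assoc, ha, zero_comp])
  refine ⟨b ≫ i.inv.hom₁, ?_⟩
  rw [Category.assoc, ← i.inv.comm₁, ← Category.assoc, hb, Category.assoc]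
  simp

omit [Preadditive C] in
/-- The completion of morphisms of triangles is invariant under isomorphisms. -/
lemma completion_of_iso {T₁ T₂ S₁ S₂ : Triangle C} (i : T₁ ≅ S₁) (j : T₂ ≅ S₂)
    (compl : ∀ (a : S₁.obj₁ ⟶ S₂.obj₁) (b : S₁.obj₂ ⟶ S₂.obj₂), S₁.mor₁ ≫ b = a ≫ S₂.mor₁ →
      ∃ c : S₁.obj₃ ⟶ S₂.obj₃, S₁.mor₂ ≫ c = b ≫ S₂.mor₂ ∧ S₁.mor₃ ≫ a⟦1⟧' = c ≫ S₂.mor₃)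
    (a : T₁.obj₁ ⟶ T₂.obj₁) (b : T₁.obj₂ ⟶ T₂.obj₂) (hab : T₁.mor₁ ≫ b = a ≫ T₂.mor₁) :
    ∃ c : T₁.obj₃ ⟶ T₂.obj₃, T₁.mor₂ ≫ c = b ≫ T₂.mor₂ ∧ T₁.mor₃ ≫ a⟦1⟧' = c ≫ T₂.mor₃ := by
  obtain ⟨c, hc1, hc2⟩ := compl (i.inv.hom₁ ≫ a ≫ j.hom.hom₁) (i.inv.hom₂ ≫ b ≫ j.hom.hom₂) (by
    rw [← Category.assoc, i.inv.comm₁, Category.assoc, Category.assoc, Category.assoc,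
      ← j.hom.comm₁, ← Category.assoc a, ← hab, Category.assoc])
  refine ⟨i.hom.hom₃ ≫ c ≫ j.inv.hom₃, ?_, ?_⟩
  · rw [← Category.assoc, i.hom.comm₂, Category.assoc, ← Category.assoc _ c, hc1,
      Category.assoc, Category.assoc, Category.assoc, j.inv.comm₂]
    simp
  · rw [Category.assoc, Category.assoc, ← j.inv.comm₃, ← Category.assoc c, ← hc2,
      ← Category.assoc i.hom.hom₃, ← Category.assoc i.hom.hom₃, ← i.hom.comm₃]
    simp only [Functor.map_comp, Category.assoc]
    rw [← Functor.map_comp_assoc, ← Functor.map_comp]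
    simp

variable [∀ n : ℤ, (shiftFunctor C n).Additive]

/-- For a class of triangles which satisfies the other axioms of a pretriangulated category and on
which the functors `Hom(A, -)` are exact, closure under rotation implies closure under inverse
rotation: the cone of the first morphism of `T` is compared with `T` after rotating three times. -/
lemma mem_of_rotate_mem (dist : Set (Triangle C))
    (iso : ∀ T₁ ∈ dist, ∀ T₂ : Triangle C, (T₂ ≅ T₁) → T₂ ∈ dist)
    (cone : ∀ {X Y : C} (f : X ⟶ Y), ∃ (Z : C) (g : Y ⟶ Z) (h : Z ⟶ X⟦(1 : ℤ)⟧),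
      Triangle.mk f g h ∈ dist)
    (rot : ∀ T ∈ dist, T.rotate ∈ dist)
    (compl : ∀ T₁ ∈ dist, ∀ T₂ ∈ dist, ∀ (a : T₁.obj₁ ⟶ T₂.obj₁) (b : T₁.obj₂ ⟶ T₂.obj₂),
      T₁.mor₁ ≫ b = a ≫ T₂.mor₁ →
      ∃ c : T₁.obj₃ ⟶ T₂.obj₃, T₁.mor₂ ≫ c = b ≫ T₂.mor₂ ∧ T₁.mor₃ ≫ a⟦1⟧' = c ≫ T₂.mor₃)
    (comp_zero : ∀ T ∈ dist, T.mor₁ ≫ T.mor₂ = 0)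
    (exact : ∀ T ∈ dist, ∀ {A : C} (a : A ⟶ T.obj₂), a ≫ T.mor₂ = 0 →
      ∃ b : A ⟶ T.obj₁, b ≫ T.mor₁ = a)
    (T : Triangle C) (hT : T.rotate ∈ dist) : T ∈ dist := by
  obtain ⟨X, Y, Z, u, v, w⟩ := T
  obtain ⟨Z', v', w', hT'⟩ := cone u
  have hT2 := rot _ hT
  have hT3 := rot _ hT2
  have hT'1 := rot _ hT'
  have hT'2 := rot _ hT'1
  have hT'3 := rot _ hT'2
  have zero_vw : v ≫ w = 0 := comp_zero _ hT
  have zero_uv : u ≫ v = 0 := by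
    have h : (-u⟦(1 : ℤ)⟧') ≫ (-v⟦(1 : ℤ)⟧') = 0 := comp_zero _ hT3
    rw [Preadditive.neg_comp, Preadditive.comp_neg, neg_neg, ← Functor.map_comp] at h
    exact (shiftFunctor C (1 : ℤ)).map_injective (h.trans (Functor.map_zero _ _ _).symm)
  have zero_w'u : w' ≫ u⟦(1 : ℤ)⟧' = 0 := by
    have h : w' ≫ (-u⟦(1 : ℤ)⟧') = 0 := comp_zero _ hT'2
    rwa [Preadditive.comp_neg, neg_eq_zero] at h
  -- after three rotations the triangles begin with the same (shifted) morphism and can be compared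
  obtain ⟨θ, h1, h2⟩ : ∃ θ : Z⟦(1 : ℤ)⟧ ⟶ Z'⟦(1 : ℤ)⟧,
      (-v⟦(1 : ℤ)⟧') ≫ θ = 𝟙 (Y⟦(1 : ℤ)⟧) ≫ (-v'⟦(1 : ℤ)⟧') ∧
      (-w⟦(1 : ℤ)⟧') ≫ (𝟙 (X⟦(1 : ℤ)⟧))⟦(1 : ℤ)⟧' = θ ≫ (-w'⟦(1 : ℤ)⟧') :=
    compl _ hT3 _ hT'3 (𝟙 (X⟦(1 : ℤ)⟧)) (𝟙 (Y⟦(1 : ℤ)⟧))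
      ((Category.comp_id _).trans (Category.id_comp _).symm)
  obtain ⟨ζ, rfl⟩ := (shiftFunctor C (1 : ℤ)).map_surjective θ
  have h1 : v ≫ ζ = v' := by
    rw [Preadditive.neg_comp, Category.id_comp, neg_inj, ← Functor.map_comp] at h1
    exact (shiftFunctor C (1 : ℤ)).map_injective h1
  have h2 : w = ζ ≫ w' := by
    rw [CategoryTheory.Functor.map_id, Category.comp_id, Preadditive.comp_neg, neg_inj,
      ← Functor.map_comp] at h2
    exact (shiftFunctor C (1 : ℤ)).map_injective h2
  -- `ζ` is a monomorphism, and it has a right inverse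
  have inj : ∀ {A : C} (z : A ⟶ Z), z ≫ ζ = 0 → z = 0 := by
    intro A z hz
    obtain ⟨y, rfl⟩ : ∃ y : A ⟶ Y, y ≫ v = z := exact _ hT z (by
      change z ≫ w = 0
      rw [h2, ← Category.assoc, hz, Limits.zero_comp])
    obtain ⟨x, rfl⟩ : ∃ x : A ⟶ X, x ≫ u = y := exact _ hT' y (by
      change y ≫ v' = 0
      rw [← h1, ← Category.assoc, hz])
    rw [Category.assoc, zero_uv, Limits.comp_zero]
  obtain ⟨η, hη⟩ : ∃ η : Z' ⟶ Z, η ≫ ζ = 𝟙 Z' := by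
    obtain ⟨z, hz⟩ : ∃ z : Z' ⟶ Z, z ≫ w = w' := exact _ hT2 w' (by
      change w' ≫ (-u⟦(1 : ℤ)⟧') = 0
      rw [Preadditive.comp_neg, zero_w'u, neg_zero])
    obtain ⟨y, hy⟩ : ∃ y : Z' ⟶ Y, y ≫ v' = 𝟙 Z' - z ≫ ζ := exact _ hT'1 (𝟙 Z' - z ≫ ζ) (by
      change (𝟙 Z' - z ≫ ζ) ≫ w' = 0
      rw [Preadditive.sub_comp, Category.id_comp, Category.assoc, ← h2, hz, sub_self])
    exact ⟨z + y ≫ v, by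
      rw [Preadditive.add_comp, Category.assoc, h1, hy, add_sub_cancel]⟩
  let i : Z ≅ Z' :=
    { hom := ζ
      inv := η
      hom_inv_id := by
        rw [← sub_eq_zero]
        refine inj _ ?_
        rw [Preadditive.sub_comp, Category.assoc, hη, Category.comp_id, Category.id_comp, sub_self]
      inv_hom_id := hη }
  refine iso _ hT' _ (Triangle.isoMk _ _ (Iso.refl X) (Iso.refl Y) i ?_ ?_ ?_)
  · exact (Category.comp_id _).trans (Category.id_comp _).symm
  · exact h1.trans (Category.id_comp _).symm
  · change w ≫ (𝟙 X)⟦(1 : ℤ)⟧' = ζ ≫ w'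
    rw [CategoryTheory.Functor.map_id, Category.comp_id, h2]

end Rotation

/-! ### The triangulation of the stable category -/

section Triangulation

open Pretriangulated

variable {A : Type w} [Category.{v} A] [Abelian A] {P : ObjectProperty A}

/-- A conflation `X ⟶ Y ⟶ Z` with a morphism `(𝟙, φ, h)` to the chosen conflation of `X`. -/
structure ConflationTriangle (D : CosyzygyChoice P) where
  X : P.FullSubcategory
  Y : P.FullSubcategory
  Z : P.FullSubcategory
  f : X ⟶ Y
  g : Y ⟶ Z
  φ : Y ⟶ D.I X
  h : Z ⟶ D.cosyz X
  conflation : IsConflation f g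
  fφ : f ≫ φ = D.ι X
  gh : g ≫ h = φ ≫ D.π X

lemma exists_conflationTriangle (D : CosyzygyChoice P) {X Y Z : P.FullSubcategory} {f : X ⟶ Y}
    {g : Y ⟶ Z} (hfg : IsConflation f g) :
    ∃ (φ : Y ⟶ D.I X) (h : Z ⟶ D.cosyz X), f ≫ φ = D.ι X ∧ g ≫ h = φ ≫ D.π X := by
  obtain ⟨φ, h, h1, h2⟩ := exists_third hfg (D.conflation X) (D.injective X) (𝟙 X)
  exact ⟨φ, h, h1.trans (Category.id_comp _), h2⟩

/-- Projective objects become zero in the stable category. -/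
lemma isZero_stab_obj {X : P.FullSubcategory} (hX : IsProj X) :
    IsZero ((stabilisation P).obj X) := by
  rw [IsZero.iff_id_eq_zero, ← (stabilisation P).map_id, stab_map_eq_zero_iff]
  exact projHom_of_isProj_left hX _

variable [hP : IsFrobeniusAbelian P]

instance hasZeroObject_stableCategory : HasZeroObject (StableCategory P) := by
  obtain ⟨Z, hZ⟩ := HasZeroObject.zero (C := P.FullSubcategory)
  exact ⟨_, (stabilisation P).map_isZero hZ⟩

/-- Adding a projective summand does not change the stable isomorphism class. -/
noncomputable def stabFstIso (Y : P.FullSubcategory) {Q : P.FullSubcategory} (hQ : IsProj Q) :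
    (stabilisation P).obj (Y ⊞ Q) ≅ (stabilisation P).obj Y where
  hom := (stabilisation P).map biprod.fst
  inv := (stabilisation P).map biprod.inl
  hom_inv_id := by
    rw [← (stabilisation P).map_comp, ← (stabilisation P).map_id, stab_map_eq_iff,
      ← biprod.total, sub_add_cancel_left]
    exact neg_mem (projHom_of_fac hQ _ _)
  inv_hom_id := by
    rw [← (stabilisation P).map_comp, biprod.inl_fst, (stabilisation P).map_id]

lemma mono_biprod_lift {X Y Q : P.FullSubcategory} (f : X ⟶ Y) {i : X ⟶ Q} (hi : Mono i.hom) :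
    Mono (biprod.lift f i).hom := by
  have : Mono ((biprod.lift f i).hom ≫ (biprod.snd : Y ⊞ Q ⟶ Q).hom) := by
    rw [← ObjectProperty.FullSubcategory.comp_hom, biprod.lift_snd]
    exact hi
  exact mono_of_mono _ (biprod.snd : Y ⊞ Q ⟶ Q).hom

namespace ConflationTriangle

variable {D : CosyzygyChoice P}

/-- The conflation triangle of an identity, for a given zero object. -/
def contractible (D : CosyzygyChoice P) (X : P.FullSubcategory) {Z : P.FullSubcategory}
    (hZ : IsZero Z) : ConflationTriangle D where
  X := X
  Y := X
  Z := Z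
  f := 𝟙 X
  g := 0
  φ := D.ι X
  h := 0
  conflation := by
    have : Mono (𝟙 X : X ⟶ X).hom := inferInstanceAs (Mono (𝟙 X.obj))
    have hz : IsZero Z.obj := by
      rw [IsZero.iff_id_eq_zero]
      exact congrArg (·.hom) ((IsZero.iff_id_eq_zero _).1 hZ)
    have : Epi (0 : X ⟶ Z).hom := ⟨fun a b _ => hz.eq_of_src a b⟩
    exact .of_refinements (by simp) fun W y _ =>
      ⟨W, 𝟙 W, inferInstance, y, (Category.id_comp y).trans (Category.comp_id y).symm⟩
  fφ := Category.id_comp _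
  gh := by rw [(D.conflation X).comp_eq_zero, comp_zero]

/-- A morphism of the first two terms of conflation triangles which commutes stably completes to a
morphism of triangles. -/
lemma exists_completion (S T : ConflationTriangle D)
    (a : S.X ⟶ T.X)
    (b : (stabilisation P).obj S.Y ⟶ (stabilisation P).obj T.Y)
    (hab : (stabilisation P).map S.f ≫ b = (stabilisation P).map a ≫ (stabilisation P).map T.f) :
    ∃ c : (stabilisation P).obj S.Z ⟶ (stabilisation P).obj T.Z,
      (stabilisation P).map S.g ≫ c = b ≫ (stabilisation P).map T.g ∧
      (stabilisation P).map S.h ≫ (stabilisation P).map (D.mapCosyz a) = c ≫ (stabilisation P).map T.h := by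
  obtain ⟨b, rfl⟩ := (stabilisation P).map_surjective b
  rw [← (stabilisation P).map_comp, ← (stabilisation P).map_comp, stab_map_eq_iff] at hab
  obtain ⟨r, hr, hr'⟩ := S.conflation.exists_extension hab
  -- after correcting `b` the first square commutes on the nose
  have hb : S.f ≫ (b - r) = a ≫ T.f := by rw [Preadditive.comp_sub, hr', sub_sub_cancel]
  obtain ⟨c, hc⟩ := S.conflation.exists_desc ((b - r) ≫ T.g) (by
    rw [← Category.assoc, hb, Category.assoc, T.conflation.comp_eq_zero, comp_zero])
  refine ⟨(stabilisation P).map c, ?_, ?_⟩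
  · rw [← (stabilisation P).map_comp, hc, Preadditive.sub_comp, (stabilisation P).map_sub,
      (stabilisation P).map_comp r, (stab_map_eq_zero_iff r).2 hr, zero_comp, sub_zero,
      (stabilisation P).map_comp]
  · rw [← (stabilisation P).map_comp, ← (stabilisation P).map_comp]
    refine third_unique S.conflation (D.conflation T.X) (D.isProj_I _) (f := a) (f' := a)
      (χ := S.φ ≫ D.mapI a) (χ' := (b - r) ≫ T.φ) (by simp) ?_ ?_ ?_ ?_
    · rw [← Category.assoc, S.fφ, D.ι_mapI]
    · rw [← Category.assoc, S.gh, Category.assoc, D.π_mapCosyz, Category.assoc]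
    · rw [← Category.assoc, hb, Category.assoc, T.fφ]
    · rw [← Category.assoc, hc, Category.assoc, T.gh, Category.assoc]

variable [HasShift (StableCategory P) ℤ]
  (e : ∀ X : P.FullSubcategory, (shiftFunctor (StableCategory P) (1 : ℤ)).obj
    ((stabilisation P).obj X) ≅ (stabilisation P).obj (D.cosyz X))

/-- The triangle in the stable category defined by a conflation. -/
noncomputable def triangle (T : ConflationTriangle D) : Triangle (StableCategory P) :=
  Triangle.mk ((stabilisation P).map T.f) ((stabilisation P).map T.g)
    ((stabilisation P).map T.h ≫ (e T.X).inv)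

/-- The triangles isomorphic to those defined by conflations. -/
def dist : Set (Triangle (StableCategory P)) :=
  {T | ∃ S : ConflationTriangle D, Nonempty (T ≅ S.triangle e)}

omit hP in
lemma triangle_mem (T : ConflationTriangle D) : T.triangle e ∈ dist e := ⟨T, ⟨Iso.refl _⟩⟩

omit hP in
lemma dist_iso (T₁ : Triangle (StableCategory P)) (h₁ : T₁ ∈ dist e)
    (T₂ : Triangle (StableCategory P)) (i : T₂ ≅ T₁) : T₂ ∈ dist e := by
  obtain ⟨S, ⟨j⟩⟩ := h₁
  exact ⟨S, ⟨i ≪≫ j⟩⟩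

omit hP in
lemma comp_zero_of_mem (T : Triangle (StableCategory P)) (hT : T ∈ dist e) :
    T.mor₁ ≫ T.mor₂ = 0 := by
  obtain ⟨S, ⟨i⟩⟩ := hT
  have h : (S.triangle e).mor₁ ≫ (S.triangle e).mor₂ = 0 := by
    change (stabilisation P).map S.f ≫ (stabilisation P).map S.g = 0
    rw [← (stabilisation P).map_comp, S.conflation.comp_eq_zero, (stabilisation P).map_zero]
  rw [← cancel_mono i.hom.hom₃, Category.assoc, i.hom.comm₂, ← Category.assoc, i.hom.comm₁,
    Category.assoc, h, comp_zero, zero_comp]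

omit hP [HasShift (StableCategory P) ℤ] in
/-- Exactness of a conflation triangle: a stable lift is corrected by a stably trivial morphism,
which lifts along the deflation. -/
lemma exists_stab_lift (S : ConflationTriangle D) {B : P.FullSubcategory}
    (a : (stabilisation P).obj B ⟶ (stabilisation P).obj S.Y)
    (ha : a ≫ (stabilisation P).map S.g = 0) :
    ∃ b, b ≫ (stabilisation P).map S.f = a := by
  obtain ⟨a, rfl⟩ := (stabilisation P).map_surjective a
  rw [← (stabilisation P).map_comp, stab_map_eq_zero_iff] at ha
  obtain ⟨c, hc, hc'⟩ := S.conflation.exists_lifting ha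
  obtain ⟨b, hb⟩ := S.conflation.exists_lift (a - c) (by simp [hc'])
  refine ⟨(stabilisation P).map b, ?_⟩
  rw [← (stabilisation P).map_comp, hb, (stabilisation P).map_sub,
    (stab_map_eq_zero_iff c).2 hc, sub_zero]

omit hP in
lemma exact_of_mem (T : Triangle (StableCategory P)) (hT : T ∈ dist e) {B : StableCategory P}
    (a : B ⟶ T.obj₂) (ha : a ≫ T.mor₂ = 0) : ∃ b : B ⟶ T.obj₁, b ≫ T.mor₁ = a := by
  obtain ⟨S, ⟨i⟩⟩ := hT
  exact exact_of_iso i (fun a ha => exists_stab_lift S (B := B.as) a ha) a ha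

lemma contractible_mem (X : StableCategory P) : contractibleTriangle X ∈ dist e := by
  obtain ⟨Z, hZ⟩ := HasZeroObject.zero (C := P.FullSubcategory)
  refine ⟨contractible D X.as hZ, ⟨Triangle.isoMk _ _ (Iso.refl X) (Iso.refl X)
    ((isZero_zero _).iso ((stabilisation P).map_isZero hZ)) ?_ ?_ ?_⟩⟩
  · exact congrArg (𝟙 X ≫ ·) ((stabilisation P).map_id X.as).symm
  · exact ((stabilisation P).map_isZero hZ).eq_of_tgt _ _
  · exact (isZero_zero _).eq_of_src _ _

/-- The cone of `f` is the cokernel of the inflation `(f, ι) : X ⟶ Y ⊞ I X`, which is stably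
isomorphic to `f`. -/
lemma exists_cone {X Y : P.FullSubcategory} (f : X ⟶ Y) :
    ∃ (Z : StableCategory P) (g : (stabilisation P).obj Y ⟶ Z)
      (h : Z ⟶ ((stabilisation P).obj X)⟦(1 : ℤ)⟧),
      Triangle.mk ((stabilisation P).map f) g h ∈ dist e := by
  let i : X ⟶ Y ⊞ D.I X := biprod.lift f (D.ι X)
  have : Mono i.hom := mono_biprod_lift f (D.conflation X).mono
  obtain ⟨Z, g, hg⟩ := exists_conflation_of_mono i
  obtain ⟨h, hh⟩ := hg.exists_desc (biprod.snd ≫ D.π X) (by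
    rw [← Category.assoc, biprod.lift_snd, (D.conflation _).comp_eq_zero])
  let S : ConflationTriangle D := ⟨X, Y ⊞ D.I X, Z, i, g, biprod.snd, h, hg,
    biprod.lift_snd _ _, hh⟩
  have h1 : (stabilisation P).map f ≫ (stabFstIso Y (D.isProj_I X)).inv =
      𝟙 _ ≫ (stabilisation P).map i := by
    rw [Category.id_comp, Iso.comp_inv_eq]
    exact (congrArg _ (biprod.lift_fst f (D.ι X)).symm).trans ((stabilisation P).map_comp _ _)
  have h3 : ((stabilisation P).map h ≫ (e X).inv) ≫ (𝟙 ((stabilisation P).obj X))⟦(1 : ℤ)⟧' =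
      𝟙 _ ≫ (stabilisation P).map h ≫ (e X).inv := by
    rw [CategoryTheory.Functor.map_id, Category.comp_id, Category.id_comp]
  exact ⟨(stabilisation P).obj Z, (stabFstIso Y (D.isProj_I X)).inv ≫
    (stabilisation P).map g, (stabilisation P).map h ≫ (e X).inv, S,
    ⟨Triangle.isoMk _ _ (Iso.refl _) (stabFstIso Y (D.isProj_I X)).symm (Iso.refl _)
      h1 (Category.comp_id _) h3⟩⟩

lemma cone {X Y : StableCategory P} (f : X ⟶ Y) :
    ∃ (Z : StableCategory P) (g : Y ⟶ Z) (h : Z ⟶ X⟦(1 : ℤ)⟧), Triangle.mk f g h ∈ dist e := by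
  obtain ⟨f, rfl⟩ := (stabilisation P).map_surjective (X := X.as) (Y := Y.as) f
  exact exists_cone e f

/-- The isomorphisms `e` are compatible with the maps induced on the chosen cosyzygies. -/
def ShiftCompatible : Prop := ∀ ⦃X Y : P.FullSubcategory⦄ (f : X ⟶ Y),
  ((stabilisation P).map f)⟦(1 : ℤ)⟧' ≫ (e Y).hom =
    (e X).hom ≫ (stabilisation P).map (D.mapCosyz f)

variable {e}

lemma completion (he : ShiftCompatible e) (T₁ : Triangle (StableCategory P)) (h₁ : T₁ ∈ dist e)
    (T₂ : Triangle (StableCategory P)) (h₂ : T₂ ∈ dist e) (a : T₁.obj₁ ⟶ T₂.obj₁)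
    (b : T₁.obj₂ ⟶ T₂.obj₂) (hab : T₁.mor₁ ≫ b = a ≫ T₂.mor₁) :
    ∃ c : T₁.obj₃ ⟶ T₂.obj₃, T₁.mor₂ ≫ c = b ≫ T₂.mor₂ ∧
      T₁.mor₃ ≫ a⟦1⟧' = c ≫ T₂.mor₃ := by
  obtain ⟨S, ⟨i⟩⟩ := h₁
  obtain ⟨T, ⟨j⟩⟩ := h₂
  refine completion_of_iso i j (fun a b h => ?_) a b hab
  obtain ⟨a, rfl⟩ := (stabilisation P).map_surjective (X := S.X) (Y := T.X) a
  obtain ⟨c, hc1, hc2⟩ := exists_completion S T a b h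
  refine ⟨c, hc1, ?_⟩
  have : ((stabilisation P).map S.h ≫ (e S.X).inv) ≫ ((stabilisation P).map a)⟦(1 : ℤ)⟧' =
      c ≫ (stabilisation P).map T.h ≫ (e T.X).inv := by
    rw [← Category.assoc c, ← hc2, Iso.eq_comp_inv, Category.assoc, Category.assoc, he,
      Iso.inv_hom_id_assoc]
  exact this

variable [∀ n : ℤ, (shiftFunctor (StableCategory P) n).Additive]

omit [∀ n : ℤ, (shiftFunctor (StableCategory P) n).Additive] in
/-- The rotated conflation triangle `Y ⟶ Z ⊞ I X ⟶ Σ X`. -/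
lemma exists_rotate (he : ShiftCompatible e) (S : ConflationTriangle D) : ∃ T : ConflationTriangle D,
    Nonempty ((S.triangle e).rotate ≅ T.triangle e) := by
  obtain ⟨X, Y, Z, f, g, φ, h, hfg, hφ, hh⟩ := S
  let a : Y ⟶ Z ⊞ D.I X := biprod.lift g φ
  let b : Z ⊞ D.I X ⟶ D.cosyz X := biprod.desc h (-D.π X)
  have hab : a ≫ b = 0 := by
    rw [biprod.lift_desc, hh, Preadditive.comp_neg, add_neg_cancel]
  have := (D.conflation X).mono
  have := (D.conflation X).epi
  have := hfg.epi
  have : Epi b.hom := by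
    have : Epi ((biprod.inr : D.I X ⟶ Z ⊞ D.I X).hom ≫ b.hom) := by
      rw [← ObjectProperty.FullSubcategory.comp_hom, biprod.inr_desc]
      exact inferInstanceAs (Epi (-(D.π X).hom))
    exact epi_of_epi (biprod.inr : D.I X ⟶ Z ⊞ D.I X).hom _
  have a1 : a.hom ≫ (biprod.fst : Z ⊞ D.I X ⟶ Z).hom = g.hom :=
    congrArg (·.hom) (biprod.lift_fst g φ)
  have a2 : a.hom ≫ (biprod.snd : Z ⊞ D.I X ⟶ D.I X).hom = φ.hom :=
    congrArg (·.hom) (biprod.lift_snd g φ)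
  have b0 : b.hom = (biprod.fst : Z ⊞ D.I X ⟶ Z).hom ≫ h.hom -
      (biprod.snd : Z ⊞ D.I X ⟶ D.I X).hom ≫ (D.π X).hom := by
    have : b = biprod.fst ≫ h - biprod.snd ≫ D.π X := by
      apply biprod.hom_ext' <;> simp [b]
    rw [this]; rfl
  have hφ' : f.hom ≫ φ.hom = (D.ι X).hom := congrArg (·.hom) hφ
  have hh' : g.hom ≫ h.hom = φ.hom ≫ (D.π X).hom := congrArg (·.hom) hh
  -- the biproduct of the subcategory is a product also for objects of the ambient category
  have hext : ∀ {W : A} (s t : W ⟶ (Z ⊞ D.I X).obj),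
      s ≫ (biprod.fst : Z ⊞ D.I X ⟶ Z).hom = t ≫ (biprod.fst : Z ⊞ D.I X ⟶ Z).hom →
      s ≫ (biprod.snd : Z ⊞ D.I X ⟶ D.I X).hom = t ≫ (biprod.snd : Z ⊞ D.I X ⟶ D.I X).hom →
      s = t := by
    intro W s t h1 h2
    have ht : (biprod.fst : Z ⊞ D.I X ⟶ Z).hom ≫ (biprod.inl : Z ⟶ Z ⊞ D.I X).hom +
        (biprod.snd : Z ⊞ D.I X ⟶ D.I X).hom ≫ (biprod.inr : D.I X ⟶ Z ⊞ D.I X).hom = 𝟙 _ :=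
      congrArg (·.hom) (biprod.total (X := Z) (Y := D.I X))
    rw [← Category.comp_id s, ← Category.comp_id t, ← ht, Preadditive.comp_add,
      Preadditive.comp_add, ← Category.assoc, ← Category.assoc, h1, h2, Category.assoc,
      Category.assoc]
  have : Mono a.hom := by
    rw [Preadditive.mono_iff_cancel_zero]
    intro W y hy
    have h1 : y ≫ g.hom = 0 := by rw [← a1, ← Category.assoc, hy, zero_comp]
    have h2 : y ≫ φ.hom = 0 := by rw [← a2, ← Category.assoc, hy, zero_comp]
    obtain ⟨x, rfl⟩ := hfg.exists_refinement y h1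
    rw [Category.assoc, hφ'] at h2
    rw [(cancel_mono (D.ι X).hom).1 (h2.trans zero_comp.symm), zero_comp]
  have hc : IsConflation a b := by
    refine .of_refinements hab fun W y hy => ?_
    obtain ⟨W', p, hp, t, ht⟩ := surjective_up_to_refinements_of_epi g.hom
      (y ≫ (biprod.fst : Z ⊞ D.I X ⟶ Z).hom)
    rw [b0, Preadditive.comp_sub, sub_eq_zero, ← Category.assoc, ← Category.assoc] at hy
    obtain ⟨x, hx⟩ := (D.conflation X).exists_refinement
      (p ≫ y ≫ (biprod.snd : Z ⊞ D.I X ⟶ D.I X).hom - t ≫ φ.hom) (by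
        rw [Preadditive.sub_comp, Category.assoc, Category.assoc, Category.assoc t, ← hh',
          ← Category.assoc t, ← ht, Category.assoc p, hy, Category.assoc, sub_self])
    refine ⟨W', p, hp, t + x ≫ f.hom, hext _ _ ?_ ?_⟩
    · rw [Category.assoc, ht, Category.assoc, a1, Preadditive.add_comp, Category.assoc,
        show f.hom ≫ g.hom = 0 from congrArg (·.hom) hfg.comp_eq_zero, comp_zero, add_zero]
    · rw [Category.assoc, Category.assoc, a2, Preadditive.add_comp, Category.assoc, hφ', hx]
      abel
  -- `(c, I f)` extends `ι` along `a`, and the induced connecting morphism is `-Σ f`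
  obtain ⟨c, hc'⟩ := hfg.exists_desc (D.ι Y - φ ≫ D.mapI f) (by
    rw [Preadditive.comp_sub, ← Category.assoc, hφ, D.ι_mapI, sub_self])
  let T : ConflationTriangle D := ⟨Y, Z ⊞ D.I X, D.cosyz X, a, b, biprod.desc c (D.mapI f),
    -D.mapCosyz f, hc, by rw [biprod.lift_desc, hc', sub_add_cancel], by
      apply biprod.hom_ext'
      · simp only [b, biprod.inl_desc_assoc]
        refine hfg.cancel_right ?_
        rw [← Category.assoc, hh, ← Category.assoc g c, hc', Preadditive.sub_comp,
          (D.conflation Y).comp_eq_zero, Category.assoc, Category.assoc, Preadditive.comp_neg,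
          D.π_mapCosyz, Preadditive.comp_neg, zero_sub]
      · simp [b, D.π_mapCosyz]⟩
  have h1 : (stabilisation P).map g ≫ (stabFstIso Z (D.isProj_I X)).inv =
      𝟙 _ ≫ (stabilisation P).map a := by
    rw [Category.id_comp, Iso.comp_inv_eq]
    exact (congrArg _ (biprod.lift_fst g φ).symm).trans ((stabilisation P).map_comp _ _)
  have h2 : ((stabilisation P).map h ≫ (e X).inv) ≫ (e X).hom =
      (stabFstIso Z (D.isProj_I X)).inv ≫ (stabilisation P).map b := by
    rw [Category.assoc, Iso.inv_hom_id, Category.comp_id]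
    exact (congrArg _ (biprod.inl_desc h (-D.π X)).symm).trans ((stabilisation P).map_comp _ _)
  have h3 : (-((stabilisation P).map f)⟦(1 : ℤ)⟧') ≫ (𝟙 ((stabilisation P).obj Y))⟦(1 : ℤ)⟧' =
      (e X).hom ≫ (stabilisation P).map (-D.mapCosyz f) ≫ (e Y).inv := by
    rw [CategoryTheory.Functor.map_id, Category.comp_id, ← Category.assoc, Iso.eq_comp_inv,
      (stabilisation P).map_neg, Preadditive.neg_comp, Preadditive.comp_neg, he f]
  exact ⟨T, ⟨Triangle.isoMk _ _ (Iso.refl _) (stabFstIso Z (D.isProj_I X)).symm (e X) h1 h2 h3⟩⟩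

/-- The pretriangulated structure on the stable category. -/
noncomputable abbrev pretriangulated (he : ShiftCompatible e) : Pretriangulated (StableCategory P) where
  distinguishedTriangles := dist e
  isomorphic_distinguished := dist_iso e
  contractible_distinguished := contractible_mem e
  distinguished_cocone_triangle := cone e
  rotate_distinguished_triangle T := by
    have rot : ∀ T ∈ dist e, T.rotate ∈ dist e := by
      rintro T ⟨S, ⟨i⟩⟩
      obtain ⟨S', ⟨j⟩⟩ := exists_rotate he S
      exact ⟨S', ⟨(Pretriangulated.rotate _).mapIso i ≪≫ j⟩⟩
    exact ⟨rot T, mem_of_rotate_mem (dist e) (dist_iso e) (cone e) rot (completion he)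
      (comp_zero_of_mem e) (exact_of_mem e) T⟩
  complete_distinguished_triangle_morphism T₁ T₂ h₁ h₂ := completion he T₁ h₁ T₂ h₂

omit hP [HasShift (StableCategory P) ℤ] [∀ n : ℤ, (shiftFunctor (StableCategory P) n).Additive] in
/-- The cokernels of two inflations and of their composition form a conflation. -/
lemma isConflation_cokernels {X Y Z U V W : P.FullSubcategory} {f : X ⟶ Y} {g : Y ⟶ Z}
    {p : Y ⟶ U} {q : Z ⟶ V} {r : Z ⟶ W} (hf : IsConflation f p) (hg : IsConflation g q)
    (hfg : IsConflation (f ≫ g) r) {a : U ⟶ W} {b : W ⟶ V} (ha : p ≫ a = g ≫ r)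
    (hb : r ≫ b = q) : IsConflation a b := by
  have := hf.epi
  have := hfg.epi
  have := hg.mono
  have hb' : r.hom ≫ b.hom = q.hom := congrArg (·.hom) hb
  have ha' : p.hom ≫ a.hom = g.hom ≫ r.hom := congrArg (·.hom) ha
  have h0 : a ≫ b = 0 := hf.cancel_right (by
    rw [← Category.assoc, ha, Category.assoc, hb, hg.comp_eq_zero, comp_zero])
  have : Epi b.hom := by
    have := hg.epi
    rw [← hb'] at this
    exact epi_of_epi r.hom b.hom
  have : Mono a.hom := by
    rw [Preadditive.mono_iff_cancel_zero]
    intro T y hy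
    obtain ⟨T', π, hπ, t, ht⟩ := surjective_up_to_refinements_of_epi p.hom y
    obtain ⟨x, hx⟩ := hfg.exists_refinement (t ≫ g.hom) (by
      rw [Category.assoc, ← ha', ← Category.assoc, ← ht, Category.assoc, hy, comp_zero])
    have hx' : x ≫ f.hom = t := by
      rw [← cancel_mono g.hom, ← hx, ObjectProperty.FullSubcategory.comp_hom, Category.assoc]
    rw [← cancel_epi π, ht, ← hx', Category.assoc,
      show f.hom ≫ p.hom = 0 from congrArg (·.hom) hf.comp_eq_zero, comp_zero, comp_zero]
  refine .of_refinements h0 fun T y hy => ?_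
  obtain ⟨T', π, hπ, t, ht⟩ := surjective_up_to_refinements_of_epi r.hom y
  obtain ⟨s, hs⟩ := hg.exists_refinement t (by
    rw [← hb', ← Category.assoc, ← ht, Category.assoc, hy, comp_zero])
  exact ⟨T', π, hπ, s ≫ p.hom, by rw [ht, ← hs, Category.assoc, Category.assoc, ha']⟩

/-- The octahedral axiom: for composable inflations the octahedron is the commutative diagram of
their cokernels. -/
lemma isTriangulated (he : ShiftCompatible e) :
    letI := pretriangulated he
    IsTriangulated (StableCategory P) := by
  let := pretriangulated he
  refine IsTriangulated.mk' fun X₁ X₂ X₃ u v => ?_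
  obtain ⟨u, rfl⟩ := (stabilisation P).map_surjective (X := X₁.as) (Y := X₂.as) u
  obtain ⟨v, rfl⟩ := (stabilisation P).map_surjective (X := X₂.as) (Y := X₃.as) v
  obtain ⟨X₁⟩ := X₁
  obtain ⟨X₂⟩ := X₂
  obtain ⟨X₃⟩ := X₃
  -- the two morphisms are replaced by stably isomorphic inflations `i` and `j`
  let i : X₁ ⟶ X₂ ⊞ D.I X₁ := biprod.lift u (D.ι X₁)
  let j : X₂ ⊞ D.I X₁ ⟶ X₃ ⊞ D.I (X₂ ⊞ D.I X₁) := biprod.lift (biprod.fst ≫ v) (D.ι _)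
  have hi : Mono i.hom := mono_biprod_lift u (D.conflation X₁).mono
  have hj : Mono j.hom := mono_biprod_lift _ (D.conflation _).mono
  have hij : Mono (i ≫ j).hom := inferInstanceAs (Mono (i.hom ≫ j.hom))
  obtain ⟨Z₁₂, p, hp⟩ := exists_conflation_of_mono i
  obtain ⟨Z₂₃, q, hq⟩ := exists_conflation_of_mono j
  obtain ⟨Z₁₃, r, hr⟩ := exists_conflation_of_mono (i ≫ j)
  obtain ⟨φ₁, h₁, hφ₁, hh₁⟩ := exists_conflationTriangle D hp
  obtain ⟨φ₂, h₂, hφ₂, hh₂⟩ := exists_conflationTriangle D hq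
  obtain ⟨φ₃, h₃, hφ₃, hh₃⟩ := exists_conflationTriangle D hr
  obtain ⟨a, ha⟩ := hp.exists_desc (j ≫ r) (by rw [← Category.assoc, hr.comp_eq_zero])
  obtain ⟨b, hb⟩ := hr.exists_desc q (by rw [Category.assoc, hq.comp_eq_zero, comp_zero])
  obtain ⟨χ, hχ⟩ := hr.exists_desc (φ₂ ≫ D.mapI p) (by
    rw [Category.assoc, ← Category.assoc j, hφ₂, D.ι_mapI, ← Category.assoc, hp.comp_eq_zero,
      zero_comp])
  -- the fourth triangle is the conflation of the cokernels, with connecting morphism `h₂ (Σ p)`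
  have hab := isConflation_cokernels hp hq hr ha hb
  have haχ : a ≫ χ = D.ι Z₁₂ := hp.cancel_right (by
    rw [← Category.assoc, ha, Category.assoc, hχ, ← Category.assoc, hφ₂, D.ι_mapI])
  have hbh : b ≫ h₂ ≫ D.mapCosyz p = χ ≫ D.π Z₁₂ := hr.cancel_right (by
    rw [← Category.assoc, hb, ← Category.assoc, hh₂, Category.assoc, D.π_mapCosyz,
      ← Category.assoc, ← hχ, Category.assoc])
  -- the squares comparing `u`, `v` with the inflations `i`, `j`
  have e2 : (stabilisation P).map u ≫ (stabFstIso X₂ (D.isProj_I X₁)).inv =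
      𝟙 _ ≫ (stabilisation P).map i := by
    rw [Category.id_comp, Iso.comp_inv_eq]
    exact (congrArg _ (biprod.lift_fst u (D.ι X₁)).symm).trans ((stabilisation P).map_comp _ _)
  have e3 : (stabilisation P).map v ≫ (stabFstIso X₃ (D.isProj_I (X₂ ⊞ D.I X₁))).inv =
      (stabFstIso X₂ (D.isProj_I X₁)).inv ≫ (stabilisation P).map j := by
    rw [Iso.comp_inv_eq, Category.assoc, Iso.eq_inv_comp]
    change (stabilisation P).map biprod.fst ≫ (stabilisation P).map v =
      (stabilisation P).map j ≫ (stabilisation P).map biprod.fst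
    rw [← (stabilisation P).map_comp, ← (stabilisation P).map_comp, biprod.lift_fst]
  -- the commutativities of the octahedron
  have c1 : (stabilisation P).map p ≫ (stabilisation P).map a =
      (stabilisation P).map j ≫ (stabilisation P).map r := by
    rw [← (stabilisation P).map_comp, ← (stabilisation P).map_comp, ha]
  have c2 : (stabilisation P).map a ≫ (stabilisation P).map h₃ ≫ (e X₁).inv =
      (stabilisation P).map h₁ ≫ (e X₁).inv := by
    rw [← Category.assoc, ← (stabilisation P).map_comp]
    congr 1
    refine third_unique hp (D.conflation X₁) (D.isProj_I _) (f := 𝟙 _) (f' := 𝟙 _)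
      (χ := j ≫ φ₃) (χ' := φ₁) (by simp) ?_ ?_ ?_ ?_
    · rw [← Category.assoc, hφ₃, Category.id_comp]
    · rw [← Category.assoc, ha, Category.assoc, hh₃, Category.assoc]
    · rw [hφ₁, Category.id_comp]
    · rw [hh₁]
  have c3 : (stabilisation P).map r ≫ (stabilisation P).map b = (stabilisation P).map q := by
    rw [← (stabilisation P).map_comp, hb]
  have c4 : ((stabilisation P).map h₃ ≫ (e X₁).inv) ≫ ((stabilisation P).map i)⟦(1 : ℤ)⟧' =
      (stabilisation P).map b ≫ (stabilisation P).map h₂ ≫ (e (X₂ ⊞ D.I X₁)).inv := by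
    rw [← Category.assoc ((stabilisation P).map b), Iso.eq_comp_inv, Category.assoc,
      Category.assoc, he i, Iso.inv_hom_id_assoc, ← (stabilisation P).map_comp,
      ← (stabilisation P).map_comp]
    refine third_unique hr (D.conflation _) (D.isProj_I _) (f := i) (f' := i)
      (χ := φ₃ ≫ D.mapI i) (χ' := φ₂) (by simp) ?_ ?_ ?_ ?_
    · rw [← Category.assoc, hφ₃, D.ι_mapI]
    · rw [← Category.assoc, hh₃, Category.assoc, D.π_mapCosyz, Category.assoc]
    · rw [Category.assoc, hφ₂]
    · rw [← Category.assoc, hb, hh₂]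
  have c5 : ((stabilisation P).map h₂ ≫ (e (X₂ ⊞ D.I X₁)).inv) ≫
      ((stabilisation P).map p)⟦(1 : ℤ)⟧' =
      (stabilisation P).map (h₂ ≫ D.mapCosyz p) ≫ (e Z₁₂).inv := by
    rw [Iso.eq_comp_inv, Category.assoc, Category.assoc, he p, Iso.inv_hom_id_assoc,
      (stabilisation P).map_comp]
  have mem : Triangle.mk ((stabilisation P).map a) ((stabilisation P).map b)
      (((stabilisation P).map h₂ ≫ (e (X₂ ⊞ D.I X₁)).inv) ≫
        ((stabilisation P).map p)⟦(1 : ℤ)⟧') ∈ dist e := by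
    rw [c5]
    exact triangle_mem e ⟨_, _, _, a, b, χ, h₂ ≫ D.mapCosyz p, hab, haχ, hbh⟩
  have t₁ : Triangle.mk ((stabilisation P).map i) ((stabilisation P).map p)
      ((stabilisation P).map h₁ ≫ (e X₁).inv) ∈ dist e :=
    triangle_mem e ⟨_, _, _, i, p, φ₁, h₁, hp, hφ₁, hh₁⟩
  have t₂ : Triangle.mk ((stabilisation P).map j) ((stabilisation P).map q)
      ((stabilisation P).map h₂ ≫ (e (X₂ ⊞ D.I X₁)).inv) ∈ dist e :=
    triangle_mem e ⟨_, _, _, j, q, φ₂, h₂, hq, hφ₂, hh₂⟩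
  have t₃ : Triangle.mk ((stabilisation P).map i ≫ (stabilisation P).map j)
      ((stabilisation P).map r) ((stabilisation P).map h₃ ≫ (e X₁).inv) ∈ dist e := by
    rw [← (stabilisation P).map_comp]
    exact triangle_mem e ⟨_, _, _, i ≫ j, r, φ₃, h₃, hr, hφ₃, hh₃⟩
  exact ⟨_, _, _, _, _, _, (stabilisation P).map i, (stabilisation P).map j, Iso.refl _,
    (stabFstIso X₂ (D.isProj_I X₁)).symm, (stabFstIso X₃ (D.isProj_I (X₂ ⊞ D.I X₁))).symm, e2, e3,
    (stabilisation P).map p, (stabilisation P).map h₁ ≫ (e X₁).inv, t₁,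
    (stabilisation P).map q, (stabilisation P).map h₂ ≫ (e (X₂ ⊞ D.I X₁)).inv, t₂,
    (stabilisation P).map r, (stabilisation P).map h₃ ≫ (e X₁).inv, t₃,
    ⟨⟨(stabilisation P).map a, (stabilisation P).map b, c1, c2, c3, c4, mem⟩⟩⟩

/-- The triangulation defined by the conflations is induced by the exact structure. -/
lemma isInducedTriangulation (he : ShiftCompatible e) :
    letI := pretriangulated he
    IsInducedTriangulation D := by
  let := pretriangulated he
  refine ⟨e, fun X Y f φ ψ h1 h2 => ?_, fun T => ⟨?_, ?_⟩⟩
  · rw [he f, D.stab_map_eq_mapCosyz h1 h2]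
  · rintro ⟨⟨X, Y, Z, f, g, φ, h, hfg, h1, h2⟩, i⟩
    exact ⟨X, Y, Z, f, g, φ, h, hfg, h1, h2, i⟩
  · rintro ⟨X, Y, Z, f, g, φ, h, hfg, h1, h2, i⟩
    exact ⟨⟨X, Y, Z, f, g, φ, h, hfg, h1, h2⟩, i⟩

end ConflationTriangle

end Triangulation

/-! ### Additivity and linearity of shifts -/

section ShiftLinear

variable {C : Type w} [Category.{v} C] [HasShift C ℤ]

/-- A property of endofunctors which holds for the shifts by `1` and `-1` holds for all shifts. -/
lemma shiftFunctor_induction (p : (C ⥤ C) → Prop) (hiso : ∀ F G : C ⥤ C, (F ≅ G) → p F → p G)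
    (hid : p (𝟭 C)) (hcomp : ∀ F G : C ⥤ C, p F → p G → p (F ⋙ G))
    (h1 : p (shiftFunctor C (1 : ℤ))) (h2 : p (shiftFunctor C (-1 : ℤ))) (n : ℤ) :
    p (shiftFunctor C n) := by
  induction n using Int.induction_on with
  | zero => exact hiso _ _ (shiftFunctorZero C ℤ).symm hid
  | succ n ih => exact hiso _ _ (shiftFunctorAdd C (n : ℤ) 1).symm (hcomp _ _ ih h1)
  | pred n ih =>
    exact hiso _ _ (shiftFunctorAdd' C (-n : ℤ) (-1) (-n - 1) rfl).symm (hcomp _ _ ih h2)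

lemma shiftFunctor_additive [Preadditive C] (F : C ⥤ C) [F.Additive]
    (e : shiftFunctor C (1 : ℤ) ≅ F) (n : ℤ) : (shiftFunctor C n).Additive := by
  have h1 : (shiftFunctor C (1 : ℤ)).Additive := Functor.additive_of_iso e.symm
  have : (shiftEquiv C (1 : ℤ)).functor.Additive := h1
  have h2 : (shiftFunctor C (-1 : ℤ)).Additive :=
    inferInstanceAs ((shiftEquiv C (1 : ℤ)).inverse.Additive)
  exact shiftFunctor_induction (fun F => F.Additive) (fun F G i h => Functor.additive_of_iso i)
    inferInstance (fun F G _ _ => inferInstance) h1 h2 n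

lemma shiftFunctor_linear {K : Type u} [Field K] [Preadditive C] [Linear K C] (F : C ⥤ C)
    [F.Linear K] (e : shiftFunctor C (1 : ℤ) ≅ F) (n : ℤ) : (shiftFunctor C n).Linear K := by
  have h1 : (shiftFunctor C (1 : ℤ)).Linear K := Functor.linear_of_iso K e.symm
  have : (shiftEquiv C (1 : ℤ)).functor.Linear K := h1
  have h2 : (shiftFunctor C (-1 : ℤ)).Linear K :=
    inferInstanceAs ((shiftEquiv C (1 : ℤ)).inverse.Linear K)
  exact shiftFunctor_induction (fun F : C ⥤ C => F.Linear K) (fun F G i (h : F.Linear K) => Functor.linear_of_iso K i)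
    inferInstance (fun F G _ _ => inferInstance) h1 h2 n

end ShiftLinear

/-! ### Serre duality from a symmetric form on the projective objects -/

section Linear

/-- In finite dimensions a functional is represented by a pairing which is nondegenerate on both
sides. -/
lemma exists_eq_of_separating {K V W : Type*} [Field K] [AddCommGroup V] [AddCommGroup W]
    [Module K V] [Module K W] [FiniteDimensional K V] [FiniteDimensional K W]
    (B : V →ₗ[K] W →ₗ[K] K) (h1 : ∀ v, (∀ w, B v w = 0) → v = 0)
    (h2 : ∀ w, (∀ v, B v w = 0) → w = 0) (l : Module.Dual K W) : ∃ v, B v = l := by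
  have i1 : Function.Injective (B : V →ₗ[K] Module.Dual K W) :=
    (injective_iff_map_eq_zero _).2 fun v hv => h1 v fun w => by rw [hv]; rfl
  have i2 : Function.Injective (B.flip : W →ₗ[K] Module.Dual K V) :=
    (injective_iff_map_eq_zero _).2 fun w hw => h2 w fun v => by
      rw [← LinearMap.flip_apply, hw]; rfl
  have d1 := LinearMap.finrank_le_finrank_of_injective i1
  have d2 := LinearMap.finrank_le_finrank_of_injective i2
  rw [Subspace.dual_finrank_eq] at d1 d2
  exact (LinearMap.injective_iff_surjective_of_finrank_eq_finrank (f := B)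
    ((le_antisymm d1 d2).trans Subspace.dual_finrank_eq.symm)).1 i1 l

end Linear

section Serre

variable {A : Type w} [Category.{v} A] [Abelian A] {P : ObjectProperty A}
variable {K : Type u} [Field K] [Linear K A]

lemma stableCategory_isHomFinite
    (hfin : ∀ X Y : P.FullSubcategory, FiniteDimensional K (X ⟶ Y)) :
    IsHomFinite (StableCategory P) K := fun X Y => by
  have := hfin X.as Y.as
  exact Module.Finite.of_surjective
    (((stabilisation P).mapLinearMap K : (X.as ⟶ Y.as) →ₗ[K] _))
    ((stabilisation P).map_surjective)

variable (P K) in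
/-- A symmetric form on the projective objects: linear forms `t` on their endomorphism algebras with
`t (u v) = t (v u)`, such that the pairings `(u, v) ↦ t (u v)` between `Hom(Q, M)` and `Hom(M, Q)`
are nondegenerate on both sides, for `Q` projective and `M` arbitrary. -/
structure SymmetricForm where
  t : ∀ Q : P.FullSubcategory, (Q ⟶ Q) →ₗ[K] K
  symm : ∀ {Q R : P.FullSubcategory}, IsProj Q → IsProj R → ∀ (u : Q ⟶ R) (v : R ⟶ Q),
    t Q (u ≫ v) = t R (v ≫ u)
  left : ∀ {Q M : P.FullSubcategory}, IsProj Q → ∀ u : Q ⟶ M,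
    (∀ v : M ⟶ Q, t Q (u ≫ v) = 0) → u = 0
  right : ∀ {Q M : P.FullSubcategory}, IsProj Q → ∀ v : M ⟶ Q,
    (∀ u : Q ⟶ M, t Q (u ≫ v) = 0) → v = 0

namespace SymmetricForm

variable (T : SymmetricForm P K)

/-- The pairing of `Hom(Q, M)` and `Hom(M, Q)`. -/
def pairing (Q M : P.FullSubcategory) : (Q ⟶ M) →ₗ[K] (M ⟶ Q) →ₗ[K] K :=
  (Linear.comp (S := K) Q M Q).compr₂ (T.t Q)

lemma pairing_apply {Q M : P.FullSubcategory} (u : Q ⟶ M) (v : M ⟶ Q) :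
    T.pairing Q M u v = T.t Q (u ≫ v) := rfl

variable (hfin : ∀ X Y : P.FullSubcategory, FiniteDimensional K (X ⟶ Y))
  {X I S : P.FullSubcategory} {i : X ⟶ I} {p : I ⟶ S}

include hfin in
/-- A morphism `g : B ⟶ X` which is orthogonal to all `f : S ⟶ B` is stably trivial. If
`q : R ⟶ X` is a deflation with `R` projective, then `g i` is orthogonal to the orthogonal space of
the image of `Hom(B, R)` in `Hom(B, I)`. -/
lemma mem_projHom_right [hP : IsFrobeniusAbelian P] (h : IsConflation i p) (hI : IsProj I)
    {B : P.FullSubcategory} (g : B ⟶ X) (hg : ∀ f : S ⟶ B, T.t I (p ≫ f ≫ g ≫ i) = 0) :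
    g ∈ projHom P B X := by
  obtain ⟨L, R, k, q, hR, hq⟩ := hP.enough_projectives X
  have key : g ≫ i ∈ LinearMap.range (Linear.rightComp K B (q ≫ i)) := by
    by_contra hn
    -- otherwise a linear form `t (u -)` separates `g i` from the image, contradicting `hg`
    obtain ⟨l, hl, hl'⟩ := Submodule.exists_dual_map_eq_bot_of_notMem hn inferInstance
    obtain ⟨u, rfl⟩ := exists_eq_of_separating (T.pairing I B) (fun u => T.left hI u)
      (fun v => T.right hI v) l
    have h1 : q ≫ i ≫ u = 0 := T.left hR _ fun w => by
      have h2 : T.pairing I B u (w ≫ q ≫ i) = 0 := by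
        have : T.pairing I B u (w ≫ q ≫ i) ∈
          Submodule.map (T.pairing I B u) (LinearMap.range (Linear.rightComp K B (q ≫ i))) :=
          Submodule.mem_map_of_mem ⟨w, rfl⟩
        rwa [hl', Submodule.mem_bot] at this
      rw [pairing_apply, ← Category.assoc, T.symm hI hR] at h2
      simpa using h2
    have h3 : i ≫ u = 0 := hq.cancel_right (h1.trans comp_zero.symm)
    obtain ⟨f, rfl⟩ := h.exists_desc u h3
    exact hl (by rw [pairing_apply, Category.assoc]; exact hg f)
  obtain ⟨w, hw⟩ := key
  have : g = w ≫ q := h.cancel_left (by rw [Category.assoc]; exact hw.symm)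
  rw [this]
  exact projHom_of_fac hR w q

include hfin in
/-- A morphism `f : S ⟶ B` which is orthogonal to all `g : B ⟶ X` is stably trivial. -/
lemma mem_projHom_left [hP : IsFrobeniusAbelian P] (h : IsConflation i p) (hI : IsProj I)
    {B : P.FullSubcategory} (f : S ⟶ B) (hf : ∀ g : B ⟶ X, T.t I (p ≫ f ≫ g ≫ i) = 0) :
    f ∈ projHom P S B := by
  obtain ⟨J, L, j, k, hJ, hj⟩ := hP.enough_injectives S
  replace hJ := (hP.proj_iff_inj J).2 hJ
  have key : p ≫ f ∈ LinearMap.range (Linear.leftComp K B (p ≫ j)) := by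
    by_contra hn
    obtain ⟨l, hl, hl'⟩ := Submodule.exists_dual_map_eq_bot_of_notMem hn inferInstance
    obtain ⟨v, rfl⟩ := exists_eq_of_separating (T.pairing I B).flip (fun v => T.right hI v)
      (fun u => T.left hI u) l
    have h1 : v ≫ p ≫ j = 0 := T.right hJ _ fun w => by
      have h2 : (T.pairing I B).flip v ((p ≫ j) ≫ w) = 0 := by
        have : (T.pairing I B).flip v ((p ≫ j) ≫ w) ∈
          Submodule.map ((T.pairing I B).flip v) (LinearMap.range (Linear.leftComp K B (p ≫ j))) :=
          Submodule.mem_map_of_mem ⟨w, rfl⟩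
        rwa [hl', Submodule.mem_bot] at this
      rw [LinearMap.flip_apply, pairing_apply, Category.assoc, T.symm hI hJ] at h2
      simpa using h2
    have h3 : v ≫ p = 0 := hj.cancel_left (by rw [Category.assoc, h1, zero_comp])
    obtain ⟨g, rfl⟩ := h.exists_lift v h3
    exact hl (by rw [LinearMap.flip_apply, pairing_apply, Category.assoc]; exact hf g)
  obtain ⟨w, hw⟩ := key
  have : f = j ≫ w := h.cancel_right (by rw [← Category.assoc]; exact hw.symm)
  rw [this]
  exact projHom_of_fac hJ j w

variable [hP : IsFrobeniusAbelian P] (D : CosyzygyChoice P)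

/-- The form `k ↦ t (π k ι)` vanishes on stably trivial morphisms, since `ι π = 0`. -/
lemma t_eq_zero {X : P.FullSubcategory} {k : D.cosyz X ⟶ X} (hk : k ∈ projHom P _ _) :
    T.t (D.I X) (D.π X ≫ k ≫ D.ι X) = 0 := by
  induction hk using AddSubgroup.closure_induction with
  | mem k hk =>
    obtain ⟨R, a, b, hR, rfl⟩ := hk
    have h := T.symm (D.isProj_I X) hR (D.π X ≫ a) (b ≫ D.ι X)
    have h0 : (b ≫ D.ι X) ≫ D.π X ≫ a = 0 := by
      rw [Category.assoc, ← Category.assoc (D.ι X), (D.conflation X).comp_eq_zero, zero_comp,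
        comp_zero]
    rw [h0, map_zero] at h
    simpa using h
  | zero => simp
  | add f g _ _ hf hg => simp [hf, hg]
  | neg f _ hf => simp [hf]

/-- The linear form on the stable morphisms `Σ X ⟶ X` which sends the class of `k` to
`t (π k ι)`. -/
noncomputable def stableForm (X : P.FullSubcategory) :
    ((stabilisation P).obj (D.cosyz X) ⟶ (stabilisation P).obj X) →ₗ[K] K where
  toFun k := T.t (D.I X) (D.π X ≫ (stabilisation P).preimage k ≫ D.ι X)
  map_add' k l := by
    have h : (stabilisation P).preimage (k + l) -
        ((stabilisation P).preimage k + (stabilisation P).preimage l) ∈ projHom P _ _ := by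
      rw [← stab_map_eq_iff, (stabilisation P).map_add]
      simp only [Functor.map_preimage]
    have := T.t_eq_zero D h
    simpa [sub_eq_zero] using this
  map_smul' c k := by
    have h : (stabilisation P).preimage (c • k) - c • (stabilisation P).preimage k ∈
        projHom P _ _ := by
      rw [← stab_map_eq_iff, Functor.map_preimage]
      exact congrArg (c • ·) ((stabilisation P).map_preimage k).symm
    have := T.t_eq_zero D h
    simpa [sub_eq_zero] using this

lemma stableForm_map {X : P.FullSubcategory} (k : D.cosyz X ⟶ X) :
    T.stableForm D X ((stabilisation P).map k) = T.t (D.I X) (D.π X ≫ k ≫ D.ι X) := by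
  have h : (stabilisation P).preimage ((stabilisation P).map k) - k ∈ projHom P _ _ := by
    rw [← stab_map_eq_iff, Functor.map_preimage]
  have := T.t_eq_zero D h
  rw [Preadditive.sub_comp, Preadditive.comp_sub, map_sub, sub_eq_zero] at this
  exact this

/-- The linear forms on stable morphisms `Σ X ⟶ X` are invariant under cyclic permutations, up to
`Σ`. -/
lemma stableForm_comp {X Y : P.FullSubcategory} (f : X ⟶ Y)
    (k : (stabilisation P).obj (D.cosyz Y) ⟶ (stabilisation P).obj X) :
    T.stableForm D X ((stabilisation P).map (D.mapCosyz f) ≫ k) =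
      T.stableForm D Y (k ≫ (stabilisation P).map f) := by
  obtain ⟨k, rfl⟩ := (stabilisation P).map_surjective k
  rw [← (stabilisation P).map_comp, ← (stabilisation P).map_comp, stableForm_map, stableForm_map,
    Category.assoc, ← Category.assoc, D.π_mapCosyz, Category.assoc,
    T.symm (D.isProj_I X) (D.isProj_I Y), Category.assoc, Category.assoc, Category.assoc, D.ι_mapI]

section

variable [HasShift (StableCategory P) ℤ]
  (e : ∀ X : P.FullSubcategory, (shiftFunctor (StableCategory P) (1 : ℤ)).obj
    ((stabilisation P).obj X) ≅ (stabilisation P).obj (D.cosyz X))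

/-- Splicing a commutative square with the inverse of one whose horizontal maps are invertible. -/
lemma comm_of_comm {C : Type*} [Category* C] {X X' Y Y' U U' : C} {m : X ⟶ Y} {i : X ≅ X'}
    {j : Y ≅ Y'} {q : X' ⟶ Y'} {c : X ⟶ U} {d : Y ⟶ U'} {f : U ⟶ U'}
    (h1 : m ≫ j.hom = i.hom ≫ q) (h2 : m ≫ d = c ≫ f) :
    q ≫ j.inv ≫ d = (i.inv ≫ c) ≫ f := by
  have h3 : q ≫ j.inv = i.inv ≫ m := by rw [Iso.comp_inv_eq, Category.assoc, h1]; simp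
  rw [← Category.assoc, h3, Category.assoc, h2, Category.assoc]

variable {D} in
/-- The cosyzygy of the desuspension of `a` is `a`. -/
noncomputable def cosyzDesuspIso (a : StableCategory P) :
    (stabilisation P).obj (D.cosyz ((shiftFunctor (StableCategory P) (-1 : ℤ)).obj a).as) ≅ a :=
  (e ((shiftFunctor (StableCategory P) (-1 : ℤ)).obj a).as).symm ≪≫
    (shiftEquiv (StableCategory P) (1 : ℤ)).counitIso.app a

variable {D e} in
omit hP in
lemma cosyzDesuspIso_naturality (he : ConflationTriangle.ShiftCompatible e)
    {a b : StableCategory P} (f : a ⟶ b)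
    (g : ((shiftFunctor (StableCategory P) (-1 : ℤ)).obj a).as ⟶
      ((shiftFunctor (StableCategory P) (-1 : ℤ)).obj b).as)
    (hg : (stabilisation P).map g = (shiftFunctor (StableCategory P) (-1 : ℤ)).map f) :
    (stabilisation P).map (D.mapCosyz g) ≫ (cosyzDesuspIso e b).hom =
      (cosyzDesuspIso e a).hom ≫ f := by
  have h1 := he g
  rw [hg] at h1
  exact comm_of_comm h1 ((shiftEquiv (StableCategory P) (1 : ℤ)).counitIso.hom.naturality f)

/-- The map from `Hom(a, b)` to the dual of `Hom(b, a⟦-1⟧)` defined by a symmetric form. -/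
noncomputable def serreMap (a b : StableCategory P) :
    (a ⟶ b) →ₗ[K] Module.Dual K (b ⟶ (shiftFunctor (StableCategory P) (-1 : ℤ)).obj a) :=
  ((Linear.comp (S := K) a b ((shiftFunctor (StableCategory P) (-1 : ℤ)).obj a)).compr₂
    ((T.stableForm D ((shiftFunctor (StableCategory P) (-1 : ℤ)).obj a).as) ∘ₗ
      Linear.leftComp K _ (cosyzDesuspIso e a).hom))

lemma serreMap_apply {a b : StableCategory P} (f : a ⟶ b)
    (g : b ⟶ (shiftFunctor (StableCategory P) (-1 : ℤ)).obj a) :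
    T.serreMap D e a b f g = T.stableForm D ((shiftFunctor (StableCategory P) (-1 : ℤ)).obj a).as
      ((cosyzDesuspIso e a).hom ≫ f ≫ g) := rfl

include hfin in
/-- Both kernels of the pairing vanish, since morphisms orthogonal to everything are stably trivial.
-/
lemma serreMap_bijective (a b : StableCategory P) : Function.Bijective (T.serreMap D e a b) := by
  let c := ((shiftFunctor (StableCategory P) (-1 : ℤ)).obj a).as
  have := stableCategory_isHomFinite hfin
  have f1 : FiniteDimensional K (a ⟶ b) := this a b
  have f2 : FiniteDimensional K (b ⟶ (shiftFunctor (StableCategory P) (-1 : ℤ)).obj a) := this _ _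
  have inj : ∀ f : a ⟶ b, (∀ g, T.serreMap D e a b f g = 0) → f = 0 := by
    intro f hf
    obtain ⟨f', hf'⟩ := (stabilisation P).map_surjective (X := D.cosyz c) (Y := b.as)
      ((cosyzDesuspIso e a).hom ≫ f)
    have h0 : (cosyzDesuspIso e a).hom ≫ f = 0 := by
      rw [← hf']
      refine (stab_map_eq_zero_iff _).2 (T.mem_projHom_left hfin (D.conflation c) (D.isProj_I c) f'
        fun g => ?_)
      have h1 := hf ((stabilisation P).map g)
      rw [serreMap_apply, ← Category.assoc, ← hf', ← (stabilisation P).map_comp] at h1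
      have h2 := T.stableForm_map D (f' ≫ g)
      rw [Category.assoc] at h2
      exact h2.symm.trans h1
    rw [← (cosyzDesuspIso e a).inv_hom_id_assoc f, h0, comp_zero]
  have inj' : ∀ g, (∀ f, T.serreMap D e a b f g = 0) → g = 0 := by
    intro g hg
    obtain ⟨g, rfl⟩ := (stabilisation P).map_surjective (X := b.as) (Y := c) g
    refine (stab_map_eq_zero_iff _).2 (T.mem_projHom_right hfin (D.conflation c) (D.isProj_I c) g
      fun f => ?_)
    have h1 := hg ((cosyzDesuspIso e a).inv ≫ (stabilisation P).map f)
    rw [serreMap_apply, Category.assoc, Iso.hom_inv_id_assoc] at h1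
    have h2 := T.stableForm_map D (f ≫ g)
    rw [Category.assoc] at h2
    exact h2.symm.trans h1
  refine ⟨(injective_iff_map_eq_zero _).2 fun f hf => inj f fun g => by rw [hf]; rfl, fun l => ?_⟩
  exact exists_eq_of_separating (T.serreMap D e a b) inj inj' l

include hfin in
/-- Serre duality for the inverse of the suspension. -/
lemma nonempty_serreDuality (T : SymmetricForm P K) (he : ConflationTriangle.ShiftCompatible e) :
    Nonempty (SerreDuality K (shiftFunctor (StableCategory P) (-1 : ℤ))) :=
  ⟨{ iso := fun a b => LinearEquiv.ofBijective (T.serreMap D e a b) (T.serreMap_bijective hfin D e a b)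
     natural_left := fun {a' a b} f g h => by
      obtain ⟨f', hf'⟩ := (stabilisation P).map_surjective
        (X := ((shiftFunctor (StableCategory P) (-1 : ℤ)).obj a').as)
        (Y := ((shiftFunctor (StableCategory P) (-1 : ℤ)).obj a).as)
        ((shiftFunctor (StableCategory P) (-1 : ℤ)).map f)
      change T.stableForm D _ ((cosyzDesuspIso e a').hom ≫ (f ≫ g) ≫ h) =
        T.stableForm D _ ((cosyzDesuspIso e a).hom ≫ g ≫ h ≫ _)
      have h1 := T.stableForm_comp D f' ((cosyzDesuspIso e a).hom ≫ g ≫ h)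
      rw [← Category.assoc, cosyzDesuspIso_naturality he f f' hf'] at h1
      simp only [Category.assoc] at h1 ⊢
      rw [h1, hf']
     natural_right := fun {a b b'} g k h => by
      change T.stableForm D _ ((cosyzDesuspIso e a).hom ≫ (g ≫ k) ≫ h) =
        T.stableForm D _ ((cosyzDesuspIso e a).hom ≫ g ≫ k ≫ h)
      rw [Category.assoc] }⟩

end

end SymmetricForm

end Serre

/-! ### The trace pairing -/

section Trace

variable {C : Type w} [Category.{v} C] [Preadditive C] {K : Type u} [Field K] [Linear K C]
  {S : C ⥤ C}

namespace SerreDuality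

variable (s : SerreDuality K S)

/-- The linear form on `Hom(a, S a)` which corresponds to the identity of `a`. -/
def form (a : C) : (a ⟶ S.obj a) →ₗ[K] K := s.iso a a (𝟙 a)

lemma iso_apply {a b : C} (f : a ⟶ b) (g : b ⟶ S.obj a) : s.iso a b f g = s.form a (f ≫ g) := by
  have := s.natural_right (𝟙 a) f g
  rwa [Category.id_comp] at this

lemma form_comp {a b : C} (f : a ⟶ b) (k : b ⟶ S.obj a) :
    s.form a (f ≫ k) = s.form b (k ≫ S.map f) := by
  have := s.natural_left f (𝟙 b) k
  rw [Category.comp_id, iso_apply] at this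
  exact this

lemma finrank_eq (s : SerreDuality K S) (hC : IsHomFinite C K) (a b : C) :
    Module.finrank K (b ⟶ S.obj a) = Module.finrank K (a ⟶ b) := by
  have := hC b (S.obj a)
  rw [(s.iso a b).finrank_eq, Subspace.dual_finrank_eq]

/-- Any choice of coordinates on the spaces `Hom(X i, S (X i))` of the indecomposable summands turns
the trace into the form of the Serre duality, twisted by an automorphism of the object. -/
lemma tracePairing_nondegenerate (s : SerreDuality K S) {n : ℕ} {X : Fin n → C} (B : Bicone X) (hB : B.IsBilimit)
    (hX : ∀ i, ¬ IsZero (X i)) (θ : ∀ i, (X i ⟶ S.obj (X i)) ≃ₗ[K] K) (b : C) :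
    (tracePairing K S B θ b).Nondegenerate := by
  -- the Serre form on `Hom(X i, S (X i))` is the multiple `d i` of `θ i`, and `d i ≠ 0`
  let d : Fin n → K := fun i => s.form (X i) ((θ i).symm 1)
  have hd : ∀ i (x : X i ⟶ S.obj (X i)), s.form (X i) x = θ i x * d i := by
    intro i x
    have : x = θ i x • (θ i).symm 1 := by
      apply (θ i).injective
      simp
    conv_lhs => rw [this]
    rw [map_smul, smul_eq_mul]
  have hd0 : ∀ i, d i ≠ 0 := by
    intro i hi
    refine hX i ((IsZero.iff_id_eq_zero _).2 ((s.iso (X i) (X i)).injective ?_))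
    rw [map_zero]
    ext x
    have := hd i x
    rwa [hi, mul_zero] at this
  -- `u` multiplies the summand `X i` by `(d i)⁻¹`, and `u'` is its inverse
  let u : B.pt ⟶ B.pt := ∑ i, (d i)⁻¹ • (B.π i ≫ B.ι i)
  let u' : B.pt ⟶ B.pt := ∑ i, d i • (B.π i ≫ B.ι i)
  have hπ : ∀ i, u ≫ B.π i = (d i)⁻¹ • B.π i := by
    intro i
    simp only [u, Preadditive.sum_comp, Linear.smul_comp, Category.assoc, B.ι_π]
    rw [Finset.sum_eq_single i]
    · simp
    · intro j _ hj
      simp [hj]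
    · simp
  have hπ' : ∀ i, u' ≫ B.π i = d i • B.π i := by
    intro i
    simp only [u', Preadditive.sum_comp, Linear.smul_comp, Category.assoc, B.ι_π]
    rw [Finset.sum_eq_single i]
    · simp
    · intro j _ hj
      simp [hj]
    · simp
  have huu' : u ≫ u' = 𝟙 _ := by
    refine hB.isLimit.hom_ext fun ⟨i⟩ => ?_
    change (u ≫ u') ≫ B.π i = 𝟙 _ ≫ B.π i
    rw [Category.assoc, hπ', Linear.comp_smul, hπ, smul_smul, mul_inv_cancel₀ (hd0 i), one_smul,
      Category.id_comp]
  have hu'u : u' ≫ u = 𝟙 _ := by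
    refine hB.isLimit.hom_ext fun ⟨i⟩ => ?_
    change (u' ≫ u) ≫ B.π i = 𝟙 _ ≫ B.π i
    rw [Category.assoc, hπ, Linear.comp_smul, hπ', smul_smul, inv_mul_cancel₀ (hd0 i), one_smul,
      Category.id_comp]
  have htrace : ∀ k, trace K S B θ k = s.form B.pt (u ≫ k) := by
    intro k
    simp only [trace, LinearMap.sum_apply, u, Preadditive.sum_comp, map_sum]
    refine Finset.sum_congr rfl fun i _ => ?_
    change θ i ((B.ι i ≫ k) ≫ S.map (B.π i)) = _
    have h1 := s.form_comp (B.π i) (B.ι i ≫ k)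
    rw [hd] at h1
    rw [Linear.smul_comp, map_smul, Category.assoc (B.π i), h1, smul_eq_mul, mul_comm, mul_assoc,
      mul_inv_cancel₀ (hd0 i), mul_one]
  have hpair : ∀ (f : B.pt ⟶ b) g, tracePairing K S B θ b f g = s.iso B.pt b (u ≫ f) g := by
    intro f g
    rw [iso_apply, Category.assoc, ← htrace]
    rfl
  constructor
  · intro f hf
    have : u ≫ f = 0 := (s.iso B.pt b).injective (by
      rw [map_zero]
      ext g
      rw [← hpair]
      exact hf g)
    rw [← Category.id_comp f, ← hu'u, Category.assoc, this, comp_zero]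
  · intro g hg
    rw [← Module.forall_dual_apply_eq_zero_iff K]
    intro l
    obtain ⟨f, rfl⟩ := (s.iso B.pt b).surjective l
    have := hg (u' ≫ f)
    rwa [hpair, ← Category.assoc, huu', Category.id_comp] at this

end SerreDuality

end Trace

section

variable {A : Type w} [Category.{v} A] [Abelian A] {P : ObjectProperty A}
variable {K : Type u} [Field K] [Linear K A]

/-- The stable category of a `Hom`-finite Frobenius category with a symmetric form on its projective
objects is triangulated, and its inverse suspension is a Serre functor. -/
theorem exists_serre_triangulation [hP : IsFrobeniusAbelian P]
    (hfin : ∀ X Y : P.FullSubcategory, FiniteDimensional K (X ⟶ Y)) (T : SymmetricForm P K)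
    (hend : ∀ X : StableCategory P, IsIndecomposable X → Module.finrank K (X ⟶ X) = 1)
    (D : CosyzygyChoice P) :
    ∃ (_ : HasZeroObject (StableCategory P)) (_ : HasShift (StableCategory P) ℤ)
      (_ : ∀ n : ℤ, (shiftFunctor (StableCategory P) n).Additive)
      (_ : Pretriangulated (StableCategory P)),
      IsTriangulated (StableCategory P) ∧
      IsInducedTriangulation D ∧
      (∀ n : ℤ, (shiftFunctor (StableCategory P) n).Linear K) ∧
      IsSerreFunctor K (shiftFunctor (StableCategory P) (-1 : ℤ)) ∧
      (∀ X : StableCategory P, IsIndecomposable X →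
        Module.finrank K (X ⟶ (shiftFunctor (StableCategory P) (-1 : ℤ)).obj X) = 1) ∧
      ∀ (n : ℕ) (X : Fin n → StableCategory P) (B : Bicone X), Nonempty B.IsBilimit →
        (∀ i, IsIndecomposable (X i)) →
        ∀ (θ : ∀ i, (X i ⟶ (shiftFunctor (StableCategory P) (-1 : ℤ)).obj (X i)) ≃ₗ[K] K)
          (b : StableCategory P),
          (tracePairing K (shiftFunctor (StableCategory P) (-1 : ℤ)) B θ b).Nondegenerate := by
  let _ : HasShift (StableCategory P) ℤ := hasShiftOfEquivalence D.sigma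
  let i : shiftFunctor (StableCategory P) (1 : ℤ) ≅ D.sigma := shiftOneIso D.sigma
  have hadd : ∀ n : ℤ, (shiftFunctor (StableCategory P) n).Additive :=
    shiftFunctor_additive D.sigma i
  have hlin : ∀ n : ℤ, (shiftFunctor (StableCategory P) n).Linear K :=
    shiftFunctor_linear D.sigma i
  let e : ∀ X : P.FullSubcategory, (shiftFunctor (StableCategory P) (1 : ℤ)).obj
    ((stabilisation P).obj X) ≅ (stabilisation P).obj (D.cosyz X) :=
    fun X => i.app ((stabilisation P).obj X)
  have he : ConflationTriangle.ShiftCompatible e := fun {X Y} f => by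
    have h1 := i.hom.naturality ((stabilisation P).map f)
    rw [D.sigma_map] at h1
    exact h1
  have hz : HasZeroObject (StableCategory P) := hasZeroObject_stableCategory
  obtain ⟨s⟩ := T.nonempty_serreDuality hfin D e he
  have heq : (shiftFunctor (StableCategory P) (-1 : ℤ)).IsEquivalence := inferInstance
  refine ⟨hz, inferInstance, hadd, ConflationTriangle.pretriangulated he,
    ConflationTriangle.isTriangulated he, ConflationTriangle.isInducedTriangulation he, hlin,
    ⟨heq, ⟨hadd (-1), hlin (-1)⟩, ⟨s⟩⟩, fun X hX => ?_, fun n X B ⟨hB⟩ hX θ b => ?_⟩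
  · rw [s.finrank_eq (stableCategory_isHomFinite hfin), hend X hX]
  · exact s.tracePairing_nondegenerate B hB (fun i => (hX i).1) θ b

end

/-! ### Minimality and decompositions in `Hom`-finite categories -/

section Fitting

/-- The idempotent of the Fitting decomposition of an element of a finite dimensional algebra. -/
lemma exists_fitting_idempotent (K : Type*) {R : Type*} [Field K] [Ring R] [Algebra K R]
    [FiniteDimensional K R] (e : R) :
    ∃ (n : ℕ) (ε : R), ε * ε = ε ∧ ε * e ^ n = e ^ n ∧ e ^ n * ε = e ^ n ∧ (ε = 1 → IsUnit e) := by
  -- in the commutative Artinian algebra generated by `e` the powers of `e` stabilize up to units: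
  -- `e ^ n = e ^ (n + 1) y`, and `e ^ n y ^ n` is the idempotent
  let B := Algebra.adjoin K {e}
  have : IsMulCommutative B := Algebra.isMulCommutative_adjoin K (by
    intro a ha b hb
    rw [Set.mem_singleton_iff.1 ha, Set.mem_singleton_iff.1 hb])
  have : FiniteDimensional K B := FiniteDimensional.finiteDimensional_subalgebra B
  have : IsArtinianRing B := IsArtinianRing.of_finite K B
  let x : B := ⟨e, Algebra.subset_adjoin rfl⟩
  obtain ⟨n, y, hy⟩ := IsArtinian.exists_pow_succ_smul_dvd x (1 : B)
  simp only [smul_eq_mul, mul_one] at hy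
  have h1 : ∀ k, x ^ n = x ^ n * (x ^ k * y ^ k) := by
    intro k
    induction k with
    | zero => simp
    | succ k ih =>
      calc x ^ n = x ^ n * (x ^ k * y ^ k) := ih
        _ = (x ^ n.succ * y) * (x ^ k * y ^ k) := by rw [hy]
        _ = _ := by rw [Nat.succ_eq_add_one]; ring
  have h2 : (x ^ n * y ^ n) * x ^ n = x ^ n := by rw [mul_comm]; exact (h1 n).symm
  have h3 : (x ^ n * y ^ n) * (x ^ n * y ^ n) = x ^ n * y ^ n := by
    rw [← mul_assoc, h2]
  refine ⟨n, ((x ^ n * y ^ n : B) : R), congrArg Subtype.val h3, congrArg Subtype.val h2,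
    congrArg Subtype.val (h1 n).symm, fun h => ?_⟩
  have h4 : x ^ n * y ^ n = 1 := Subtype.ext h
  have h5 : x * y = 1 := by
    calc x * y = (x ^ n * y ^ n) * (x * y) := by rw [h4, one_mul]
      _ = (x ^ n.succ * y) * y ^ n := by rw [Nat.succ_eq_add_one]; ring
      _ = 1 := by rw [hy, h4]
  have h6 : y * x = 1 := by rw [mul_comm, h5]
  exact ⟨⟨e, y, congrArg Subtype.val h5, congrArg Subtype.val h6⟩, rfl⟩

variable {C : Type w} [Category.{v} C] [Preadditive C] {K : Type u} [Field K] [Linear K C]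

/-- A proper retract has a smaller endomorphism algebra. -/
lemma finrank_end_lt_of_retract {X Y : C} [FiniteDimensional K (Y ⟶ Y)] (i : X ⟶ Y) (r : Y ⟶ X)
    (h : i ≫ r = 𝟙 X) (hne : r ≫ i ≠ 𝟙 Y) :
    Module.finrank K (X ⟶ X) < Module.finrank K (Y ⟶ Y) := by
  -- `End X` embeds in the corner of the idempotent `r i`, and `1 - r i` is not in that corner
  let φ : (X ⟶ X) × K →ₗ[K] (Y ⟶ Y) := LinearMap.coprod
    (Linear.rightComp K Y i ∘ₗ Linear.leftComp K X r) (LinearMap.toSpanSingleton K _ (𝟙 Y - r ≫ i))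
  have hφ : ∀ f c, φ (f, c) = (r ≫ f) ≫ i + c • (𝟙 Y - r ≫ i) := fun f c => rfl
  have inj : Function.Injective φ := (injective_iff_map_eq_zero _).2 fun ⟨f, c⟩ hfc => by
    rw [hφ] at hfc
    have h1 : i ≫ ((r ≫ f) ≫ i + c • (𝟙 Y - r ≫ i)) ≫ r = 0 := by rw [hfc]; simp
    have hf : f = 0 := by
      simpa [Preadditive.add_comp, Preadditive.comp_add, Preadditive.comp_sub, Preadditive.sub_comp,
        h, reassoc_of% h] using h1
    have hc : c = 0 := by
      rw [hf, comp_zero, zero_comp, zero_add, smul_eq_zero, sub_eq_zero] at hfc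
      exact hfc.resolve_right (Ne.symm hne)
    rw [hf, hc]
    rfl
  have hX : FiniteDimensional K (X ⟶ X) := by
    refine Module.Finite.of_injective (φ ∘ₗ LinearMap.inl K _ _) (inj.comp ?_)
    exact LinearMap.inl_injective
  have := LinearMap.finrank_le_finrank_of_injective inj
  rw [Module.finrank_prod, Module.finrank_self] at this
  omega

/-- An endomorphism `e` either is invertible, or there are a proper idempotent `ε` and a power of
`e` which is unchanged by composition with `ε`. -/
lemma isIso_or_exists_idempotent {Y : C} (K : Type u) [Field K] [Linear K C]
    [FiniteDimensional K (Y ⟶ Y)] (e : Y ⟶ Y) :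
    IsIso e ∨ ∃ (n : ℕ) (ε : Y ⟶ Y), ε ≫ ε = ε ∧ ε ≠ 𝟙 Y ∧ ε ≫ (End.of e ^ n).asHom = (End.of e ^ n).asHom ∧
      (End.of e ^ n).asHom ≫ ε = (End.of e ^ n).asHom := by
  have : FiniteDimensional K (End Y) := ‹FiniteDimensional K (Y ⟶ Y)›
  obtain ⟨n, ε, h1, h2, h3, h4⟩ := exists_fitting_idempotent K (End.of e)
  by_cases h : ε = 1
  · exact Or.inl ((isUnit_iff_isIso e).1 (h4 h))
  · exact Or.inr ⟨n, ε, h1, h, h3, h2⟩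

end Fitting

section Strings

variable {A : Type w} [Category.{v} A] [Abelian A] {P : ObjectProperty A}

/-- A retract in an abelian subcategory has a complement. -/
lemma exists_bicone_of_retract [IsAbelianSubcategory P] {S X : P.FullSubcategory} (i : S ⟶ X)
    (r : X ⟶ S) (h : i ≫ r = 𝟙 S) :
    ∃ (R : P.FullSubcategory) (b : BinaryBicone S R), b.pt = X ∧
      b.fst ≫ b.inl + b.snd ≫ b.inr = 𝟙 b.pt := by
  have hr : Epi r.hom := by
    have : i.hom ≫ r.hom = 𝟙 _ := congrArg (·.hom) h
    have : IsSplitEpi r.hom := ⟨⟨⟨i.hom, this⟩⟩⟩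
    infer_instance
  obtain ⟨R, k, hk⟩ := exists_conflation_of_epi r
  obtain ⟨s, hs⟩ := hk.exists_lift (𝟙 X - r ≫ i) (by
    rw [Preadditive.sub_comp, Category.assoc, h, Category.id_comp, Category.comp_id, sub_self])
  refine ⟨R, BinaryBicone.mk X r s i k h (hk.cancel_left ?_) hk.comp_eq_zero (hk.cancel_left ?_),
    rfl, ?_⟩
  · rw [Category.assoc, hs, Preadditive.comp_sub, ← Category.assoc, h]
    simp
  · rw [Category.assoc, hs, Preadditive.comp_sub, ← Category.assoc, hk.comp_eq_zero]
    simp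
  · simp [hs]

lemma IsProj.of_retract {X Y : P.FullSubcategory} (hY : IsProj Y) (i : X ⟶ Y) (r : Y ⟶ X)
    (h : i ≫ r = 𝟙 X) : IsProj X := fun _ _ _ f g hfg k => by
  obtain ⟨l, hl⟩ := hY f g hfg (r ≫ k)
  exact ⟨i ≫ l, by rw [Category.assoc, hl, ← Category.assoc, h, Category.id_comp]⟩

lemma IsInj.of_retract {X Y : P.FullSubcategory} (hY : IsInj Y) (i : X ⟶ Y) (r : Y ⟶ X)
    (h : i ≫ r = 𝟙 X) : IsInj X := fun _ _ _ f g hfg k => by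
  obtain ⟨l, hl⟩ := hY f g hfg (k ≫ i)
  exact ⟨l ≫ r, by rw [← Category.assoc, hl, Category.assoc, h, Category.comp_id]⟩

variable {K : Type u} [Field K] [Linear K A]

/-- A projective deflation onto `X` with an endomorphism algebra of minimal dimension is right
minimal. -/
lemma exists_isProjectiveCover [IsAbelianSubcategory P] [P.IsStableUnderRetracts]
    (hfin : ∀ X Y : P.FullSubcategory, FiniteDimensional K (X ⟶ Y)) (X : P.FullSubcategory)
    (hX : ∃ (Q : P.FullSubcategory) (p : Q ⟶ X), IsProj Q ∧ Epi p.hom) :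
    ∃ (Q : P.FullSubcategory) (p : Q ⟶ X), IsProjectiveCover p := by
  obtain ⟨n, ⟨Q, p, hQ, hp, hn⟩, hmin⟩ := WellFounded.has_min (wellFounded_lt (α := ℕ))
    {n | ∃ (Q : P.FullSubcategory) (p : Q ⟶ X), IsProj Q ∧ Epi p.hom ∧
      Module.finrank K (Q ⟶ Q) = n} (by
        obtain ⟨Q, p, h1, h2⟩ := hX
        exact ⟨_, Q, p, h1, h2, rfl⟩)
  refine ⟨Q, p, hQ, exists_conflation_of_epi p, fun e he => ?_⟩
  have := hfin Q Q
  refine (isIso_or_exists_idempotent K e).resolve_right ?_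
  rintro ⟨k, ε, h1, h2, h3, -⟩
  -- the idempotent `ε` fixes `p`, so its image would be a smaller projective object over `X`
  have hek : (End.of e ^ k).asHom ≫ p = p := by
    clear h3
    induction k with
    | zero => exact Category.id_comp p
    | succ k ih =>
      rw [pow_succ]
      change (e ≫ (End.of e ^ k).asHom) ≫ p = p
      rw [Category.assoc, ih, he]
  have hεp : ε ≫ p = p := by rw [← hek, ← Category.assoc, h3]
  obtain ⟨Y, i, r, hi, hr⟩ := IsIdempotentComplete.idempotents_split Q.obj ε.hom
    (congrArg (·.hom) h1)
  let Q' : P.FullSubcategory := ⟨Y, P.prop_of_retract ⟨i, r, hi⟩ Q.2⟩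
  let i' : Q' ⟶ Q := ObjectProperty.homMk i
  let r' : Q ⟶ Q' := ObjectProperty.homMk r
  have hi' : i' ≫ r' = 𝟙 Q' := ObjectProperty.hom_ext _ hi
  have hr' : r' ≫ i' = ε := ObjectProperty.hom_ext _ hr
  refine hmin (Module.finrank K (Q' ⟶ Q')) ⟨Q', i' ≫ p, hQ.of_retract i' r' hi', ?_, rfl⟩ ?_
  · have h5 : r'.hom ≫ (i' ≫ p).hom = p.hom := by
      have : r' ≫ i' ≫ p = p := by rw [← Category.assoc, hr', hεp]
      exact congrArg (·.hom) this
    exact epi_of_epi_fac h5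
  · rw [← hn]
    exact finrank_end_lt_of_retract i' r' hi' (hr' ▸ h2)

/-- An inflation of `X` into an injective object with an endomorphism algebra of minimal dimension
is left minimal. -/
lemma exists_isInjectiveEnvelope [IsAbelianSubcategory P] [P.IsStableUnderRetracts]
    (hfin : ∀ X Y : P.FullSubcategory, FiniteDimensional K (X ⟶ Y)) (X : P.FullSubcategory)
    (hX : ∃ (I : P.FullSubcategory) (j : X ⟶ I), IsInj I ∧ Mono j.hom) :
    ∃ (I : P.FullSubcategory) (j : X ⟶ I), IsInjectiveEnvelope j := by
  obtain ⟨n, ⟨Q, p, hQ, hp, hn⟩, hmin⟩ := WellFounded.has_min (wellFounded_lt (α := ℕ))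
    {n | ∃ (Q : P.FullSubcategory) (p : X ⟶ Q), IsInj Q ∧ Mono p.hom ∧
      Module.finrank K (Q ⟶ Q) = n} (by
        obtain ⟨Q, p, h1, h2⟩ := hX
        exact ⟨_, Q, p, h1, h2, rfl⟩)
  refine ⟨Q, p, hQ, exists_conflation_of_mono p, fun e he => ?_⟩
  have := hfin Q Q
  refine (isIso_or_exists_idempotent K e).resolve_right ?_
  rintro ⟨k, ε, h1, h2, -, h3⟩
  -- the idempotent `ε` fixes `p`, so its image would be a smaller injective object under `X`
  have hek : p ≫ (End.of e ^ k).asHom = p := by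
    clear h3
    induction k with
    | zero => exact Category.comp_id p
    | succ k ih =>
      rw [pow_succ]
      change p ≫ e ≫ (End.of e ^ k).asHom = p
      rw [← Category.assoc, he, ih]
  have hεp : p ≫ ε = p := by
    conv_lhs => rw [← hek, Category.assoc, h3]
    exact hek
  obtain ⟨Y, i, r, hi, hr⟩ := IsIdempotentComplete.idempotents_split Q.obj ε.hom
    (congrArg (·.hom) h1)
  let Q' : P.FullSubcategory := ⟨Y, P.prop_of_retract ⟨i, r, hi⟩ Q.2⟩
  let i' : Q' ⟶ Q := ObjectProperty.homMk i
  let r' : Q ⟶ Q' := ObjectProperty.homMk r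
  have hi' : i' ≫ r' = 𝟙 Q' := ObjectProperty.hom_ext _ hi
  have hr' : r' ≫ i' = ε := ObjectProperty.hom_ext _ hr
  refine hmin (Module.finrank K (Q' ⟶ Q')) ⟨Q', p ≫ r', hQ.of_retract i' r' hi', ?_, rfl⟩ ?_
  · have h5 : (p ≫ r').hom ≫ i'.hom = p.hom := by
      have : (p ≫ r') ≫ i' = p := by rw [Category.assoc, hr', hεp]
      exact congrArg (·.hom) this
    exact mono_of_mono_fac h5
  · rw [← hn]
    exact finrank_end_lt_of_retract i' r' hi' (hr' ▸ h2)

end Strings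

section StringSystem

variable {A : Type w} [Category.{v} A] [Abelian A] {P : ObjectProperty A}

variable (P) in
/-- A system of objects `S j` such that each nonzero object has some `S j` as a retract, and of
projective-injective objects among them, of which all `S j` are quotients and subobjects. The
endomorphisms of the other `S j` are scalars, and the projective ones carry a symmetric form. -/
structure StringSystem (K : Type u) [Field K] [Linear K A] where
  J : Type
  S : J → P.FullSubcategory
  pr : J → Prop
  not_isZero : ∀ j, ¬ IsZero (S j)
  exists_retract : ∀ X, ¬ IsZero X → ∃ (j : J) (i : S j ⟶ X) (r : X ⟶ S j), i ≫ r = 𝟙 (S j)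
  isProj : ∀ {j}, pr j → IsProj (S j)
  isInj : ∀ {j}, pr j → IsInj (S j)
  cover : ∀ j, ∃ (k : J) (q : S k ⟶ S j), pr k ∧ Epi q.hom
  envelope : ∀ j, ∃ (k : J) (i : S j ⟶ S k), pr k ∧ Mono i.hom
  finrank_end : ∀ j, pr j ∨ Module.finrank K (S j ⟶ S j) = 1
  t : ∀ j, (S j ⟶ S j) →ₗ[K] K
  symm : ∀ {j k}, pr j → pr k → ∀ (u : S j ⟶ S k) (v : S k ⟶ S j), t j (u ≫ v) = t k (v ≫ u)
  left : ∀ {j M}, pr j → ∀ u : S j ⟶ M, (∀ v : M ⟶ S j, t j (u ≫ v) = 0) → u = 0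
  right : ∀ {j M}, pr j → ∀ v : M ⟶ S j, (∀ u : S j ⟶ M, t j (u ≫ v) = 0) → v = 0

namespace StringSystem

variable {K : Type u} [Field K] [Linear K A] (E : StringSystem P K)

/-- Induction on the dimension of the endomorphism algebra, splitting off one `S j` after the
other. -/
lemma induction [IsAbelianSubcategory P]
    (hfin : ∀ X Y : P.FullSubcategory, FiniteDimensional K (X ⟶ Y)) (p : P.FullSubcategory → Prop)
    (zero : ∀ X, IsZero X → p X)
    (step : ∀ (j : E.J) (R : P.FullSubcategory) (b : BinaryBicone (E.S j) R),
      b.fst ≫ b.inl + b.snd ≫ b.inr = 𝟙 b.pt → p R → p b.pt) (X : P.FullSubcategory) : p X := by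
  induction h : Module.finrank K (X ⟶ X) using Nat.strong_induction_on generalizing X with
  | _ n ih =>
    by_cases hX : IsZero X
    · exact zero X hX
    · obtain ⟨j, i, r, hir⟩ := E.exists_retract X hX
      obtain ⟨R, b, rfl, hb⟩ := exists_bicone_of_retract i r hir
      refine step j R b hb (ih _ ?_ R rfl)
      have := hfin b.pt b.pt
      rw [← h]
      refine finrank_end_lt_of_retract b.inr b.snd b.inr_snd fun h1 => E.not_isZero j ?_
      rw [h1, add_eq_right] at hb
      have h2 : 𝟙 (E.S j) = b.inl ≫ (b.fst ≫ b.inl) ≫ b.fst := by simp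
      rw [IsZero.iff_id_eq_zero, h2, hb]
      simp

/-- A decomposition of the identity of an object through projective objects among the `S j`. -/
structure Resolution (X : P.FullSubcategory) where
  idx : Type
  [fintype : Fintype idx]
  j : idx → E.J
  pr : ∀ a, E.pr (j a)
  i : ∀ a, E.S (j a) ⟶ X
  r : ∀ a, X ⟶ E.S (j a)
  sum_eq : ∑ a, r a ≫ i a = 𝟙 X

attribute [instance] Resolution.fintype

section Enough

variable [IsAbelianSubcategory P]
    (hfin : ∀ X Y : P.FullSubcategory, FiniteDimensional K (X ⟶ Y))

/-- The decomposition of the identity of a direct sum. -/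
noncomputable def resolutionBiprod (E : StringSystem P K) {k : E.J} (hk : E.pr k)
    {Q : P.FullSubcategory} (T : E.Resolution Q) : E.Resolution (E.S k ⊞ Q) where
  idx := Option T.idx
  j a := a.elim k T.j
  pr a := match a with
    | none => hk
    | some a => T.pr a
  i a := match a with
    | none => biprod.inl
    | some a => T.i a ≫ biprod.inr
  r a := match a with
    | none => biprod.fst
    | some a => biprod.snd ≫ T.r a
  sum_eq := by
    have h1 : ∑ a, ((biprod.snd : E.S k ⊞ Q ⟶ Q) ≫ T.r a) ≫ T.i a ≫
        (biprod.inr : Q ⟶ E.S k ⊞ Q) = biprod.snd ≫ biprod.inr := by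
      simp only [Category.assoc]
      simp only [← Category.assoc (T.r _), ← Preadditive.comp_sum, ← Preadditive.sum_comp,
        T.sum_eq, Category.id_comp]
    exact (Fintype.sum_option _).trans
      ((congrArg ((biprod.fst : E.S k ⊞ Q ⟶ _) ≫ biprod.inl + ·) h1).trans biprod.total)

include E hfin

/-- Each object is a quotient of a finite direct sum of projective objects `S j`. -/
lemma exists_proj_epi (X : P.FullSubcategory) :
    ∃ (Q : P.FullSubcategory) (q : Q ⟶ X), Nonempty (E.Resolution Q) ∧ IsProj Q ∧ IsInj Q ∧
      Epi q.hom := by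
  refine E.induction hfin (fun X => ∃ (Q : P.FullSubcategory) (q : Q ⟶ X),
    Nonempty (E.Resolution Q) ∧ IsProj Q ∧ IsInj Q ∧ Epi q.hom) (fun X hX => ?_)
    (fun j R b hb => ?_) X
  · refine ⟨X, 𝟙 X, ⟨Resolution.mk Empty Empty.elim (fun a => a.elim) (fun a => a.elim)
      (fun a => a.elim) (hX.eq_of_src _ _)⟩, fun _ _ _ f g _ h => ⟨0, hX.eq_of_src _ _⟩,
      fun _ _ _ f g _ h => ⟨0, hX.eq_of_tgt _ _⟩, inferInstanceAs (Epi (𝟙 X.obj))⟩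
  · rintro ⟨Q, q, ⟨T⟩, h1, h2, h3⟩
    obtain ⟨k, q', hk, h3'⟩ := E.cover j
    let d : E.S k ⊞ Q ⟶ b.pt := biprod.desc (q' ≫ b.inl) (q ≫ b.inr)
    refine ⟨E.S k ⊞ Q, d, ⟨E.resolutionBiprod hk T⟩, (E.isProj hk).biprod h1, (E.isInj hk).biprod h2,
      Preadditive.epi_of_cancel_zero _ fun {W} a ha => ?_⟩
    have e1 : q'.hom ≫ b.inl.hom ≫ a = 0 := by
      have : (biprod.inl ≫ d).hom ≫ a = 0 := by
        rw [ObjectProperty.FullSubcategory.comp_hom, Category.assoc, ha, comp_zero]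
      rwa [biprod.inl_desc, ObjectProperty.FullSubcategory.comp_hom, Category.assoc] at this
    have e2 : q.hom ≫ b.inr.hom ≫ a = 0 := by
      have : (biprod.inr ≫ d).hom ≫ a = 0 := by
        rw [ObjectProperty.FullSubcategory.comp_hom, Category.assoc, ha, comp_zero]
      rwa [biprod.inr_desc, ObjectProperty.FullSubcategory.comp_hom, Category.assoc] at this
    have e1' := zero_of_epi_comp _ e1
    have e2' := zero_of_epi_comp _ e2
    have hb' : b.fst.hom ≫ b.inl.hom + b.snd.hom ≫ b.inr.hom = 𝟙 b.pt.obj := congrArg (·.hom) hb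
    rw [← Category.id_comp a, ← hb', Preadditive.add_comp, Category.assoc, Category.assoc, e1', e2']
    simp

/-- Each object is a subobject of a projective and injective object. -/
lemma exists_inj_mono (X : P.FullSubcategory) :
    ∃ (I : P.FullSubcategory) (i : X ⟶ I), IsProj I ∧ IsInj I ∧ Mono i.hom := by
  refine E.induction hfin (fun X => ∃ (I : P.FullSubcategory) (i : X ⟶ I), IsProj I ∧ IsInj I ∧
    Mono i.hom) (fun X hX => ?_) (fun j R b hb => ?_) X
  · refine ⟨X, 𝟙 X, fun _ _ _ f g _ h => ⟨0, hX.eq_of_src _ _⟩,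
      fun _ _ _ f g _ h => ⟨0, hX.eq_of_tgt _ _⟩, inferInstanceAs (Mono (𝟙 X.obj))⟩
  · rintro ⟨Q, q, h1, h2, h3⟩
    obtain ⟨k, q', hk, h3'⟩ := E.envelope j
    let d : b.pt ⟶ E.S k ⊞ Q := biprod.lift (b.fst ≫ q') (b.snd ≫ q)
    refine ⟨E.S k ⊞ Q, d, (E.isProj hk).biprod h1, (E.isInj hk).biprod h2,
      Preadditive.mono_of_cancel_zero _ fun {W} a ha => ?_⟩
    have e1 : (a ≫ b.fst.hom) ≫ q'.hom = 0 := by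
      have : a ≫ (d ≫ biprod.fst).hom = 0 := by
        rw [ObjectProperty.FullSubcategory.comp_hom, ← Category.assoc, ha, zero_comp]
      rwa [biprod.lift_fst, ObjectProperty.FullSubcategory.comp_hom, ← Category.assoc] at this
    have e2 : (a ≫ b.snd.hom) ≫ q.hom = 0 := by
      have : a ≫ (d ≫ biprod.snd).hom = 0 := by
        rw [ObjectProperty.FullSubcategory.comp_hom, ← Category.assoc, ha, zero_comp]
      rwa [biprod.lift_snd, ObjectProperty.FullSubcategory.comp_hom, ← Category.assoc] at this
    have e1' := zero_of_comp_mono _ e1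
    have e2' := zero_of_comp_mono _ e2
    have hb' : b.fst.hom ≫ b.inl.hom + b.snd.hom ≫ b.inr.hom = 𝟙 b.pt.obj := congrArg (·.hom) hb
    rw [← Category.comp_id a, ← hb', Preadditive.comp_add, ← Category.assoc, ← Category.assoc, e1',
      e2']
    simp

/-- The projective objects are the retracts of direct sums of projective `S j`, and so are the
injective ones. -/
lemma isFrobeniusAbelian : IsFrobeniusAbelian P where
  enough_projectives X := by
    obtain ⟨Q, q, -, h1, -, h3⟩ := E.exists_proj_epi hfin X
    obtain ⟨L, k, hk⟩ := exists_conflation_of_epi q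
    exact ⟨L, Q, k, q, h1, hk⟩
  enough_injectives X := by
    obtain ⟨I, i, -, h2, h3⟩ := E.exists_inj_mono hfin X
    obtain ⟨L, k, hk⟩ := exists_conflation_of_mono i
    exact ⟨I, L, i, k, h2, hk⟩
  proj_iff_inj X := by
    constructor
    · intro hX
      obtain ⟨Q, q, -, -, h2, h3⟩ := E.exists_proj_epi hfin X
      obtain ⟨L, k, hk⟩ := exists_conflation_of_epi q
      obtain ⟨s, hs⟩ := hX k q hk (𝟙 X)
      exact h2.of_retract s q hs
    · intro hX
      obtain ⟨I, i, h1, -, h3⟩ := E.exists_inj_mono hfin X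
      obtain ⟨L, k, hk⟩ := exists_conflation_of_mono i
      obtain ⟨s, hs⟩ := hX i k hk (𝟙 X)
      exact h1.of_retract i s hs

end Enough

/-! ### The symmetric form -/

section Form

variable {E}

/-- The linear form on the endomorphisms of `X` defined by a decomposition of its identity. -/
def Resolution.form {X : P.FullSubcategory} (T : E.Resolution X) : (X ⟶ X) →ₗ[K] K :=
  ∑ a, E.t (T.j a) ∘ₗ Linear.rightComp K _ (T.r a) ∘ₗ Linear.leftComp K _ (T.i a)

lemma Resolution.form_apply {X : P.FullSubcategory} (T : E.Resolution X) (f : X ⟶ X) :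
    T.form f = ∑ a, E.t (T.j a) (T.i a ≫ f ≫ T.r a) := by
  simp [Resolution.form]

/-- The trace of a product of matrices is symmetric; in particular the form does not depend on the
decomposition of the identity. -/
lemma Resolution.form_symm {X Y : P.FullSubcategory} (T : E.Resolution X) (T' : E.Resolution Y)
    (u : X ⟶ Y) (v : Y ⟶ X) : T.form (u ≫ v) = T'.form (v ≫ u) := by
  have h1 : ∀ a, E.t (T.j a) (T.i a ≫ (u ≫ v) ≫ T.r a) =
      ∑ c, E.t (T.j a) ((T.i a ≫ u ≫ T'.r c) ≫ (T'.i c ≫ v ≫ T.r a)) := by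
    intro a
    rw [← map_sum]
    congr 1
    simp only [Category.assoc]
    simp only [← Category.assoc (T'.r _), ← Preadditive.comp_sum, ← Preadditive.sum_comp, T'.sum_eq,
      Category.id_comp]
  have h2 : ∀ c, E.t (T'.j c) (T'.i c ≫ (v ≫ u) ≫ T'.r c) =
      ∑ a, E.t (T'.j c) ((T'.i c ≫ v ≫ T.r a) ≫ (T.i a ≫ u ≫ T'.r c)) := by
    intro c
    rw [← map_sum]
    congr 1
    simp only [Category.assoc]
    simp only [← Category.assoc (T.r _), ← Preadditive.comp_sum, ← Preadditive.sum_comp, T.sum_eq,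
      Category.id_comp]
  rw [form_apply, form_apply, Finset.sum_congr rfl fun a _ => h1 a,
    Finset.sum_congr rfl fun c _ => h2 c, Finset.sum_comm]
  exact Finset.sum_congr rfl fun c _ => Finset.sum_congr rfl fun a _ =>
    E.symm (T.pr a) (T'.pr c) _ _

lemma Resolution.form_comp_i {X : P.FullSubcategory} (T : E.Resolution X) (a : T.idx)
    (f : X ⟶ E.S (T.j a)) : T.form (f ≫ T.i a) = E.t (T.j a) (T.i a ≫ f) := by
  have h1 : ∀ c, E.t (T.j c) (T.i c ≫ (f ≫ T.i a) ≫ T.r c) =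
      E.t (T.j a) ((T.i a ≫ T.r c) ≫ (T.i c ≫ f)) := by
    intro c
    rw [E.symm (T.pr a) (T.pr c)]
    simp
  rw [form_apply, Finset.sum_congr rfl fun c _ => h1 c, ← map_sum]
  congr 1
  simp only [Category.assoc]
  simp only [← Category.assoc (T.r _), ← Preadditive.comp_sum, ← Preadditive.sum_comp, T.sum_eq,
    Category.id_comp]

lemma Resolution.form_r_comp {X : P.FullSubcategory} (T : E.Resolution X) (a : T.idx)
    (f : E.S (T.j a) ⟶ X) : T.form (T.r a ≫ f) = E.t (T.j a) (f ≫ T.r a) := by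
  have h1 : ∀ c, E.t (T.j c) (T.i c ≫ (T.r a ≫ f) ≫ T.r c) =
      E.t (T.j a) ((f ≫ T.r c) ≫ (T.i c ≫ T.r a)) := by
    intro c
    rw [E.symm (T.pr a) (T.pr c)]
    simp
  rw [form_apply, Finset.sum_congr rfl fun c _ => h1 c, ← map_sum]
  congr 1
  simp only [Category.assoc]
  simp only [← Category.assoc (T.r _), ← Preadditive.comp_sum, ← Preadditive.sum_comp, T.sum_eq,
    Category.id_comp]

variable (E)

variable [IsAbelianSubcategory P]
    (hfin : ∀ X Y : P.FullSubcategory, FiniteDimensional K (X ⟶ Y))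

include hfin in
/-- A projective object is a retract of a finite direct sum of projective objects `S j`. -/
lemma nonempty_resolution (X : P.FullSubcategory) (hX : IsProj X) : Nonempty (E.Resolution X) := by
  obtain ⟨Q, q, ⟨T⟩, -, -, h3⟩ := E.exists_proj_epi hfin X
  obtain ⟨L, k, hk⟩ := exists_conflation_of_epi q
  obtain ⟨s, hs⟩ := hX k q hk (𝟙 X)
  refine ⟨{ idx := T.idx, j := T.j, pr := T.pr, i := fun a => T.i a ≫ q, r := fun a => s ≫ T.r a,
            sum_eq := ?_ }⟩
  simp only [Category.assoc]
  simp only [← Category.assoc (T.r _), ← Preadditive.comp_sum, ← Preadditive.sum_comp, T.sum_eq,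
    Category.id_comp, hs]

open Classical in
/-- The symmetric form on all projective objects obtained from the forms on the `S j`. -/
noncomputable def symmetricForm : SymmetricForm P K where
  t Q := if h : IsProj Q then (E.nonempty_resolution hfin Q h).some.form else 0
  symm {Q R} hQ hR u v := by
    rw [dif_pos hQ, dif_pos hR]
    exact Resolution.form_symm _ _ u v
  left {Q M} hQ u hu := by
    simp only [dif_pos hQ] at hu
    set T := (E.nonempty_resolution hfin Q hQ).some
    have h1 : ∀ a, T.i a ≫ u = 0 := fun a => E.left (T.pr a) _ fun v => by
      have := hu (v ≫ T.i a)
      rwa [← Category.assoc, T.form_comp_i, ← Category.assoc] at this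
    rw [← Category.id_comp u, ← T.sum_eq, Preadditive.sum_comp]
    exact Finset.sum_eq_zero fun a _ => by rw [Category.assoc, h1, comp_zero]
  right {Q M} hQ v hv := by
    simp only [dif_pos hQ] at hv
    set T := (E.nonempty_resolution hfin Q hQ).some
    have h1 : ∀ a, v ≫ T.r a = 0 := fun a => E.right (T.pr a) _ fun u => by
      have := hv (T.r a ≫ u)
      rwa [Category.assoc, T.form_r_comp, Category.assoc] at this
    rw [← Category.comp_id v, ← T.sum_eq, Preadditive.comp_sum]
    exact Finset.sum_eq_zero fun a _ => by rw [← Category.assoc, h1, zero_comp]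

end Form

/-! ### The Krull--Schmidt property of the stable category -/

section KrullSchmidt

variable [hP : IsFrobeniusAbelian P]
    (hfin : ∀ X Y : P.FullSubcategory, FiniteDimensional K (X ⟶ Y))

lemma isProj_of_isZero_stab {X : P.FullSubcategory} (h : IsZero ((stabilisation P).obj X)) :
    IsProj X := by
  have h1 : 𝟙 X ∈ projHom P X X := by
    rw [← stab_map_eq_zero_iff]
    exact h.eq_of_src _ _
  obtain ⟨I, Y, i, p, hI, hip⟩ := hP.enough_injectives X
  obtain ⟨c, -, hc⟩ := hip.exists_extension h1
  exact ((hP.proj_iff_inj I).2 hI).of_retract i c hc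

include hfin in
/-- A stable endomorphism of a nonprojective `S j` comes from an endomorphism, which is a scalar. -/
lemma finrank_stable_end (j : E.J) (hj : ¬ IsProj (E.S j)) :
    Module.finrank K ((stabilisation P).obj (E.S j) ⟶ (stabilisation P).obj (E.S j)) = 1 := by
  have h1 := (E.finrank_end j).resolve_left fun h => hj (E.isProj h)
  have := hfin (E.S j) (E.S j)
  let φ : (E.S j ⟶ E.S j) →ₗ[K] _ := (stabilisation P).mapLinearMap K
  have h2 := LinearMap.finrank_le_finrank_of_surjective (f := φ) (stabilisation P).map_surjective
  have : FiniteDimensional K ((stabilisation P).obj (E.S j) ⟶ (stabilisation P).obj (E.S j)) :=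
    stableCategory_isHomFinite hfin _ _
  have h3 : Nontrivial ((stabilisation P).obj (E.S j) ⟶ (stabilisation P).obj (E.S j)) :=
    ⟨𝟙 _, 0, fun h => hj (isProj_of_isZero_stab ((IsZero.iff_id_eq_zero _).2 h))⟩
  have := Module.finrank_pos (R := K)
    (M := (stabilisation P).obj (E.S j) ⟶ (stabilisation P).obj (E.S j))
  omega

lemma isLocalRing_end_of_finrank_eq_one {C : Type*} [Category* C] [Preadditive C] [Linear K C]
    (X : C) (h : Module.finrank K (X ⟶ X) = 1) : IsLocalRing (End X) := by
  have hne : 𝟙 X ≠ 0 := fun h0 => by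
    have : Subsingleton (X ⟶ X) := ⟨fun a b => by
      rw [← Category.comp_id a, ← Category.comp_id b, h0, comp_zero, comp_zero]⟩
    rw [Module.finrank_zero_of_subsingleton] at h
    exact zero_ne_one h
  have h1 := (finrank_eq_one_iff_of_nonzero' _ hne).1 h
  have : Nontrivial (End X) := ⟨𝟙 X, 0, hne⟩
  have hu : ∀ c : K, c ≠ 0 → IsUnit (End.of (c • 𝟙 X)) := fun c hc =>
    ⟨⟨c • 𝟙 X, c⁻¹ • 𝟙 X, by
      change (c⁻¹ • 𝟙 X) ≫ (c • 𝟙 X) = 𝟙 X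
      simp [smul_smul, hc], by
      change (c • 𝟙 X) ≫ (c⁻¹ • 𝟙 X) = 𝟙 X
      simp [smul_smul, hc]⟩, rfl⟩
  refine IsLocalRing.of_is_unit_or_is_unit_of_add_one fun {a b} hab => ?_
  obtain ⟨c, rfl⟩ := h1 a
  obtain ⟨d, rfl⟩ := h1 b
  by_cases hc : c = 0
  · refine Or.inr (hu d fun hd => hne ?_)
    rw [hc, hd, zero_smul, add_zero] at hab
    exact hab.symm
  · exact Or.inl (hu c hc)

lemma isIndecomposable_of_iso {C : Type*} [Category* C] [Preadditive C] {X Y : C} (e : X ≅ Y)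
    (h : IsIndecomposable X) : IsIndecomposable Y :=
  ⟨fun hY => h.1 (hY.of_iso e), fun U V b hb ⟨i⟩ => h.2 U V b hb ⟨i ≪≫ e.symm⟩⟩

lemma finrank_end_of_iso {C : Type*} [Category* C] [Preadditive C] [Linear K C] {X Y : C}
    (e : X ≅ Y) : Module.finrank K (X ⟶ X) = Module.finrank K (Y ⟶ Y) :=
  (Linear.homCongr K e e).finrank_eq

omit hP in
/-- The image of a decomposition of an object. -/
lemma stab_total {S R : P.FullSubcategory} (b : BinaryBicone S R)
    (hb : b.fst ≫ b.inl + b.snd ≫ b.inr = 𝟙 b.pt) :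
    (stabilisation P).map b.fst ≫ (stabilisation P).map b.inl +
      (stabilisation P).map b.snd ≫ (stabilisation P).map b.inr = 𝟙 _ := by
  rw [← (stabilisation P).map_comp, ← (stabilisation P).map_comp, ← (stabilisation P).map_add, hb,
    (stabilisation P).map_id]

/-- A summand which is stably zero can be dropped. -/
noncomputable def stabSndIso {S R : P.FullSubcategory} (b : BinaryBicone S R)
    (hb : b.fst ≫ b.inl + b.snd ≫ b.inr = 𝟙 b.pt) (h : IsZero ((stabilisation P).obj S)) :
    (stabilisation P).obj b.pt ≅ (stabilisation P).obj R where
  hom := (stabilisation P).map b.snd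
  inv := (stabilisation P).map b.inr
  hom_inv_id := by
    rw [← stab_total b hb, h.eq_of_tgt ((stabilisation P).map b.fst) 0, zero_comp, zero_add]
  inv_hom_id := by rw [← (stabilisation P).map_comp, b.inr_snd, (stabilisation P).map_id]

/-- A summand which is stably zero can be dropped. -/
noncomputable def stabFstIso' {S R : P.FullSubcategory} (b : BinaryBicone S R)
    (hb : b.fst ≫ b.inl + b.snd ≫ b.inr = 𝟙 b.pt) (h : IsZero ((stabilisation P).obj R)) :
    (stabilisation P).obj b.pt ≅ (stabilisation P).obj S where
  hom := (stabilisation P).map b.fst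
  inv := (stabilisation P).map b.inl
  hom_inv_id := by
    rw [← stab_total b hb, h.eq_of_tgt ((stabilisation P).map b.snd) 0, zero_comp, add_zero]
  inv_hom_id := by rw [← (stabilisation P).map_comp, b.inl_fst, (stabilisation P).map_id]

include E hfin

/-- The endomorphisms of an indecomposable object of the stable category are scalars. -/
lemma finrank_end_of_isIndecomposable (X : StableCategory P) (hX : IsIndecomposable X) :
    Module.finrank K (X ⟶ X) = 1 := by
  obtain ⟨X⟩ := X
  revert hX
  refine E.induction hfin (fun X => IsIndecomposable ((stabilisation P).obj X) →
    Module.finrank K ((stabilisation P).obj X ⟶ (stabilisation P).obj X) = 1) (fun X hX h => ?_)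
    (fun j R b hb hR h => ?_) X
  · exact absurd ((stabilisation P).map_isZero hX) h.1
  · by_cases hj : IsProj (E.S j)
    · let e := stabSndIso b hb (isZero_stab_obj hj)
      rw [finrank_end_of_iso (K := K) e]
      exact hR (isIndecomposable_of_iso e h)
    · rcases h.2 _ _ ((stabilisation P).mapBinaryBicone b)
        ⟨isBinaryBilimitOfTotal _ (stab_total b hb)⟩ ⟨Iso.refl _⟩ with h1 | h1
      · exact absurd (isProj_of_isZero_stab h1) hj
      · rw [finrank_end_of_iso (K := K) (stabFstIso' b hb h1)]
        exact E.finrank_stable_end hfin j hj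

/-- In the stable category each object is the direct sum of its nonprojective summands `S j`. -/
lemma exists_stable_decomposition (X : P.FullSubcategory) :
    ∃ (I : Type) (_ : Fintype I) (Y : I → StableCategory P) (B : Bicone Y),
      Nonempty B.IsBilimit ∧ Nonempty (B.pt ≅ (stabilisation P).obj X) ∧
        ∀ i, IsLocalRing (End (Y i)) := by
  classical
  refine E.induction hfin (fun X => ∃ (I : Type) (_ : Fintype I) (Y : I → StableCategory P)
    (B : Bicone Y), Nonempty B.IsBilimit ∧ Nonempty (B.pt ≅ (stabilisation P).obj X) ∧
      ∀ i, IsLocalRing (End (Y i))) (fun X hX => ?_) (fun j R b hb hR => ?_) X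
  · refine ⟨Empty, inferInstance, Empty.elim, Bicone.mk ((stabilisation P).obj X) (fun a => a.elim)
      (fun a => a.elim) (fun a => a.elim), ⟨isBilimitOfTotal _ ?_⟩, ⟨Iso.refl _⟩, fun a => a.elim⟩
    exact ((stabilisation P).map_isZero hX).eq_of_src _ _
  · obtain ⟨I, hI, Y, B, ⟨hB⟩, ⟨e⟩, hY⟩ := hR
    by_cases hj : IsProj (E.S j)
    · exact ⟨I, hI, Y, B, ⟨hB⟩, ⟨e ≪≫ (stabSndIso b hb (isZero_stab_obj hj)).symm⟩, hY⟩
    · have h1 : (stabilisation P).map b.inl ≫ (stabilisation P).map b.fst = 𝟙 _ := by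
        rw [← (stabilisation P).map_comp, b.inl_fst, (stabilisation P).map_id]
      have h2 : (stabilisation P).map b.inr ≫ (stabilisation P).map b.snd = 𝟙 _ := by
        rw [← (stabilisation P).map_comp, b.inr_snd, (stabilisation P).map_id]
      have h3 : (stabilisation P).map b.inl ≫ (stabilisation P).map b.snd = 0 := by
        rw [← (stabilisation P).map_comp, b.inl_snd, (stabilisation P).map_zero]
      have h4 : (stabilisation P).map b.inr ≫ (stabilisation P).map b.fst = 0 := by
        rw [← (stabilisation P).map_comp, b.inr_fst, (stabilisation P).map_zero]
      let Y' : Option I → StableCategory P := fun a => match a with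
        | none => (stabilisation P).obj (E.S j)
        | some a => Y a
      let π' : ∀ a, (stabilisation P).obj b.pt ⟶ Y' a := fun a => match a with
        | none => (stabilisation P).map b.fst
        | some a => (stabilisation P).map b.snd ≫ e.inv ≫ B.π a
      let ι' : ∀ a, Y' a ⟶ (stabilisation P).obj b.pt := fun a => match a with
        | none => (stabilisation P).map b.inl
        | some a => B.ι a ≫ e.hom ≫ (stabilisation P).map b.inr
      refine ⟨Option I, inferInstance, Y', Bicone.mk ((stabilisation P).obj b.pt) π' ι' ?_,
        ⟨isBilimitOfTotal _ ?_⟩, ⟨Iso.refl _⟩, fun a => ?_⟩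
      · rintro (_ | a) (_ | c)
        · simpa [π', ι'] using h1
        · simp only [π', ι', reduceCtorEq, dite_false]
          rw [← Category.assoc, h3, zero_comp]
        · simp only [π', ι', reduceCtorEq, dite_false, Category.assoc]
          rw [h4, comp_zero, comp_zero]
        · simp only [π', ι', Category.assoc]
          rw [← Category.assoc ((stabilisation P).map b.inr), h2, Category.id_comp,
            Iso.hom_inv_id_assoc, B.ι_π]
          by_cases hac : a = c
          · subst hac
            rw [dif_pos rfl, dif_pos rfl]
          · simp [hac]
      · have h5 : ∑ a, ((stabilisation P).map b.snd ≫ e.inv ≫ B.π a) ≫ B.ι a ≫ e.hom ≫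
            (stabilisation P).map b.inr =
              (stabilisation P).map b.snd ≫ (stabilisation P).map b.inr := by
          have h6 : ∑ a, B.π a ≫ B.ι a = 𝟙 B.pt := IsBilimit.total hB
          simp only [Category.assoc]
          simp only [← Category.assoc (B.π _), ← Preadditive.comp_sum, ← Preadditive.sum_comp, h6]
          simp
        exact (Fintype.sum_option _).trans
          ((congrArg ((stabilisation P).map b.fst ≫ (stabilisation P).map b.inl + ·) h5).trans
            (stab_total b hb))
      · match a with
        | none => exact isLocalRing_end_of_finrank_eq_one _ (E.finrank_stable_end hfin j hj)
        | some a => exact hY a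

/-- The stable category is a Krull--Schmidt category. -/
theorem isKrullSchmidt : IsKrullSchmidt (StableCategory P) := by
  classical
  refine ⟨?_, fun ⟨X⟩ => ?_⟩
  · have : HasBinaryBiproducts (StableCategory P) := ⟨fun ⟨X⟩ ⟨Y⟩ =>
      ⟨⟨⟨(stabilisation P).mapBinaryBicone (BinaryBiproduct.bicone X Y),
        isBinaryBilimitOfTotal _ (stab_total _ biprod.total)⟩⟩⟩⟩
    have : HasBinaryProducts (StableCategory P) := inferInstance
    have : HasFiniteProducts (StableCategory P) := hasFiniteProducts_of_has_binary_and_terminal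
    exact HasFiniteBiproducts.of_hasFiniteProducts
  · obtain ⟨I, hI, Y, B, ⟨hB⟩, ⟨e⟩, hY⟩ := E.exists_stable_decomposition hfin X
    let g := (Fintype.equivFin I).symm
    exact ⟨_, Y ∘ g, B.whisker g, ⟨(B.whiskerIsBilimitIff g).symm hB⟩, ⟨e⟩, fun i => hY (g i)⟩

end KrullSchmidt

end StringSystem

end StringSystem

/-! ### The lifts of the points of the `∞`-gon to the real line -/

namespace InfinityGon

variable {m : ℕ} (Z : InfinityGon m)

lemma acc_lt_point (p : Fin m) (n : ℤ) : Z.acc p.castSucc < Z.point p n :=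
  ((Z.point_strictMono p).monotone.le_of_tendsto (Z.tendsto_atBot p) (n - 1)).trans_lt
    (Z.point_strictMono p (by omega))

lemma point_lt_acc (p : Fin m) (n : ℤ) : Z.point p n < Z.acc p.succ :=
  (Z.point_strictMono p (by omega : n < n + 1)).trans_le
    ((Z.point_strictMono p).monotone.ge_of_tendsto (Z.tendsto_atTop p) (n + 1))

lemma acc_nonneg (q : Fin (m + 1)) : 0 ≤ Z.acc q :=
  Z.acc_zero ▸ Z.acc_strictMono.monotone (Fin.zero_le q)

lemma acc_le (q : Fin (m + 1)) : Z.acc q ≤ 2 * Real.pi :=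
  Z.acc_last ▸ Z.acc_strictMono.monotone (Fin.le_last q)

/-- The point `point p n` after `k` full turns, seen in the universal cover of the circle. -/
noncomputable def pt (i : ℤ × Fin m × ℤ) : ℝ := Z.point i.2.1 i.2.2 + i.1 * (2 * Real.pi)

/-- The successor of a lifted point. -/
def next (i : ℤ × Fin m × ℤ) : ℤ × Fin m × ℤ := (i.1, i.2.1, i.2.2 + 1)

/-- The predecessor of a lifted point. -/
def prev (i : ℤ × Fin m × ℤ) : ℤ × Fin m × ℤ := (i.1, i.2.1, i.2.2 - 1)

/-- The translate of a lifted point by `l` full turns. -/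
def turn (l : ℤ) (i : ℤ × Fin m × ℤ) : ℤ × Fin m × ℤ := (i.1 + l, i.2.1, i.2.2)

omit Z in
@[simp] lemma next_prev (i : ℤ × Fin m × ℤ) : next (prev i) = i := by simp [next, prev]

omit Z in
@[simp] lemma next_turn (l : ℤ) (i : ℤ × Fin m × ℤ) : next (turn l i) = turn l (next i) := rfl

@[simp] lemma pt_turn (l : ℤ) (i : ℤ × Fin m × ℤ) : Z.pt (turn l i) = Z.pt i + l * (2 * Real.pi) := by
  simp [pt, turn]; ring

lemma pt_lt_next (i : ℤ × Fin m × ℤ) : Z.pt i < Z.pt (next i) := by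
  have := Z.point_strictMono i.2.1 (by omega : i.2.2 < i.2.2 + 1)
  simpa [pt, next] using this

lemma lt_pt (i : ℤ × Fin m × ℤ) : i.1 * (2 * Real.pi) < Z.pt i := by
  have h1 := Z.acc_lt_point i.2.1 i.2.2
  have h2 := Z.acc_nonneg i.2.1.castSucc
  unfold pt; linarith

lemma pt_lt (i : ℤ × Fin m × ℤ) : Z.pt i < (i.1 + 1) * (2 * Real.pi) := by
  have h1 := Z.point_lt_acc i.2.1 i.2.2
  have h2 := Z.acc_le i.2.1.succ
  unfold pt; linarith

/-- There is no lifted point between a lifted point and its successor. -/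
lemma next_le_of_lt {i j : ℤ × Fin m × ℤ} (h : Z.pt i < Z.pt j) : Z.pt (next i) ≤ Z.pt j := by
  have hpi := Real.two_pi_pos
  rcases lt_trichotomy i.1 j.1 with h1 | h1 | h1
  · have h2 := Z.pt_lt (next i)
    have h3 := Z.lt_pt j
    have h4 : ((i.1 : ℝ) + 1) ≤ j.1 := by exact_mod_cast h1
    have h5 := mul_le_mul_of_nonneg_right h4 hpi.le
    have h6 : ((next i).1 : ℝ) = i.1 := rfl
    rw [h6] at h2
    linarith
  · obtain ⟨k, p, n⟩ := i
    obtain ⟨l, q, r⟩ := j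
    obtain rfl : k = l := h1
    simp only [pt, next, add_lt_add_iff_right, add_le_add_iff_right] at h ⊢
    rcases lt_trichotomy p q with h2 | rfl | h2
    · have h3 := Z.acc_strictMono.monotone (show p.succ ≤ q.castSucc from h2)
      have h4 := Z.point_lt_acc p (n + 1)
      have h5 := Z.acc_lt_point q r
      linarith
    · have := (Z.point_strictMono p).lt_iff_lt.1 h
      exact (Z.point_strictMono p).monotone (by omega)
    · have h3 := Z.acc_strictMono.monotone (show q.succ ≤ p.castSucc from h2)
      have h4 := Z.point_lt_acc q r
      have h5 := Z.acc_lt_point p n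
      linarith
  · have h2 := Z.pt_lt j
    have h3 := Z.lt_pt i
    have h4 : ((j.1 : ℝ) + 1) ≤ i.1 := by exact_mod_cast h1
    have h5 := mul_le_mul_of_nonneg_right h4 hpi.le
    linarith

lemma le_of_lt_next {i j : ℤ × Fin m × ℤ} (h : Z.pt i < Z.pt (next j)) : Z.pt i ≤ Z.pt j :=
  not_lt.1 fun h1 => (Z.next_le_of_lt h1).not_gt h

lemma pt_next_lt_iff {i j : ℤ × Fin m × ℤ} : Z.pt (next i) < Z.pt (next j) ↔ Z.pt i < Z.pt j :=
  ⟨fun h => (Z.pt_lt_next i).trans_le (Z.le_of_lt_next h),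
    fun h => (Z.next_le_of_lt h).trans_lt (Z.pt_lt_next j)⟩

lemma pt_next_le_iff {i j : ℤ × Fin m × ℤ} : Z.pt (next i) ≤ Z.pt (next j) ↔ Z.pt i ≤ Z.pt j := by
  rw [← not_lt, ← not_lt, pt_next_lt_iff]

/-- The lifted accumulation points. -/
noncomputable def accLift (i : ℤ × Fin m) : ℝ := Z.acc i.2.castSucc + i.1 * (2 * Real.pi)

lemma exists_mem_Ico_acc {s : ℝ} (h0 : 0 ≤ s) (h1 : s < 2 * Real.pi) :
    ∃ p : Fin m, Z.acc p.castSucc ≤ s ∧ s < Z.acc p.succ := by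
  by_contra! h
  have h2 : ∀ q : Fin (m + 1), Z.acc q ≤ s := by
    intro q
    induction q using Fin.induction with
    | zero => rw [Z.acc_zero]; exact h0
    | succ q ih => exact h q ih
  have := h2 (Fin.last m)
  rw [Z.acc_last] at this
  linarith

lemma exists_point_lt (p : Fin m) {s : ℝ} (h : Z.acc p.castSucc < s) : ∃ n, Z.point p n < s :=
  ((Z.tendsto_atBot p).eventually_lt_const h).exists

lemma exists_lt_point (p : Fin m) {s : ℝ} (h : s < Z.acc p.succ) : ∃ n, s < Z.point p n :=
  ((Z.tendsto_atTop p).eventually_const_lt h).exists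

/-- Each real number is a lifted accumulation point or belongs to a unique gap `(z, z⁺]`. -/
lemma exists_mem_Ioc (t : ℝ) :
    (∃ i, Z.pt i < t ∧ t ≤ Z.pt (next i)) ∨ ∃ i, t = Z.accLift i := by
  have h0 := toIcoMod_mem_Ico' Real.two_pi_pos t
  have h1 := toIcoMod_add_toIcoDiv_zsmul Real.two_pi_pos 0 t
  set s := toIcoMod Real.two_pi_pos 0 t
  set k := toIcoDiv Real.two_pi_pos 0 t
  rw [zsmul_eq_mul] at h1
  obtain ⟨p, hp, hp'⟩ := Z.exists_mem_Ico_acc h0.1 h0.2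
  rcases hp.eq_or_lt with hp | hp
  · exact Or.inr ⟨(k, p), by rw [accLift, hp, h1]⟩
  · left
    obtain ⟨n₀, hn₀⟩ := Z.exists_point_lt p hp
    obtain ⟨n₁, hn₁⟩ := Z.exists_lt_point p hp'
    obtain ⟨n, hn, hmax⟩ := Int.exists_greatest_of_bdd (P := fun n => Z.point p n < s)
      ⟨n₁, fun n hn => (Z.point_strictMono p).lt_iff_lt.1 (hn.trans hn₁) |>.le⟩ ⟨n₀, hn₀⟩
    refine ⟨(k, p, n), ?_, ?_⟩
    · simp only [pt]; linarith
    · have : ¬ Z.point p (n + 1) < s := fun h => by have := hmax _ h; omega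
      simp only [pt, next]; linarith

/-- Each real number is a lifted accumulation point or belongs to a unique gap `[z, z⁺)`. -/
lemma exists_mem_Ico (t : ℝ) :
    (∃ i, Z.pt i ≤ t ∧ t < Z.pt (next i)) ∨ ∃ i, t = Z.accLift i := by
  rcases Z.exists_mem_Ioc t with ⟨i, h1, h2⟩ | h
  · rcases h2.eq_or_lt with h2 | h2
    · exact Or.inl ⟨next i, h2.ge, h2.trans_lt (Z.pt_lt_next _)⟩
    · exact Or.inl ⟨i, h1.le, h2⟩
  · exact Or.inr h

/-- Lifted points accumulate at a lifted accumulation point from above. -/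
lemma exists_pt_gt (i : ℤ × Fin m) {b : ℝ} (h : Z.accLift i < b) :
    ∃ j, Z.accLift i < Z.pt j ∧ Z.pt j < b := by
  obtain ⟨n, hn⟩ := Z.exists_point_lt i.2 (s := b - i.1 * (2 * Real.pi)) (by
    unfold accLift at h; linarith)
  refine ⟨(i.1, i.2, n), ?_, ?_⟩
  · have := Z.acc_lt_point i.2 n
    simp only [pt, accLift]; linarith
  · simp only [pt]; linarith

/-- Lifted points accumulate at a lifted accumulation point from below. -/
lemma exists_pt_lt (i : ℤ × Fin m) {a : ℝ} (h : a < Z.accLift i) :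
    ∃ j, a < Z.pt j ∧ Z.pt j < Z.accLift i := by
  obtain ⟨k, p⟩ := i
  -- an accumulation point is the right end of the preceding arc, possibly in the previous turn
  have key : ∃ (l : ℤ) (q : Fin m), Z.accLift (k, p) = Z.acc q.succ + l * (2 * Real.pi) := by
    by_cases hp : (p : ℕ) = 0
    · have hm : 0 < m := p.pos
      refine ⟨k - 1, ⟨m - 1, by omega⟩, ?_⟩
      have h1 : (⟨m - 1, by omega⟩ : Fin m).succ = Fin.last m := by
        ext; simp; omega
      have h2 : p.castSucc = 0 := by ext; simpa using hp
      simp only [accLift]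
      rw [h1, h2, Z.acc_zero, Z.acc_last]
      push_cast
      ring
    · refine ⟨k, ⟨p - 1, by omega⟩, ?_⟩
      have h1 : (⟨p - 1, by omega⟩ : Fin m).succ = p.castSucc := by
        ext; simp; omega
      rw [h1, accLift]
  obtain ⟨l, q, hq⟩ := key
  rw [hq] at h ⊢
  obtain ⟨n, hn⟩ := Z.exists_lt_point q (s := a - l * (2 * Real.pi)) (by linarith)
  refine ⟨(l, q, n), ?_, ?_⟩
  · simp only [pt]; linarith
  · have := Z.point_lt_acc q n
    simp only [pt]; linarith

lemma pt_ne_accLift (i : ℤ × Fin m × ℤ) (j : ℤ × Fin m) : Z.pt i ≠ Z.accLift j := fun h => by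
  have h0 := Z.pt_lt_next (prev i)
  rw [next_prev, h] at h0
  obtain ⟨a, h1, h2⟩ := Z.exists_pt_lt j h0
  have h3 := Z.next_le_of_lt h1
  rw [next_prev, h] at h3
  exact h3.not_gt h2

lemma ofReal_add_turn (t : ℝ) (l : ℤ) :
    CircleCat.ofReal (t + l * (2 * Real.pi)) = CircleCat.ofReal t := by
  unfold CircleCat.ofReal
  congr 1
  rw [← zsmul_eq_mul, AddCircle.coe_add, AddCircle.coe_zsmul, AddCircle.coe_period]
  simp

end InfinityGon

lemma CircleCat.ofReal_eq_iff {s t : ℝ} :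
    ofReal s = ofReal t ↔ ∃ l : ℤ, s = t + l * (2 * Real.pi) := by
  constructor
  · intro h
    have h1 : (s : AddCircle (2 * Real.pi)) = t := congrArg CircleCat.pt h
    rw [← sub_eq_zero, ← AddCircle.coe_sub, AddCircle.coe_eq_zero_iff] at h1
    obtain ⟨l, hl⟩ := h1
    rw [zsmul_eq_mul] at hl
    exact ⟨l, by linarith⟩
  · rintro ⟨l, rfl⟩
    exact InfinityGon.ofReal_add_turn t l

namespace InfinityGon

variable {m : ℕ} (Z : InfinityGon m)

lemma isLift_iff {t : ℝ} : Z.IsLift t ↔ ∃ i, t = Z.pt i := by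
  constructor
  · rintro ⟨p, n, h⟩
    obtain ⟨l, hl⟩ := CircleCat.ofReal_eq_iff.1 h
    exact ⟨(l, p, n), hl⟩
  · rintro ⟨i, rfl⟩
    exact ⟨i.2.1, i.2.2, CircleCat.ofReal_eq_iff.2 ⟨i.1, rfl⟩⟩

lemma exists_eq_pt_of_ofReal_eq {t : ℝ} {i : ℤ × Fin m × ℤ}
    (h : CircleCat.ofReal t = CircleCat.ofReal (Z.pt i)) : ∃ l, t = Z.pt (turn l i) := by
  obtain ⟨l, rfl⟩ := CircleCat.ofReal_eq_iff.1 h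
  exact ⟨l, (Z.pt_turn l i).symm⟩

/-- The Kupisch function on a gap. -/
lemma add_kupisch_of_mem {t : ℝ} {i : ℤ × Fin m × ℤ} (h1 : Z.pt i ≤ t) (h2 : t < Z.pt (next i)) :
    t + Z.kupisch t = Z.pt (next i) + 2 * Real.pi := by
  obtain ⟨k, p, n⟩ := i
  have h3 := Z.lt_pt (k, p, n)
  have h4 := Z.pt_lt (next (k, p, n))
  simp only [pt, next] at h1 h2 h3 h4
  have hs : toIcoMod Real.two_pi_pos 0 t = t - k * (2 * Real.pi) := by
    rw [toIcoMod_eq_iff]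
    refine ⟨⟨by linarith, by linarith⟩, k, ?_⟩
    rw [zsmul_eq_mul]; ring
  have hex : ∃ q : Fin m × ℤ,
      toIcoMod Real.two_pi_pos 0 t ∈ Set.Ico (Z.point q.1 q.2) (Z.point q.1 (q.2 + 1)) :=
    ⟨(p, n), by rw [hs]; constructor <;> simp only <;> linarith⟩
  have h5 := hex.choose_spec
  have h6 : Z.point hex.choose.1 (hex.choose.2 + 1) = Z.point p (n + 1) := by
    set q := hex.choose
    rw [hs] at h5
    have e1 := Z.next_le_of_lt (i := (k, q.1, q.2)) (j := (k, p, n + 1)) (by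
      simp only [pt]; linarith [h5.1])
    have e2 := Z.next_le_of_lt (i := (k, p, n)) (j := (k, q.1, q.2 + 1)) (by
      simp only [pt]; linarith [h5.2])
    simp only [pt, next] at e1 e2
    linarith
  rw [kupisch, dif_pos hex, h6, hs]
  simp only [pt, next]
  ring

lemma add_kupisch_pt (i : ℤ × Fin m × ℤ) :
    Z.pt i + Z.kupisch (Z.pt i) = Z.pt (next i) + 2 * Real.pi :=
  Z.add_kupisch_of_mem le_rfl (Z.pt_lt_next i)

/-- A half-open gap does not contain an accumulation point, as it contains no further points of the
`∞`-gon. -/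
lemma kupisch_accLift (i : ℤ × Fin m) : Z.kupisch (Z.accLift i) = 2 * Real.pi := by
  rw [kupisch, dif_neg]
  rintro ⟨⟨p, n⟩, h1, h2⟩
  have h3 := toIcoMod_add_toIcoDiv_zsmul Real.two_pi_pos 0 (Z.accLift i)
  set s := toIcoMod Real.two_pi_pos 0 (Z.accLift i)
  set k := toIcoDiv Real.two_pi_pos 0 (Z.accLift i)
  rw [zsmul_eq_mul] at h3
  have h4 : Z.pt (k, p, n) < Z.accLift i := lt_of_le_of_ne (by
    simp only [pt] at h1 ⊢; linarith) (Z.pt_ne_accLift _ _)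
  obtain ⟨j, h5, h6⟩ := Z.exists_pt_lt i h4
  have h7 := Z.next_le_of_lt h5
  simp only [pt, next] at h7 h2 h6
  linarith

lemma add_kupisch_le {t : ℝ} {i : ℤ × Fin m × ℤ} (h : t < Z.pt i) :
    t + Z.kupisch t ≤ Z.pt i + 2 * Real.pi := by
  rcases Z.exists_mem_Ico t with ⟨j, h1, h2⟩ | ⟨j, rfl⟩
  · rw [Z.add_kupisch_of_mem h1 h2]
    have := Z.next_le_of_lt (h1.trans_lt h)
    linarith
  · rw [kupisch_accLift]
    linarith

/-- Near an accumulation point there are lifted points on both sides such that no translate of a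
given lifted point lies strictly between them. -/
lemma exists_turn_notMem (i : ℤ × Fin m × ℤ) (q : ℤ × Fin m) :
    ∃ a b, a < Z.accLift q ∧ Z.accLift q < b ∧
      ∀ l : ℤ, Z.pt i + l * (2 * Real.pi) ≤ a ∨ b ≤ Z.pt i + l * (2 * Real.pi) := by
  have h0 := toIcoMod_mem_Ico Real.two_pi_pos (Z.accLift q) (Z.pt i)
  have h1 := toIcoMod_add_toIcoDiv_zsmul Real.two_pi_pos (Z.accLift q) (Z.pt i)
  set s := toIcoMod Real.two_pi_pos (Z.accLift q) (Z.pt i)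
  set k := toIcoDiv Real.two_pi_pos (Z.accLift q) (Z.pt i)
  rw [zsmul_eq_mul] at h1
  have hs : Z.accLift q < s := lt_of_le_of_ne h0.1 fun h => Z.pt_ne_accLift (turn (-k) i) q (by
    rw [pt_turn, h]; push_cast; linarith)
  refine ⟨s - 2 * Real.pi, s, by linarith [h0.2], hs, fun l => ?_⟩
  have hpi := Real.two_pi_pos
  rcases lt_or_ge (l + k) 0 with h | h
  · left
    have h2 : (l : ℝ) + k + 1 ≤ 0 := by exact_mod_cast h
    nlinarith [mul_le_mul_of_nonneg_right h2 hpi.le]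
  · right
    have h2 : (0 : ℝ) ≤ l + k := by exact_mod_cast h
    nlinarith [mul_nonneg h2 hpi.le]

end InfinityGon

/-! ### Representations of the circle seen on the real line -/

namespace CircleCat

/-- The path from `p` to `q` which lifts to the segment from `b` to `c`. -/
noncomputable def arr {p q : CircleCat} {b c : ℝ} (hb : ofReal b = p) (hc : ofReal c = q)
    (h : b ≤ c) : p ⟶ q := ⟨c - b, sub_nonneg.mpr h, by subst hb hc; simp [ofReal]⟩

lemma arr_ext {p q : CircleCat} {b c b' c' : ℝ} {hb : ofReal b = p} {hc : ofReal c = q} {h : b ≤ c}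
    {hb' : ofReal b' = p} {hc' : ofReal c' = q} {h' : b' ≤ c'} (heq : c - b = c' - b') :
    arr hb hc h = arr hb' hc' h' := Subtype.ext heq

lemma arr_comp {p q r : CircleCat} {b c d : ℝ} (hb : ofReal b = p) (hc : ofReal c = q)
    (hd : ofReal d = r) (h : b ≤ c) (h' : c ≤ d) :
    arr hb hc h ≫ arr hc hd h' = arr hb hd (h.trans h') :=
  Subtype.ext (by change c - b + (d - c) = d - b; ring)

lemma arr_self {p : CircleCat} {b : ℝ} (hb : ofReal b = p) : arr hb hb le_rfl = 𝟙 p :=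
  Subtype.ext (sub_self b)

lemma ofReal_add {p q : CircleCat} (f : p ⟶ q) {b : ℝ} (hb : ofReal b = p) :
    ofReal (b + f.1) = q := by
  subst hb
  have h2 : (ofReal b).pt + (f.1 : AddCircle (2 * Real.pi)) = q.pt := f.2.2
  cases q
  simp only [ofReal, AddCircle.coe_add] at h2 ⊢
  rw [h2]

lemma eq_arr {p q : CircleCat} (f : p ⟶ q) {b : ℝ} (hb : ofReal b = p) :
    f = arr hb (ofReal_add f hb) (le_add_of_nonneg_right f.2.1) :=
  Subtype.ext (add_sub_cancel_left b f.1).symm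

lemma exists_ofReal (p : CircleCat) : ∃ b, ofReal b = p := by
  obtain ⟨p⟩ := p
  obtain ⟨b, rfl⟩ := QuotientAddGroup.mk_surjective p
  exact ⟨b, rfl⟩

end CircleCat

section Paths

open CircleCat

variable {K : Type u} [Field K]

/-- The action of the path from `p` to `q` which lifts to the segment from `b` to `c`. -/
noncomputable def act (M : CircleRep K) {p q : CircleCat} {b c : ℝ} (hb : ofReal b = p)
    (hc : ofReal c = q) (h : b ≤ c) : M.obj p →ₗ[K] M.obj q := (M.map (arr hb hc h)).hom

section act

variable (M : CircleRep K) {p q r : CircleCat} {b c d : ℝ}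

lemma act_act (hb : ofReal b = p) (hc : ofReal c = q) (hd : ofReal d = r) (h : b ≤ c) (h' : c ≤ d)
    (v : M.obj p) : act M hc hd h' (act M hb hc h v) = act M hb hd (h.trans h') v := by
  unfold act
  rw [← arr_comp hb hc hd h h', M.map_comp]
  rfl

@[simp] lemma act_self (hb : ofReal b = p) (v : M.obj p) : act M hb hb le_rfl v = v := by
  unfold act
  rw [arr_self, M.map_id]
  rfl

lemma act_congr {b' c' : ℝ} {hb : ofReal b = p} {hc : ofReal c = q} {h : b ≤ c}
    {hb' : ofReal b' = p} {hc' : ofReal c' = q} {h' : b' ≤ c'} (heq : c - b = c' - b') :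
    act M hb hc h = act M hb' hc' h' := by
  unfold act
  rw [arr_ext heq]

variable {M} in
lemma act_naturality {N : CircleRep K} (φ : M ⟶ N) (hb : ofReal b = p) (hc : ofReal c = q)
    (h : b ≤ c) (v : M.obj p) :
    (φ.app q).hom (act M hb hc h v) = act N hb hc h ((φ.app p).hom v) :=
  congrArg (fun f => f.hom v) (φ.naturality (arr hb hc h))

lemma isIso_map_path_iff (h : b ≤ c) :
    IsIso (M.map (path h)) ↔ Function.Bijective (act M rfl rfl h) :=
  ConcreteCategory.isIso_iff_bijective _

/-- The paths which lift to segments in `(a, b]` act by isomorphisms. -/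
def IsoOn (M : CircleRep K) (a b : ℝ) : Prop :=
  ∀ ⦃x y : ℝ⦄ (h : x ≤ y), a < x → y ≤ b → Function.Bijective (act M rfl rfl h)

variable {M}

lemma IsoOn.bijective {a b x y : ℝ} (hM : IsoOn M a b) (hx : ofReal x = p) (hy : ofReal y = q)
    (h : x ≤ y) (h1 : a < x) (h2 : y ≤ b) : Function.Bijective (act M hx hy h) := by
  subst hx hy
  exact hM h h1 h2

lemma IsoOn.translate {a b : ℝ} (hM : IsoOn M a b) (l : ℤ) :
    IsoOn M (a + l * (2 * Real.pi)) (b + l * (2 * Real.pi)) := fun x y h h1 h2 => by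
  have hx : ofReal (x - l * (2 * Real.pi)) = ofReal x := ofReal_eq_iff.2 ⟨-l, by push_cast; ring⟩
  have hy : ofReal (y - l * (2 * Real.pi)) = ofReal y := ofReal_eq_iff.2 ⟨-l, by push_cast; ring⟩
  rw [act_congr M (hb' := hx) (hc' := hy) (h' := by linarith) (by ring)]
  exact hM.bijective hx hy _ (by linarith) (by linarith)

lemma IsoOn.mono {a b a' b' : ℝ} (hM : IsoOn M a b) (ha : a ≤ a') (hb : b' ≤ b) : IsoOn M a' b' :=
  fun _ _ h h1 h2 => hM h (ha.trans_lt h1) (h2.trans hb)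

end act

/-! ### String representations -/

namespace StringRep

variable {U : Set ℝ} (hU : U.OrdConnected)

open Classical in
/-- The basis vector `b` of a string representation, zero unless `b` belongs to the interval and
lies over `p`. -/
noncomputable def e (p : CircleCat) (b : ℝ) : (stringRep K hU).obj p :=
  show Fibre U p →₀ K from
    if h : b ∈ U ∧ ofReal b = p then Finsupp.single ⟨b, h⟩ 1 else 0

open Classical in
/-- The coefficient at `b` of a vector of a string representation, zero unless `b` belongs to the
interval and lies over `p`. -/
noncomputable def cf (p : CircleCat) (b : ℝ) : (stringRep K hU).obj p →ₗ[K] K :=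
  show (Fibre U p →₀ K) →ₗ[K] K from
    if h : b ∈ U ∧ ofReal b = p then Finsupp.lapply ⟨b, h⟩ else 0

variable {hU} {p q : CircleCat} {b c d : ℝ}

lemma e_of_mem (hb : b ∈ U) (hp : ofReal b = p) :
    (e hU p b : (stringRep K hU).obj p) = Finsupp.single (⟨b, hb, hp⟩ : Fibre U p) (1 : K) :=
  dif_pos ⟨hb, hp⟩

lemma e_of_notMem (hb : b ∉ U) : (e hU p b : (stringRep K hU).obj p) = 0 :=
  dif_neg fun h => hb h.1

lemma cf_of_notMem (hb : b ∉ U) : (cf hU p b : (stringRep K hU).obj p →ₗ[K] K) = 0 :=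
  dif_neg fun h => hb h.1

lemma cf_apply (hb : b ∈ U) (hp : ofReal b = p) (w : (stringRep K hU).obj p) :
    cf hU p b w = (show Fibre U p →₀ K from w) ⟨b, hb, hp⟩ := by
  have : cf hU p b = (Finsupp.lapply (⟨b, hb, hp⟩ : Fibre U p) : (Fibre U p →₀ K) →ₗ[K] K) :=
    dif_pos ⟨hb, hp⟩
  rw [this]
  rfl

lemma cf_e_self (hb : b ∈ U) (hp : ofReal b = p) :
    cf hU p b (e hU p b : (stringRep K hU).obj p) = 1 := by
  rw [cf_apply hb hp, e_of_mem hb hp]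
  exact Finsupp.single_eq_same

lemma cf_e_of_ne (h : b ≠ c) : cf hU p c (e hU p b : (stringRep K hU).obj p) = 0 := by
  by_cases hb : b ∈ U ∧ ofReal b = p
  · by_cases hc : c ∈ U ∧ ofReal c = p
    · rw [cf_apply hc.1 hc.2, e_of_mem hb.1 hb.2]
      exact Finsupp.single_eq_of_ne (by simpa using h.symm)
    · rw [cf, dif_neg hc]
      rfl
  · rw [e, dif_neg hb]
    exact map_zero _

/-- Vectors of a string representation are determined by their coefficients. -/
lemma ext {w w' : (stringRep K hU).obj p} (h : ∀ b ∈ U, ofReal b = p → cf hU p b w = cf hU p b w') :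
    w = w' := by
  refine Finsupp.ext fun b => ?_
  have := h b.1 b.2.1 b.2.2
  rwa [cf_apply b.2.1 b.2.2, cf_apply b.2.1 b.2.2] at this

/-- Linear maps out of a string representation are determined on the basis. -/
lemma lhom_ext {V : Type*} [AddCommGroup V] [Module K V] {f g : (stringRep K hU).obj p →ₗ[K] V}
    (h : ∀ b ∈ U, ofReal b = p → f (e hU p b) = g (e hU p b)) : f = g := by
  refine Finsupp.lhom_ext' fun b => LinearMap.ext_ring ?_
  have := h b.1 b.2.1 b.2.2
  rwa [e_of_mem b.2.1 b.2.2] at this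

/-- A path moves a basis vector along the interval; recall that `e` is zero outside of it. -/
lemma act_e (hb : ofReal b = p) (hc : ofReal c = q) (h : b ≤ c) (hbU : b ∈ U) :
    act (stringRep K hU) hb hc h (e hU p b) = e hU q c := by
  have h0 : b + (arr hb hc h).1 = c := add_sub_cancel b c
  rw [e_of_mem hbU hb]
  change stringMap K U (arr hb hc h) (Finsupp.single (⟨b, hbU, hb⟩ : Fibre U p) (1 : K)) = _
  rw [stringMap, Finsupp.linearCombination_single, one_smul]
  by_cases hcU : c ∈ U
  · have h1 : b + (arr hb hc h).1 ∈ U := h0.symm ▸ hcU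
    rw [dif_pos h1, e_of_mem hcU hc]
    simp only [h0]
  · have h1 : b + (arr hb hc h).1 ∉ U := h0.symm ▸ hcU
    rw [dif_neg h1, e_of_notMem hcU]
    rfl

/-- The coefficients are constant along paths inside the interval. -/
lemma cf_act (hb : ofReal b = p) (hc : ofReal c = q) (h : b ≤ c) (hcU : c ∈ U)
    (w : (stringRep K hU).obj p) : cf hU q c (act (stringRep K hU) hb hc h w) = cf hU p b w := by
  have : cf hU q c ∘ₗ act (stringRep K hU) hb hc h = cf hU p b := lhom_ext fun d hd hp => by
    have h1 : ofReal (d + (c - b)) = q := ofReal_add (arr hb hc h) hp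
    have h2 : act (stringRep K hU) hb hc h = act (stringRep K hU) hp h1 (by linarith) :=
      act_congr _ (by ring)
    rw [LinearMap.comp_apply, h2, act_e hp h1 _ hd]
    by_cases hdb : d = b
    · subst hdb
      have h3 : d + (c - d) = c := by ring
      rw [cf_e_self hd hp, h3, cf_e_self hcU hc]
    · rw [cf_e_of_ne hdb, cf_e_of_ne fun h3 => hdb (by linarith)]
  exact LinearMap.congr_fun this w

/-- Paths which do not leave or enter the interval act by isomorphisms. -/
lemma bijective_act (hb : ofReal b = p) (hc : ofReal c = q) (h : b ≤ c)
    (hbc : ∀ l : ℤ, b + l * (2 * Real.pi) ∈ U ↔ c + l * (2 * Real.pi) ∈ U) :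
    Function.Bijective (act (stringRep K hU) hb hc h) := by
  have key : ∀ d, ofReal d = p → (d ∈ U ↔ d + (c - b) ∈ U) := by
    intro d hd
    obtain ⟨l, rfl⟩ := ofReal_eq_iff.1 (hd.trans hb.symm)
    rw [hbc l]
    ring_nf
  have hq : ∀ d, ofReal d = q → ofReal (d - (c - b)) = p := by
    intro d hd
    obtain ⟨l, rfl⟩ := ofReal_eq_iff.1 (hd.trans hc.symm)
    rw [← hb]
    exact ofReal_eq_iff.2 ⟨l, by ring⟩
  constructor
  · rw [← LinearMap.ker_eq_bot, LinearMap.ker_eq_bot']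
    intro w hw
    refine ext fun d hd hp => ?_
    have h1 : ofReal (d + (c - b)) = q := ofReal_add (arr hb hc h) hp
    have h2 : act (stringRep K hU) hb hc h = act (stringRep K hU) hp h1 (by linarith) :=
      act_congr _ (by ring)
    rw [← cf_act hp h1 (by linarith) ((key d hp).1 hd), ← h2, hw]
    simp
  · rw [← LinearMap.range_eq_top]
    rw [← Submodule.ker_mkQ (LinearMap.range (act (stringRep K hU) hb hc h)), LinearMap.ker_eq_top]
    refine lhom_ext fun d hd hp => ?_
    have h0 := hq d hp
    have h2 : act (stringRep K hU) hb hc h =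
      act (stringRep K hU) h0 hp (by linarith) := act_congr _ (by ring)
    rw [LinearMap.zero_apply, Submodule.mkQ_apply, Submodule.Quotient.mk_eq_zero, h2]
    refine ⟨e hU p (d - (c - b)), act_e _ _ _ ?_⟩
    rw [key _ h0]
    simpa using hd

/-- The morphism out of a string representation defined by a compatible family of vectors. -/
noncomputable def desc (hU : U.OrdConnected) {M : CircleRep K} (m : ∀ b : ℝ, M.obj (ofReal b))
    (hm : ∀ b c (h : b ≤ c), b ∈ U → c ∈ U → act M rfl rfl h (m b) = m c)
    (hm' : ∀ b c (h : b ≤ c), b ∈ U → c ∉ U → act M rfl rfl h (m b) = 0) :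
    stringRep K hU ⟶ M where
  app p := ModuleCat.ofHom (show (Fibre U p →₀ K) →ₗ[K] M.obj p from
    Finsupp.linearCombination K fun b : Fibre U p => act M rfl b.2.2 le_rfl (m b.1))
  naturality p q f := by
    ext1
    refine lhom_ext fun b hb hp => ?_
    rw [eq_arr f hp]
    set c := b + f.1
    have hc := ofReal_add f hp
    have hbc : b ≤ c := le_add_of_nonneg_right f.2.1
    change Finsupp.linearCombination K (fun b : Fibre U q => act M rfl b.2.2 le_rfl (m b.1))
      (act (stringRep K hU) hp hc hbc (e hU p b)) = act M hp hc hbc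
      (Finsupp.linearCombination K (fun b : Fibre U p => act M rfl b.2.2 le_rfl (m b.1)) (e hU p b))
    rw [act_e hp hc hbc hb, e_of_mem hb hp, Finsupp.linearCombination_single, one_smul,
      act_act]
    have h1 := act_act M rfl rfl hc hbc le_rfl (m b)
    by_cases hcU : c ∈ U
    · rw [e_of_mem hcU hc, Finsupp.linearCombination_single, one_smul, ← h1, hm b c hbc hb hcU]
    · rw [e_of_notMem hcU, ← h1, hm' b c hbc hb hcU, map_zero]
      exact map_zero _

lemma desc_app_e {M : CircleRep K} {m : ∀ b : ℝ, M.obj (ofReal b)} {hm} {hm'} (hb : b ∈ U) :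
    ((desc hU m hm hm').app (ofReal b)).hom (e hU (ofReal b) b) = m b := by
  rw [e_of_mem hb rfl]
  change Finsupp.linearCombination K (fun b : Fibre U _ => act M rfl b.2.2 le_rfl (m b.1)) _ = _
  rw [Finsupp.linearCombination_single, one_smul]
  exact act_self M rfl _

end StringRep

end Paths

section Tame

open CircleCat

variable {K : Type u} [Field K]

/-! ### Strings of half-open intervals -/

variable (K) in
/-- The string representation of the interval `(x, y]`. -/
noncomputable abbrev iocRep (x y : ℝ) : CircleRep K :=
  stringRep K (Set.ordConnected_Ioc : (Set.Ioc x y).OrdConnected)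

/-- The basis vectors of the string of `(x, y]`. -/
noncomputable abbrev iocE {x y : ℝ} (p : CircleCat) (b : ℝ) : (iocRep K x y).obj p :=
  StringRep.e _ p b

/-- The coefficients of a vector of the string of `(x, y]`. -/
noncomputable abbrev iocCf {x y : ℝ} (p : CircleCat) (b : ℝ) : (iocRep K x y).obj p →ₗ[K] K :=
  StringRep.cf _ p b

instance finite_fibre_Ioc (x y : ℝ) (p : CircleCat) : Finite (Fibre (Set.Ioc x y) p) := by
  obtain ⟨b, rfl⟩ := exists_ofReal p
  have hpi := Real.two_pi_pos
  have h : ∀ c : Fibre (Set.Ioc x y) (ofReal b), ∃ l : Set.Icc ⌊(x - b) / (2 * Real.pi)⌋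
      ⌈(y - b) / (2 * Real.pi)⌉, c.1 = b + (l : ℤ) * (2 * Real.pi) := by
    intro c
    obtain ⟨l, hl⟩ := ofReal_eq_iff.1 c.2.2
    have h1 := c.2.1
    rw [hl] at h1
    refine ⟨⟨l, Int.floor_le_iff.2 ?_, Int.le_ceil_iff.2 ?_⟩, hl⟩
    · rw [div_lt_iff₀ hpi]
      nlinarith [h1.1]
    · rw [lt_div_iff₀ hpi]
      nlinarith [h1.2]
  choose l hl using h
  refine Finite.of_injective l fun c d hcd => Subtype.ext ?_
  rw [hl c, hl d, hcd]

lemma finiteDimensional_iocRep (x y : ℝ) (p : CircleCat) :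
    FiniteDimensional K ((iocRep K x y).obj p) :=
  inferInstanceAs (FiniteDimensional K (Fibre (Set.Ioc x y) p →₀ K))

/-- The components of the morphism to the string of `(x, y]` defined by a linear form. -/
noncomputable def iocLiftApp {M : CircleRep K} (x : ℝ) {y : ℝ} (l : M.obj (ofReal y) →ₗ[K] K)
    (p : CircleCat) : M.obj p →ₗ[K] (iocRep K x y).obj p :=
  show M.obj p →ₗ[K] (Fibre (Set.Ioc x y) p →₀ K) from
    (Finsupp.linearEquivFunOnFinite K K (Fibre (Set.Ioc x y) p)).symm.toLinearMap ∘ₗ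
      LinearMap.pi fun c : Fibre (Set.Ioc x y) p => l ∘ₗ act M c.2.2 rfl c.2.1.2

lemma iocCf_iocLiftApp {M : CircleRep K} {x y : ℝ} {l : M.obj (ofReal y) →ₗ[K] K} {p : CircleCat}
    {c : ℝ} (hc : c ∈ Set.Ioc x y) (hp : ofReal c = p) (v : M.obj p) :
    iocCf p c (iocLiftApp x l p v) = l (act M hp rfl hc.2 v) := by
  rw [iocCf, StringRep.cf_apply hc hp]
  rfl

/-- The morphism to the string of `(x, y]` defined by a linear form which vanishes on the image of
the path from `x` to `y`. -/
noncomputable def iocLift {M : CircleRep K} {x y : ℝ} (hxy : x ≤ y) (l : M.obj (ofReal y) →ₗ[K] K)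
    (hl : ∀ v, l (act M rfl rfl hxy v) = 0) : M ⟶ iocRep K x y where
  app p := ModuleCat.ofHom (iocLiftApp x l p)
  naturality p q f := by
    ext v
    refine StringRep.ext fun d hd hq => ?_
    obtain ⟨a, ha⟩ := exists_ofReal p
    have hb : ofReal (d - f.1) = p := by
      obtain ⟨k, hk⟩ := ofReal_eq_iff.1 (hq.trans (ofReal_add f ha).symm)
      exact (ofReal_eq_iff.2 ⟨k, by linarith⟩).trans ha
    have hbd : d - f.1 ≤ d := sub_le_self _ f.2.1
    have hf : f = arr hb hq hbd := Subtype.ext (sub_sub_cancel d f.1).symm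
    rw [hf]
    change iocCf q d (iocLiftApp x l q (act M hb hq hbd v)) =
      iocCf q d (act (iocRep K x y) hb hq hbd (iocLiftApp x l p v))
    rw [iocCf, StringRep.cf_act hb hq hbd hd, iocCf_iocLiftApp hd hq, act_act]
    by_cases hbU : d - f.1 ∈ Set.Ioc x y
    · rw [iocCf_iocLiftApp hbU hb]
    · have hbx : d - f.1 ≤ x := not_lt.1 fun h => hbU ⟨h, hbd.trans hd.2⟩
      rw [StringRep.cf_of_notMem hbU, ← act_act M hb rfl rfl hbx hxy, hl]
      rfl

lemma iocCf_iocLift {M : CircleRep K} {x y : ℝ} {hxy : x ≤ y} {l : M.obj (ofReal y) →ₗ[K] K}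
    {hl : ∀ v, l (act M rfl rfl hxy v) = 0} {p : CircleCat} {c : ℝ} (hc : c ∈ Set.Ioc x y)
    (hp : ofReal c = p) (v : M.obj p) :
    iocCf p c (((iocLift hxy l hl).app p).hom v) = l (act M hp rfl hc.2 v) :=
  iocCf_iocLiftApp hc hp v

/-- Morphisms to the string of `(x, y]` are determined by the coefficient at `y`. -/
lemma hom_iocRep_ext {M : CircleRep K} {x y : ℝ} (hxy : x < y) {f g : M ⟶ iocRep K x y}
    (h : ∀ v, iocCf (ofReal y) y ((f.app (ofReal y)).hom v) =
      iocCf (ofReal y) y ((g.app (ofReal y)).hom v)) : f = g := by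
  ext p v
  refine StringRep.ext fun c hc hp => ?_
  have hy : y ∈ Set.Ioc x y := ⟨hxy, le_rfl⟩
  rw [← StringRep.cf_act hp rfl hc.2 hy, ← act_naturality, ← StringRep.cf_act hp rfl hc.2 hy,
    ← act_naturality]
  exact h _

/-! ### Discrete Nakayama representations -/

variable {m : ℕ} (Z : InfinityGon m)

open InfinityGon

/-- The pointwise finite dimensional representations which satisfy the two conditions on
isomorphisms in the definition of `rep(Z_m, κ)`, in terms of lifts. -/
structure IsTame (M : CircleRep K) : Prop where
  finite : ∀ p, FiniteDimensional K (M.obj p)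
  gap : ∀ i, IsoOn M (Z.pt i) (Z.pt (next i))
  acc : ∀ q, ∃ i j, Z.pt i < Z.accLift q ∧ Z.accLift q < Z.pt j ∧ IsoOn M (Z.pt i) (Z.pt j)

/-- The tame representations in which every path that starts at a point of the `∞`-gon and is longer
than a full turn acts as zero. -/
structure IsDiscreteNakayama (M : CircleRep K) : Prop extends IsTame Z M where
  act_eq_zero : ∀ i c (h : Z.pt i ≤ c), Z.pt i + 2 * Real.pi < c → act M rfl rfl h = 0

namespace IsTame

variable {Z} {M : CircleRep K} (hM : IsTame Z M)

include hM

lemma exists_left (t : ℝ) : ∃ a < t, IsoOn M a t := by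
  rcases Z.exists_mem_Ioc t with ⟨i, h1, h2⟩ | ⟨q, rfl⟩
  · exact ⟨Z.pt i, h1, (hM.gap i).mono le_rfl h2⟩
  · obtain ⟨i, j, h1, h2, h3⟩ := hM.acc q
    exact ⟨Z.pt i, h1, h3.mono le_rfl h2.le⟩

lemma exists_right (t : ℝ) : ∃ b > t, IsoOn M t b := by
  rcases Z.exists_mem_Ico t with ⟨i, h1, h2⟩ | ⟨q, rfl⟩
  · exact ⟨Z.pt (next i), h2, (hM.gap i).mono h1 le_rfl⟩
  · obtain ⟨i, j, h1, h2, h3⟩ := hM.acc q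
    exact ⟨Z.pt j, h2, h3.mono h1.le le_rfl⟩

/-- Each space of a tame representation is carried isomorphically to the one over a point of the
`∞`-gon. -/
lemma exists_bijective_act (t : ℝ) :
    ∃ i, ∃ h : t ≤ Z.pt i, Function.Bijective (act M rfl rfl h) := by
  rcases Z.exists_mem_Ioc t with ⟨i, h1, h2⟩ | ⟨q, rfl⟩
  · exact ⟨next i, h2, hM.gap i h2 h1 le_rfl⟩
  · obtain ⟨i, j, h1, h2, h3⟩ := hM.acc q
    exact ⟨j, h2.le, h3 h2.le h1 le_rfl⟩

/-- A morphism from a string to a tame representation is determined by the image of the first basis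
vector at a point of the `∞`-gon. -/
lemma iocRep_hom_ext {i j : ℤ × Fin m × ℤ} (hij : Z.pt i < Z.pt j)
    {f g : iocRep K (Z.pt i) (Z.pt j) ⟶ M}
    (h : (f.app _).hom (iocE (ofReal (Z.pt (next i))) (Z.pt (next i))) =
      (g.app _).hom (iocE (ofReal (Z.pt (next i))) (Z.pt (next i)))) : f = g := by
  have hs : Z.pt (next i) ∈ Set.Ioc (Z.pt i) (Z.pt j) := ⟨Z.pt_lt_next i, Z.next_le_of_lt hij⟩
  ext p : 3
  refine StringRep.lhom_ext fun b hb hp => ?_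
  rcases le_total (Z.pt (next i)) b with hsb | hsb
  · rw [← StringRep.act_e rfl hp hsb hs, act_naturality, act_naturality]
    exact congrArg _ h
  · refine (hM.gap i).bijective hp rfl hsb hb.1 le_rfl |>.1 ?_
    rw [← act_naturality, ← act_naturality, StringRep.act_e hp rfl hsb hb]
    exact h

/-- A vector over the successor of `i` which is killed by the paths beyond `j` defines a morphism
from the string of `(i, j]`. -/
lemma exists_iocRep_hom {i j : ℤ × Fin m × ℤ} (hij : Z.pt i < Z.pt j)
    (v : M.obj (ofReal (Z.pt (next i))))
    (hv : ∀ c (h : Z.pt (next i) ≤ c), Z.pt j < c → act M rfl rfl h v = 0) :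
    ∃ f : iocRep K (Z.pt i) (Z.pt j) ⟶ M,
      (f.app _).hom (iocE (ofReal (Z.pt (next i))) (Z.pt (next i))) = v := by
  have hs : Z.pt (next i) ∈ Set.Ioc (Z.pt i) (Z.pt j) := ⟨Z.pt_lt_next i, Z.next_le_of_lt hij⟩
  -- before the successor of `i` the images of the basis vectors are transported backwards
  have hm : ∀ b, ∃ w : M.obj (ofReal b), Z.pt i < b →
      (∀ h : b ≤ Z.pt (next i), act M rfl rfl h w = v) ∧
        (∀ h : Z.pt (next i) ≤ b, w = act M rfl rfl h v) := by
    intro b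
    by_cases hb : Z.pt i < b
    · rcases le_total (Z.pt (next i)) b with h | h
      · refine ⟨act M rfl rfl h v, fun _ => ⟨fun h' => ?_, fun _ => rfl⟩⟩
        obtain rfl := le_antisymm h h'
        rw [act_self, act_self]
      · obtain ⟨w, hw⟩ := (hM.gap i h hb le_rfl).2 v
        refine ⟨w, fun _ => ⟨fun _ => hw, fun h' => ?_⟩⟩
        obtain rfl := le_antisymm h h'
        rw [act_self] at hw ⊢
        exact hw
    · exact ⟨0, fun h => absurd h hb⟩
  choose w hw using hm
  refine ⟨StringRep.desc _ w (fun b c h hb hc => ?_) (fun b c h hb hc => ?_), ?_⟩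
  · rcases le_total (Z.pt (next i)) b with hsb | hsb
    · rw [(hw b hb.1).2 hsb, (hw c hc.1).2 (hsb.trans h), act_act]
    · rcases le_total (Z.pt (next i)) c with hsc | hsc
      · rw [(hw c hc.1).2 hsc, ← (hw b hb.1).1 hsb, act_act]
      · refine (hM.gap i hsc hc.1 le_rfl).1 ?_
        rw [act_act, (hw b hb.1).1 hsb, (hw c hc.1).1 hsc]
  · have hjc : Z.pt j < c := not_le.1 fun h' => hc ⟨hb.1.trans_le h, h'⟩
    have hsc := hs.2.trans hjc.le
    rcases le_total (Z.pt (next i)) b with hsb | hsb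
    · rw [(hw b hb.1).2 hsb, act_act, hv c hsc hjc]
    · rw [← act_act M rfl rfl rfl hsb hsc, (hw b hb.1).1 hsb, hv c hsc hjc]
  · rw [iocE, StringRep.desc_app_e hs, (hw _ hs.1).2 le_rfl, act_self]

/-- The last point where a point of the `∞`-gon acts nontrivially. -/
lemma exists_sup {i : ℤ × Fin m × ℤ} {T : ℝ} (hT : ∀ c (h : Z.pt i ≤ c), T < c → act M rfl rfl h = 0)
    {t : ℝ} (h0 : Z.pt i ≤ t) (hi : act M rfl rfl h0 ≠ 0) :
    ∃ j, ∃ h : Z.pt i ≤ Z.pt j, t ≤ Z.pt j ∧ act M rfl rfl h ≠ 0 ∧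
      ∀ c (h : Z.pt i ≤ c), Z.pt j < c → act M rfl rfl h = 0 := by
  let A : Set ℝ := {c | ∃ h : Z.pt i ≤ c, act M rfl rfl h ≠ 0}
  have hA : BddAbove A := ⟨T, fun c ⟨h, hc⟩ => not_lt.1 fun hTc => hc (hT c h hTc)⟩
  have htA : t ∈ A := ⟨h0, hi⟩
  set y := sSup A
  have hty : t ≤ y := le_csSup hA htA
  have hy : y ∈ A := by
    obtain ⟨a, ha, hay⟩ := hM.exists_left y
    obtain ⟨c, ⟨hc, hc'⟩, hac⟩ := exists_lt_of_lt_csSup ⟨t, htA⟩ ha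
    have hcy : c ≤ y := le_csSup hA ⟨hc, hc'⟩
    refine ⟨hc.trans hcy, fun h => hc' (LinearMap.ext fun v => (hay hcy hac le_rfl).1 ?_)⟩
    rw [act_act, h]
    simp
  -- a neighbourhood of `y` on which paths act bijectively would enlarge the set, so `y` is a point
  -- of the `∞`-gon
  have key : ∀ a b, a < y → y < b → ¬ IsoOn M a b := by
    intro a b hay hyb h
    obtain ⟨hy1, hy2⟩ := hy
    refine (le_csSup hA (show b ∈ A from ⟨hy1.trans hyb.le, fun h' => hy2 ?_⟩)).not_gt hyb
    refine LinearMap.ext fun v => (h hyb.le hay le_rfl).1 ?_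
    rw [act_act, h']
    simp
  obtain ⟨j, hj⟩ : ∃ j, y = Z.pt j := by
    rcases Z.exists_mem_Ioc y with ⟨j, h1, h2⟩ | ⟨q, hq⟩
    · rcases h2.eq_or_lt with h2 | h2
      · exact ⟨next j, h2⟩
      · exact absurd (hM.gap j) (key _ _ h1 h2)
    · obtain ⟨j, k, h1, h2, h3⟩ := hM.acc q
      exact absurd h3 (key _ _ (hq ▸ h1) (hq ▸ h2))
  rw [hj] at hy hty
  refine ⟨j, hy.1, hty, hy.2, fun c h hjc => ?_⟩
  by_contra hne
  exact (le_csSup hA (show c ∈ A from ⟨h, hne⟩)).not_gt (show y < c from hj ▸ hjc)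

/-- The point of the `∞`-gon after which the paths to `j` act nontrivially. -/
lemma exists_inf {j : ℤ × Fin m × ℤ} {T : ℝ} (hT : ∀ c (h : c ≤ Z.pt j), c < T → act M rfl rfl h = 0)
    {t : ℝ} (h0 : t ≤ Z.pt j) (hj : act M rfl rfl h0 ≠ 0) :
    ∃ i, ∃ h : Z.pt i ≤ Z.pt j, Z.pt i < t ∧ act M rfl rfl h = 0 ∧
      ∀ c (h : c ≤ Z.pt j), Z.pt i < c → act M rfl rfl h ≠ 0 := by
  let A : Set ℝ := {c | ∃ h : c ≤ Z.pt j, act M rfl rfl h ≠ 0}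
  have hA : BddBelow A := ⟨T, fun c ⟨h, hc⟩ => not_lt.1 fun hTc => hc (hT c h hTc)⟩
  have htA : t ∈ A := ⟨h0, hj⟩
  set x := sInf A
  have hxt : x ≤ t := csInf_le hA htA
  have hup : ∀ c, x < c → c ≤ Z.pt j → c ∈ A := by
    intro c hxc hc
    obtain ⟨b, ⟨hb, hb'⟩, hbc⟩ := exists_lt_of_csInf_lt ⟨t, htA⟩ hxc
    refine ⟨hc, fun h => hb' ?_⟩
    ext v
    rw [← act_act M rfl rfl rfl hbc.le hc, h]
    rfl
  have hx : x ∉ A := by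
    rintro ⟨h, hx'⟩
    obtain ⟨a, ha, hax⟩ := hM.exists_left x
    have hb : (a + x) / 2 ∈ A := by
      refine ⟨by linarith, fun h1 => hx' (LinearMap.ext fun v => ?_)⟩
      obtain ⟨w, rfl⟩ := (hax (by linarith : (a + x) / 2 ≤ x) (by linarith) le_rfl).2 v
      rw [act_act, h1]
      simp
    have := csInf_le hA hb
    change x ≤ _ at this
    linarith
  have hxt' : x < t := lt_of_le_of_ne hxt fun h => hx (h ▸ htA)
  -- if paths acted bijectively near `x` then `x` would belong to the set, so `x` is a point of the
  -- `∞`-gon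
  have key : ∀ a b, a < x → x < b → ¬ IsoOn M a b := by
    intro a b hax hxb h
    have hc : min b t ∈ A := hup _ (lt_min hxb hxt') ((min_le_right _ _).trans h0)
    obtain ⟨hc1, hc2⟩ := hc
    refine hx ⟨hxt.trans h0, fun h1 => hc2 (LinearMap.ext fun v => ?_)⟩
    obtain ⟨w, rfl⟩ := (h (le_min hxb.le hxt) hax (min_le_left b t)).2 v
    rw [act_act, h1]
    simp
  obtain ⟨i, hi⟩ : ∃ i, x = Z.pt i := by
    rcases Z.exists_mem_Ioc x with ⟨j, h1, h2⟩ | ⟨q, hq⟩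
    · rcases h2.eq_or_lt with h2 | h2
      · exact ⟨next j, h2⟩
      · exact absurd (hM.gap j) (key _ _ h1 h2)
    · obtain ⟨j, k, h1, h2, h3⟩ := hM.acc q
      exact absurd h3 (key _ _ (hq ▸ h1) (hq ▸ h2))
  rw [hi] at hxt' hx
  refine ⟨i, hxt'.le.trans h0, hxt', ?_, fun c h hc => (hup c (hi ▸ hc) h).2⟩
  by_contra hne
  exact hx ⟨hxt'.le.trans h0, hne⟩

end IsTame

end Tame

section Decomposition

open CircleCat InfinityGon

variable {K : Type u} [Field K] {m : ℕ} {Z : InfinityGon m}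

/-! ### Permanence properties -/

section Retract

variable {M N : CircleRep K}

lemma retract_apply (e : Retract N M) {p : CircleCat} (v : N.obj p) :
    (e.r.app p).hom ((e.i.app p).hom v) = v :=
  congrArg (fun f : N ⟶ N => (f.app p).hom v) e.retract

lemma IsoOn.of_retract (e : Retract N M) {a b : ℝ} (hM : IsoOn M a b) : IsoOn N a b := by
  intro x y h hx hy
  obtain ⟨h1, h2⟩ := hM h hx hy
  constructor
  · refine (injective_iff_map_eq_zero _).2 fun v hv => ?_
    have h3 : (e.i.app _).hom v = 0 := h1 (by rw [← act_naturality, hv]; simp)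
    rw [← retract_apply e v, h3, map_zero]
  · intro w
    obtain ⟨u, hu⟩ := h2 ((e.i.app _).hom w)
    exact ⟨(e.r.app _).hom u, by rw [← act_naturality, hu, retract_apply]⟩

lemma act_eq_zero_of_retract (e : Retract N M) {a b : ℝ} (h : a ≤ b)
    (hM : act M rfl rfl h = 0) : act N rfl rfl h = 0 := by
  ext v
  rw [← retract_apply e (act N rfl rfl h v), act_naturality, hM]
  simp

lemma IsTame.of_retract (e : Retract N M) (hM : IsTame Z M) : IsTame Z N where
  finite p := by
    have := hM.finite p
    exact Module.Finite.of_injective (e.i.app p).hom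
      (Function.LeftInverse.injective (g := (e.r.app p).hom) (retract_apply e))
  gap i := (hM.gap i).of_retract e
  acc q := by
    obtain ⟨i, j, h1, h2, h3⟩ := hM.acc q
    exact ⟨i, j, h1, h2, h3.of_retract e⟩

lemma IsDiscreteNakayama.of_retract (e : Retract N M) (hM : IsDiscreteNakayama Z M) :
    IsDiscreteNakayama Z N where
  toIsTame := hM.toIsTame.of_retract e
  act_eq_zero i c h hc := act_eq_zero_of_retract e h (hM.act_eq_zero i c h hc)

end Retract

/-! ### Finiteness of the spaces of morphisms -/

/-- By compactness of the circle, finitely many points carry all the information of a tame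
representation. -/
lemma IsTame.exists_finset {M : CircleRep K} (hM : IsTame Z M) : ∃ F : Finset ℝ,
    ∀ p : CircleCat, ∃ f ∈ F, ∃ x, ∃ h : x ≤ f, ∃ hp : ofReal x = p,
      Function.Bijective (act M hp rfl h : _ →ₗ[K] M.obj (ofReal f)) := by
  have key : ∃ F : Finset ℝ, ∀ x ∈ Set.Icc (0 : ℝ) (2 * Real.pi), ∃ f ∈ F, ∃ h : x ≤ f,
      Function.Bijective (act M rfl rfl h) := by
    refine isCompact_Icc.induction_on (p := fun S => ∃ F : Finset ℝ, ∀ x ∈ S, ∃ f ∈ F, ∃ h : x ≤ f,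
      Function.Bijective (act M rfl rfl h)) ⟨∅, by simp⟩ (fun S T hST ⟨F, hF⟩ =>
        ⟨F, fun x hx => hF x (hST hx)⟩) (fun S T ⟨F, hF⟩ ⟨G, hG⟩ => ?_) (fun x _ => ?_)
    · classical
      refine ⟨F ∪ G, fun x hx => ?_⟩
      rcases hx with hx | hx
      · obtain ⟨f, hf, h⟩ := hF x hx
        exact ⟨f, Finset.mem_union_left _ hf, h⟩
      · obtain ⟨f, hf, h⟩ := hG x hx
        exact ⟨f, Finset.mem_union_right _ hf, h⟩
    · obtain ⟨a, ha, hax⟩ := hM.exists_left x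
      obtain ⟨b, hb, hxb⟩ := hM.exists_right x
      refine ⟨Set.Ioo a b, mem_nhdsWithin_of_mem_nhds (Ioo_mem_nhds ha hb), {x, b}, fun y hy => ?_⟩
      rcases le_or_gt y x with hyx | hyx
      · exact ⟨x, by simp, hyx, hax hyx hy.1 le_rfl⟩
      · exact ⟨b, by simp, hy.2.le, hxb hy.2.le hyx le_rfl⟩
  obtain ⟨F, hF⟩ := key
  refine ⟨F, fun p => ?_⟩
  obtain ⟨x, hx, rfl⟩ : ∃ x ∈ Set.Icc (0 : ℝ) (2 * Real.pi), ofReal x = p := by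
    obtain ⟨b, rfl⟩ := exists_ofReal p
    have h0 := toIcoMod_mem_Ico' Real.two_pi_pos b
    have h1 := toIcoMod_add_toIcoDiv_zsmul Real.two_pi_pos 0 b
    rw [zsmul_eq_mul] at h1
    exact ⟨_, ⟨h0.1, h0.2.le⟩, ofReal_eq_iff.2
      ⟨-toIcoDiv Real.two_pi_pos 0 b, by push_cast; linarith⟩⟩
  obtain ⟨f, hf, h, hb⟩ := hF x hx
  exact ⟨f, hf, x, h, rfl, hb⟩

/-- Morphisms to a tame representation are determined by their components at finitely many points.
-/
lemma IsTame.finiteDimensional_hom {M N : CircleRep K} (hM : IsTame Z M) (hN : IsTame Z N) :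
    FiniteDimensional K (M ⟶ N) := by
  obtain ⟨F, hF⟩ := hN.exists_finset
  have := hM.finite
  have := hN.finite
  let Φ : (M ⟶ N) →ₗ[K] ∀ f : F, M.obj (ofReal f) →ₗ[K] N.obj (ofReal f) :=
    { toFun := fun φ f => (φ.app _).hom
      map_add' := fun _ _ => rfl
      map_smul' := fun _ _ => rfl }
  refine Module.Finite.of_injective Φ fun φ ψ h => ?_
  ext p v
  obtain ⟨f, hf, x, hxf, hp, hb⟩ := hF p
  refine hb.1 ?_
  rw [← act_naturality, ← act_naturality]
  exact LinearMap.congr_fun (congrFun h ⟨f, hf⟩) _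

/-! ### The strings which are discrete Nakayama representations -/

/-- Segments which avoid the translates of the ends of the interval act bijectively on a string. -/
lemma isTame_iocRep (Z : InfinityGon m) (i j : ℤ × Fin m × ℤ) :
    IsTame Z (iocRep K (Z.pt i) (Z.pt j)) where
  finite p := finiteDimensional_iocRep _ _ p
  gap k := fun x y h hx hy => StringRep.bijective_act rfl rfl h fun l => by
    have h1 : Z.pt (turn l k) < x + l * (2 * Real.pi) := by rw [pt_turn]; linarith
    have h2 : y + l * (2 * Real.pi) ≤ Z.pt (next (turn l k)) := by
      rw [next_turn, pt_turn]; linarith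
    constructor
    · rintro ⟨h3, h4⟩
      exact ⟨by linarith, h2.trans (Z.next_le_of_lt (h1.trans_le h4))⟩
    · rintro ⟨h3, h4⟩
      exact ⟨(Z.le_of_lt_next (h3.trans_le h2)).trans_lt h1, by linarith⟩
  acc q := by
    obtain ⟨a₁, b₁, ha₁, hb₁, h₁⟩ := Z.exists_turn_notMem i q
    obtain ⟨a₂, b₂, ha₂, hb₂, h₂⟩ := Z.exists_turn_notMem j q
    obtain ⟨i', hi', hi''⟩ := Z.exists_pt_lt q (max_lt ha₁ ha₂)
    obtain ⟨j', hj', hj''⟩ := Z.exists_pt_gt q (lt_min hb₁ hb₂)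
    rw [max_lt_iff] at hi'
    rw [lt_min_iff] at hj''
    refine ⟨i', j', hi'', hj', fun x y h hx hy => StringRep.bijective_act rfl rfl h fun l => ?_⟩
    have e1 := h₁ (-l)
    have e2 := h₂ (-l)
    push_cast at e1 e2
    constructor
    · rintro ⟨h3, h4⟩
      exact ⟨by linarith, by rcases e2 with e2 | e2 <;> linarith [hi'.2, hj''.2]⟩
    · rintro ⟨h3, h4⟩
      exact ⟨by rcases e1 with e1 | e1 <;> linarith [hi'.1, hj''.1], by linarith⟩

/-- An element of `(i, j]` over a point of the `∞`-gon is not smaller than the successor of `i`. -/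
lemma next_le_of_ofReal_eq {b : ℝ} {i k : ℤ × Fin m × ℤ} (hp : ofReal b = ofReal (Z.pt k))
    (hb : Z.pt i < b) : Z.pt (next i) ≤ b := by
  obtain ⟨l, rfl⟩ := Z.exists_eq_pt_of_ofReal_eq hp
  exact Z.next_le_of_lt hb

lemma isDiscreteNakayama_iocRep {i j : ℤ × Fin m × ℤ}
    (hij : Z.pt j ≤ Z.pt (next i) + 2 * Real.pi) :
    IsDiscreteNakayama Z (iocRep K (Z.pt i) (Z.pt j)) where
  toIsTame := isTame_iocRep Z i j
  act_eq_zero k c h hc := StringRep.lhom_ext fun b hb hp => by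
    have h1 : ofReal (b + (c - Z.pt k)) = ofReal c := ofReal_add (arr rfl rfl h) hp
    rw [act_congr _ (hb' := hp) (hc' := h1) (h' := by linarith) (by ring),
      StringRep.act_e hp h1 _ hb, StringRep.e_of_notMem]
    · simp
    · have := next_le_of_ofReal_eq hp hb.1
      rintro ⟨-, h2⟩
      linarith

/-! ### Splitting off strings -/

lemma exists_dual_eq_one {V : Type*} [AddCommGroup V] [Module K V] {S : Submodule K V} {w : V}
    (hw : w ∉ S) : ∃ l : V →ₗ[K] K, l w = 1 ∧ ∀ v ∈ S, l v = 0 := by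
  obtain ⟨l, hl, hl'⟩ := Submodule.exists_le_ker_of_notMem hw
  refine ⟨(l w)⁻¹ • l, by simp [hl], fun v hv => ?_⟩
  have : l v = 0 := hl' hv
  simp [this]

/-- If `T v = w ≠ 0` and `T w = 0` then `w` is not a multiple of `v`. -/
lemma exists_dual_eq_one_of_nilpotent {V : Type*} [AddCommGroup V] [Module K V] (T : V →ₗ[K] V)
    {v w : V} (h1 : T v = w) (h2 : T w = 0) (hw : w ≠ 0) : ∃ l : V →ₗ[K] K, l w = 1 ∧ l v = 0 := by
  have h3 : w ∉ Submodule.span K {v} := by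
    intro h
    obtain ⟨c, rfl⟩ := Submodule.mem_span_singleton.1 h
    rw [map_smul, h1] at h2
    exact hw ((smul_eq_zero.1 h2).elim (fun h => by simp [h]) fun h => h)
  obtain ⟨l, hl, hl'⟩ := exists_dual_eq_one h3
  exact ⟨l, hl, hl' v (Submodule.mem_span_singleton_self v)⟩

/-- A nonzero discrete Nakayama representation has a string as a retract. The string is `(i, j]`,
where `j` is the last point on which the successor of `i` acts nontrivially, and the successor of
`i` is the first point which acts nontrivially on `j`. -/
theorem IsDiscreteNakayama.exists_retract {M : CircleRep K} (hM : IsDiscreteNakayama Z M)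
    (h0 : ¬ IsZero M) : ∃ i j, Z.pt i < Z.pt j ∧ Z.pt j ≤ Z.pt (next i) + 2 * Real.pi ∧
      Nonempty (Retract (iocRep K (Z.pt i) (Z.pt j)) M) := by
  have hpi := Real.two_pi_pos
  obtain ⟨i₀, hi₀⟩ : ∃ i₀, act M rfl rfl (le_refl (Z.pt i₀)) ≠ 0 := by
    by_contra! h
    refine h0 (Functor.isZero_iff _ |>.2 fun p => ?_)
    obtain ⟨t, rfl⟩ := exists_ofReal p
    obtain ⟨i, hi, hb⟩ := hM.exists_bijective_act t
    have : Subsingleton (M.obj (ofReal t)) := ⟨fun v w => hb.1 (by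
      rw [← act_self M rfl (act M rfl rfl hi v), ← act_self M rfl (act M rfl rfl hi w), h]
      rfl)⟩
    exact ModuleCat.isZero_of_subsingleton _
  obtain ⟨j₁, hj₁, -, hj₁', -⟩ := hM.exists_sup (hM.act_eq_zero i₀) le_rfl hi₀
  obtain ⟨i, hij₁, hii₀, hi, hi'⟩ := hM.exists_inf (T := Z.pt (turn (-1) (prev j₁)))
    (fun c h hc => by
      have h1 := Z.pt_lt_next (prev j₁)
      rw [next_prev] at h1
      have h2 : Z.pt (turn (-1) (prev j₁)) + 2 * Real.pi = Z.pt (prev j₁) := by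
        rw [pt_turn]; push_cast; ring
      have h3 : Z.pt (turn (-1) (prev j₁)) ≤ Z.pt j₁ := by linarith
      have h4 := hM.act_eq_zero _ _ h3 (by linarith)
      ext v
      rw [← act_act M rfl rfl rfl hc.le h3, h4]
      rfl) hj₁ hj₁'
  set s := next i with hs
  have his : Z.pt i < Z.pt s := Z.pt_lt_next i
  have hsj₁ : Z.pt s ≤ Z.pt j₁ := (Z.next_le_of_lt hii₀).trans hj₁
  obtain ⟨j, hsj, hj₁j, hj, hj'⟩ := hM.exists_sup (hM.act_eq_zero s) hsj₁ (hi' _ hsj₁ his)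
  have hij : Z.pt i < Z.pt j := his.trans_le hsj
  have hjs : Z.pt j ≤ Z.pt s + 2 * Real.pi := not_lt.1 fun h => hj (hM.act_eq_zero s _ hsj h)
  obtain ⟨v, hv⟩ : ∃ v, act M rfl rfl hsj v ≠ 0 := by
    by_contra! h
    exact hj (LinearMap.ext h)
  -- the composite endomorphism of the string has to be the identity on the first basis vector; if
  -- `j` and `i⁺` lie over the same point, the coefficient at `j` has to vanish as well
  obtain ⟨l, hl, hl'⟩ : ∃ l : M.obj (ofReal (Z.pt j)) →ₗ[K] K, l (act M rfl rfl hsj v) = 1 ∧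
      ∀ h : ofReal (Z.pt s) = ofReal (Z.pt j), Z.pt s < Z.pt j → l (act M rfl h le_rfl v) = 0 := by
    by_cases h : ofReal (Z.pt s) = ofReal (Z.pt j) ∧ Z.pt s < Z.pt j
    · obtain ⟨h, hlt⟩ := h
      have h1 : Z.pt j = Z.pt s + 2 * Real.pi := by
        obtain ⟨k, hk⟩ := ofReal_eq_iff.1 h
        have h2 : k < 0 := by
          by_contra! h3
          have : (0 : ℝ) ≤ k := by exact_mod_cast h3
          nlinarith
        have h3 : (k : ℝ) ≤ -1 := by exact_mod_cast (by omega : k ≤ -1)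
        nlinarith
      have h2 : ofReal (Z.pt j + 2 * Real.pi) = ofReal (Z.pt j) :=
        ofReal_eq_iff.2 ⟨1, by push_cast; ring⟩
      obtain ⟨l, hl, hl'⟩ := exists_dual_eq_one_of_nilpotent
        (act M (rfl : ofReal (Z.pt j) = _) h2 (by linarith)) (v := act M rfl h le_rfl v)
        (w := act M rfl rfl hsj v) (by
          rw [act_congr M (hb' := h) (hc' := rfl) (h' := hsj) (by linarith), act_act]) (by
          rw [act_act, ← act_act M rfl rfl h2 (by linarith : Z.pt s ≤ Z.pt j + 2 * Real.pi) le_rfl,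
            hj' _ _ (by linarith)]
          simp) hv
      exact ⟨l, hl, fun _ _ => hl'⟩
    · obtain ⟨l, hl, -⟩ := exists_dual_eq_one (S := ⊥) (mt (Submodule.mem_bot K).1 hv)
      exact ⟨l, hl, fun h1 h2 => absurd ⟨h1, h2⟩ h⟩
  obtain ⟨f, hf⟩ := hM.exists_iocRep_hom hij v fun c h hc => by rw [hj' c h hc]; rfl
  let g : M ⟶ iocRep K (Z.pt i) (Z.pt j) := iocLift hij.le l fun w => by
    rw [← act_act M rfl rfl rfl hij₁ hj₁j, hi]
    simp
  refine ⟨i, j, hij, hjs, ⟨⟨f, g, (isTame_iocRep Z i j).iocRep_hom_ext hij ?_⟩⟩⟩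
  change (g.app _).hom ((f.app _).hom _) = iocE _ _
  rw [hf]
  refine StringRep.ext fun c hc hp => ?_
  have hsc := next_le_of_ofReal_eq hp hc.1
  rw [← hs] at hsc
  change iocCf _ c ((g.app _).hom v) = _
  rw [iocCf_iocLift hc hp]
  rcases hsc.eq_or_lt with rfl | hlt
  · rw [StringRep.cf_e_self hc rfl]
    exact hl
  · rw [StringRep.cf_e_of_ne hlt.ne]
    have hcj : c = Z.pt j := by
      obtain ⟨k, hk⟩ := ofReal_eq_iff.1 hp
      have h1 : 0 < k := by
        by_contra! h2
        have : (k : ℝ) ≤ 0 := by exact_mod_cast h2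
        nlinarith
      have h2 : (1 : ℝ) ≤ k := by exact_mod_cast h1
      refine le_antisymm hc.2 ?_
      nlinarith
    subst hcj
    rw [act_congr M (hb' := rfl) (hc' := hp.symm) (h' := le_rfl) (by ring)]
    exact hl' hp.symm hlt

end Decomposition

section Rep

open CircleCat InfinityGon

/-! ### Comparison with continuous Nakayama representations -/

section Retracts

variable {C : Type*} [Category* C] [Abelian C]

lemma binary_total {X Y : C} {b : BinaryBicone X Y} (hb : b.IsBilimit) :
    b.fst ≫ b.inl + b.snd ≫ b.inr = 𝟙 b.pt :=
  BinaryFan.IsLimit.hom_ext hb.isLimit (by simp) (by simp)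

/-- The nonzero retracts of an indecomposable object are isomorphic to it. -/
lemma nonempty_iso_of_isIndecomposable {S N : C} (hN : IsIndecomposable N) (hS : ¬ IsZero S)
    (e : Retract S N) : Nonempty (N ≅ S) := by
  have : IsSplitMono e.i := ⟨⟨⟨e.r, e.retract⟩⟩⟩
  let b := binaryBiconeOfIsSplitMonoOfCokernel (cokernelIsCokernel e.i)
  have hb : b.IsBilimit := isBilimitBinaryBiconeOfIsSplitMonoOfCokernel (cokernelIsCokernel e.i)
  have hR := (hN.2 S _ b ⟨hb⟩ ⟨Iso.refl _⟩).resolve_left hS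
  refine ⟨⟨b.fst, b.inl, ?_, b.inl_fst⟩⟩
  refine Eq.trans ?_ (binary_total hb)
  rw [hR.eq_of_src b.inr 0, comp_zero, add_zero]
  rfl

end Retracts

variable {K : Type u} [Field K] {m : ℕ} {Z : InfinityGon m}

lemma IsContinuousNakayama.of_iso_biprod {κ : ℝ → ℝ} {M N N' : CircleRep K}
    (hM : IsContinuousNakayama κ M) (e : M ≅ N ⊞ N') : IsContinuousNakayama κ N := by
  refine ⟨fun p => ?_, fun X X' hX ⟨i⟩ => hM.2 X (X' ⊞ N') hX
    ⟨e ≪≫ biprod.mapIso i (Iso.refl N') ≪≫ biprod.associator X X' N'⟩⟩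
  have := hM.1 p
  have r : Retract N M := ⟨biprod.inl ≫ e.inv, e.hom ≫ biprod.fst, by simp⟩
  exact Module.Finite.of_injective (r.i.app p).hom
    (Function.LeftInverse.injective (g := (r.r.app p).hom) (retract_apply r))

lemma not_isZero_iocRep {x y : ℝ} (h : x < y) : ¬ IsZero (iocRep K x y) := fun h0 => by
  have h1 := (Functor.isZero_iff _).1 h0 (ofReal y)
  have h2 := StringRep.cf_e_self (K := K) (hU := Set.ordConnected_Ioc) (p := ofReal y)
    (show y ∈ Set.Ioc x y from ⟨h, le_rfl⟩) rfl
  have : Subsingleton ((iocRep K x y).obj (ofReal y)) := ModuleCat.subsingleton_of_isZero h1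
  rw [Subsingleton.elim (StringRep.e _ (ofReal y) y) 0, map_zero] at h2
  exact zero_ne_one h2

/-- An indecomposable summand has a string as a retract, to which it is isomorphic. -/
lemma IsDiscreteNakayama.isContinuousNakayama {M : CircleRep K} (hM : IsDiscreteNakayama Z M) :
    IsContinuousNakayama Z.kupisch M := by
  refine ⟨hM.finite, fun N N' hN ⟨e⟩ => ?_⟩
  have r : Retract N M := ⟨biprod.inl ≫ e.inv, e.hom ≫ biprod.fst, by simp⟩
  obtain ⟨i, j, hij, hj, ⟨s⟩⟩ := (hM.of_retract r).exists_retract hN.1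
  refine ⟨Set.Ioc (Z.pt i) (Z.pt j), Set.ordConnected_Ioc, Metric.isBounded_Ioc _ _, ?_,
    nonempty_iso_of_isIndecomposable hN (not_isZero_iocRep hij) s⟩
  rw [csInf_Ioc hij, Z.add_kupisch_pt]
  exact fun x hx => ⟨hx.1.le, hx.2.trans hj⟩

/-- The tame representations are those which satisfy the two conditions on isomorphisms in the
definition of `rep(Z_m, κ)`. -/
lemma rep_of_isTame {M : CircleRep K} (hM : IsTame Z M) (hM' : IsContinuousNakayama Z.kupisch M) :
    Z.rep K M := by
  have hpi := Real.pi_pos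
  refine ⟨hM', fun p n x y hxy hx hy => ?_, fun p => ?_⟩
  · rw [isIso_map_path_iff]
    exact hM.gap (0, p, n) hxy (by simpa [InfinityGon.pt] using hx) (by simpa [InfinityGon.pt, next] using hy)
  · obtain ⟨i, j, h1, h2, h3⟩ := hM.acc (0, p)
    -- the neighbourhood has to be shorter than a full turn
    obtain ⟨i', hi1, hi2⟩ := Z.exists_pt_lt (0, p) (a := max (Z.pt i) (Z.accLift (0, p) - Real.pi))
      (max_lt h1 (by linarith))
    obtain ⟨j', hj1, hj2⟩ := Z.exists_pt_gt (0, p) (b := min (Z.pt j) (Z.accLift (0, p) + Real.pi))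
      (lt_min h2 (by linarith))
    rw [max_lt_iff] at hi1
    rw [lt_min_iff] at hj2
    have h0 : Z.accLift (0, p) = Z.acc p.castSucc := by simp [accLift]
    rw [h0] at hi2 hj1 hi1 hj2
    refine ⟨Z.pt i', Z.pt j', Z.isLift_iff.2 ⟨i', rfl⟩, Z.isLift_iff.2 ⟨j', rfl⟩, hi2, hj1,
      by linarith, fun x y hxy hx hy => ?_⟩
    rw [isIso_map_path_iff]
    exact h3 hxy (hi1.1.trans hx) (hy.trans hj2.1.le)

/-- The conditions for the chosen lifts of the points imply those for all lifts. -/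
lemma isTame_of_rep {M : CircleRep K} (hM : Z.rep K M) : IsTame Z M where
  finite := hM.1.1
  gap := by
    rintro ⟨k, p, n⟩
    have h : IsoOn M (Z.point p n) (Z.point p (n + 1)) := fun x y hxy hx hy =>
      (isIso_map_path_iff M hxy).1 (hM.2.1 p n x y hxy hx hy)
    exact h.translate k
  acc := by
    rintro ⟨k, p⟩
    obtain ⟨a, b, ha, hb, h1, h2, -, h⟩ := hM.2.2 p
    obtain ⟨i, rfl⟩ := Z.isLift_iff.1 ha
    obtain ⟨j, rfl⟩ := Z.isLift_iff.1 hb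
    have h' : IsoOn M (Z.pt i) (Z.pt j) := fun x y hxy hx hy =>
      (isIso_map_path_iff M hxy).1 (h x y hxy hx hy)
    refine ⟨turn k i, turn k j, ?_, ?_, ?_⟩
    · simp only [pt_turn, accLift]; linarith
    · simp only [pt_turn, accLift]; linarith
    · rw [pt_turn, pt_turn]
      exact h'.translate k

/-- If a tame representation is the string of an interval `U` of length bounded by the Kupisch
function, then `inf U < b` for each point `b` of the `∞`-gon in `U`, and so the elements of `U` are
not larger than `b + 2π`. -/
lemma act_stringRep_eq_zero {U : Set ℝ} (hU : U.OrdConnected) (hM : IsTame Z (stringRep K hU))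
    (hb : Bornology.IsBounded U) (hκ : U ⊆ Set.Icc (sInf U) (sInf U + Z.kupisch (sInf U)))
    (i : ℤ × Fin m × ℤ) (c : ℝ) (h : Z.pt i ≤ c) (hc : Z.pt i + 2 * Real.pi < c) :
    act (stringRep K hU) rfl rfl h = 0 := StringRep.lhom_ext fun b hbU hp => by
  have h1 : ofReal (b + (c - Z.pt i)) = ofReal c := ofReal_add (arr rfl rfl h) hp
  rw [act_congr _ (hb' := hp) (hc' := h1) (h' := by linarith) (by ring),
    StringRep.act_e hp h1 _ hbU, StringRep.e_of_notMem]
  · simp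
  · intro hmem
    obtain ⟨l, rfl⟩ := Z.exists_eq_pt_of_ofReal_eq hp
    set k := turn l i
    have h2 := Z.pt_lt_next (prev k)
    rw [next_prev] at h2
    -- tameness on the gap before `k` shows that `U` contains a point `a` of this gap
    obtain ⟨a, ha1, ha2⟩ := exists_between h2
    have hk := hM.gap (prev k)
    rw [next_prev] at hk
    obtain ⟨w, hw⟩ := (hk ha2.le ha1 le_rfl).2 (StringRep.e hU _ (Z.pt k))
    have haU : a ∈ U := by
      by_contra haU
      have h3 := StringRep.cf_e_self (K := K) (hU := hU) hbU (rfl : ofReal (Z.pt k) = _)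
      rw [← hw, StringRep.cf_act rfl rfl ha2.le hbU, StringRep.cf_of_notMem haU] at h3
      exact zero_ne_one h3
    have h4 : sInf U < Z.pt k := (csInf_le hb.bddBelow haU).trans_lt ha2
    have h5 := (hκ hmem).2.trans (Z.add_kupisch_le h4)
    linarith

/-- Vanishing of the action can be checked on direct summands. -/
lemma act_eq_zero_of_bicone {N N' : CircleRep K} (b : BinaryBicone N N')
    (hb : b.fst ≫ b.inl + b.snd ≫ b.inr = 𝟙 b.pt) {x y : ℝ} (h : x ≤ y)
    (h1 : act N rfl rfl h = 0) (h2 : act N' rfl rfl h = 0) : act b.pt rfl rfl h = 0 := by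
  ext v
  have h3 : (b.inl.app _).hom ((b.fst.app _).hom v) + (b.inr.app _).hom ((b.snd.app _).hom v) = v :=
    congrArg (fun f : b.pt ⟶ b.pt => (f.app (ofReal x)).hom v) hb
  refine (congrArg (act b.pt rfl rfl h) h3).symm.trans ?_
  rw [map_add, ← act_naturality b.inl, ← act_naturality b.inr, h1, h2]
  simp

/-- Induction on the dimension of the endomorphism algebra reduces the vanishing to indecomposable
summands, which are strings. -/
lemma act_eq_zero_of_rep {M : CircleRep K} (hM : IsTame Z M)
    (hM' : IsContinuousNakayama Z.kupisch M) (i : ℤ × Fin m × ℤ) (c : ℝ) (h : Z.pt i ≤ c)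
    (hc : Z.pt i + 2 * Real.pi < c) : act M rfl rfl h = 0 := by
  induction hn : Module.finrank K (M ⟶ M) using Nat.strong_induction_on generalizing M with
  | _ n ih =>
    have hfin : FiniteDimensional K (M ⟶ M) := hM.finiteDimensional_hom hM
    by_cases h0 : IsZero M
    · have := ModuleCat.subsingleton_of_isZero ((Functor.isZero_iff _).1 h0 (ofReal (Z.pt i)))
      ext v
      rw [Subsingleton.elim v 0, map_zero, map_zero]
    · by_cases h1 : IsIndecomposable M
      · obtain ⟨O, hO⟩ := HasZeroObject.zero (C := CircleRep K)
        have e : M ≅ M ⊞ O := ⟨biprod.inl, biprod.fst, by simp,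
          biprod.hom_ext' _ _ (by simp) (hO.eq_of_src _ _)⟩
        obtain ⟨U, hU, hb, hκ, ⟨e'⟩⟩ := hM'.2 M O h1 ⟨e⟩
        exact act_eq_zero_of_retract e'.retract h (act_stringRep_eq_zero hU
          (hM.of_retract e'.symm.retract) hb hκ i c h hc)
      · simp only [IsIndecomposable, h0, not_false_eq_true, true_and] at h1
        push Not at h1
        obtain ⟨X, Y, b, ⟨hb⟩, ⟨e⟩, hX, hY⟩ := h1
        have hn' := (Linear.homCongr K e e).finrank_eq.trans hn
        have hfin' : FiniteDimensional K (b.pt ⟶ b.pt) :=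
          Module.Finite.equiv (Linear.homCongr K e e).symm
        have htot := binary_total hb
        have e' : M ≅ X ⊞ Y := e.symm ≪≫ biprod.uniqueUpToIso X Y hb
        refine act_eq_zero_of_retract e.symm.retract h
          (act_eq_zero_of_bicone b htot h (ih _ ?_ ?_ ?_ rfl) (ih _ ?_ ?_ ?_ rfl))
        · rw [← hn']
          refine finrank_end_lt_of_retract b.inl b.fst b.inl_fst fun h2 => hY ?_
          rw [IsZero.iff_id_eq_zero, ← b.inr_snd, ← Category.id_comp b.snd, ← h2]
          simp
        · exact hM.of_retract ⟨b.inl ≫ e.hom, e.inv ≫ b.fst, by simp⟩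
        · exact hM'.of_iso_biprod e'
        · rw [← hn']
          refine finrank_end_lt_of_retract b.inr b.snd b.inr_snd fun h2 => hX ?_
          rw [IsZero.iff_id_eq_zero, ← b.inl_fst, ← Category.id_comp b.fst, ← h2]
          simp
        · exact hM.of_retract ⟨b.inr ≫ e.hom, e.inv ≫ b.snd, by simp⟩
        · exact hM'.of_iso_biprod (e' ≪≫ biprod.braiding X Y)

/-- The objects of `rep(Z_m, κ)` are the discrete Nakayama representations. -/
theorem rep_iff {M : CircleRep K} : Z.rep K M ↔ IsDiscreteNakayama Z M :=
  ⟨fun h => ⟨isTame_of_rep h, act_eq_zero_of_rep (isTame_of_rep h) h.1⟩,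
    fun h => rep_of_isTame h.toIsTame h.isContinuousNakayama⟩

/-! ### Short exact sequences -/

section ShortExact

variable {S : ShortComplex (CircleRep K)}

lemma shortExact_app (hS : S.ShortExact) (p : CircleCat) :
    Function.Injective (S.f.app p).hom ∧
      (∀ v, (S.g.app p).hom v = 0 → ∃ w, (S.f.app p).hom w = v) ∧
      Function.Surjective (S.g.app p).hom := by
  have h := hS.map_of_exact ((evaluation CircleCat (ModuleCat.{u} K)).obj p)
  refine ⟨h.moduleCat_injective_f, fun v hv => ?_, h.moduleCat_surjective_g⟩
  exact ((ShortComplex.moduleCat_exact_iff _).1 h.exact) v hv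

lemma shortExact_comp_app (p : CircleCat) (v : S.X₁.obj p) :
    (S.g.app p).hom ((S.f.app p).hom v) = 0 :=
  congrArg (fun f : S.X₁ ⟶ S.X₃ => (f.app p).hom v) S.zero

lemma IsoOn.mid (hS : S.ShortExact) {a b : ℝ} (h1 : IsoOn S.X₁ a b) (h3 : IsoOn S.X₃ a b) :
    IsoOn S.X₂ a b := by
  intro x y h hx hy
  obtain ⟨i1, s1⟩ := h1 h hx hy
  obtain ⟨i3, s3⟩ := h3 h hx hy
  obtain ⟨fx, ex, gx⟩ := shortExact_app hS (ofReal x)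
  obtain ⟨fy, ey, gy⟩ := shortExact_app hS (ofReal y)
  constructor
  · refine (injective_iff_map_eq_zero _).2 fun v hv => ?_
    obtain ⟨u, rfl⟩ := ex v (i3 (by rw [← act_naturality, hv]; simp))
    rw [← act_naturality] at hv
    have : u = 0 := i1 (fy (by rw [hv]; simp))
    rw [this, map_zero]
  · intro w
    obtain ⟨v', hv'⟩ := s3 ((S.g.app _).hom w)
    obtain ⟨v, rfl⟩ := gx v'
    rw [← act_naturality] at hv'
    obtain ⟨u', hu'⟩ := ey (w - act S.X₂ rfl rfl h v) (by rw [map_sub, hv', sub_self])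
    obtain ⟨u, rfl⟩ := s1 u'
    refine ⟨(S.f.app _).hom u + v, ?_⟩
    rw [map_add, ← act_naturality, hu', sub_add_cancel]

lemma IsoOn.left (hS : S.ShortExact) {a b : ℝ} (h2 : IsoOn S.X₂ a b) (h3 : IsoOn S.X₃ a b) :
    IsoOn S.X₁ a b := by
  intro x y h hx hy
  obtain ⟨i2, s2⟩ := h2 h hx hy
  obtain ⟨i3, s3⟩ := h3 h hx hy
  obtain ⟨fx, ex, gx⟩ := shortExact_app hS (ofReal x)
  obtain ⟨fy, ey, gy⟩ := shortExact_app hS (ofReal y)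
  constructor
  · intro v w hvw
    refine fx (i2 ?_)
    rw [← act_naturality, ← act_naturality, hvw]
  · intro w
    obtain ⟨v, hv⟩ := s2 ((S.f.app _).hom w)
    obtain ⟨u, rfl⟩ := ex v (i3 (by
      rw [← act_naturality, hv, shortExact_comp_app]; simp))
    exact ⟨u, fy (by rw [act_naturality, hv])⟩

lemma IsoOn.right (hS : S.ShortExact) {a b : ℝ} (h1 : IsoOn S.X₁ a b) (h2 : IsoOn S.X₂ a b) :
    IsoOn S.X₃ a b := by
  intro x y h hx hy
  obtain ⟨i1, s1⟩ := h1 h hx hy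
  obtain ⟨i2, s2⟩ := h2 h hx hy
  obtain ⟨fx, ex, gx⟩ := shortExact_app hS (ofReal x)
  obtain ⟨fy, ey, gy⟩ := shortExact_app hS (ofReal y)
  constructor
  · refine (injective_iff_map_eq_zero _).2 fun v hv => ?_
    obtain ⟨v, rfl⟩ := gx v
    rw [← act_naturality] at hv
    obtain ⟨w, hw⟩ := ey _ hv
    obtain ⟨u, rfl⟩ := s1 w
    rw [act_naturality] at hw
    rw [← i2 hw, shortExact_comp_app]
  · intro w
    obtain ⟨w, rfl⟩ := gy w
    obtain ⟨v, rfl⟩ := s2 w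
    exact ⟨(S.g.app _).hom v, by rw [act_naturality]⟩

/-- Two tame representations are constant on a common neighbourhood of an accumulation point. -/
lemma IsTame.exists_common {M N : CircleRep K} (hM : IsTame Z M) (hN : IsTame Z N) (q : ℤ × Fin m) :
    ∃ i j, Z.pt i < Z.accLift q ∧ Z.accLift q < Z.pt j ∧ IsoOn M (Z.pt i) (Z.pt j) ∧
      IsoOn N (Z.pt i) (Z.pt j) := by
  obtain ⟨i, j, h1, h2, h3⟩ := hM.acc q
  obtain ⟨i', j', h1', h2', h3'⟩ := hN.acc q
  obtain ⟨a, ha, ha'⟩ := Z.exists_pt_lt q (max_lt h1 h1')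
  obtain ⟨b, hb, hb'⟩ := Z.exists_pt_gt q (lt_min h2 h2')
  rw [max_lt_iff] at ha
  rw [lt_min_iff] at hb'
  exact ⟨a, b, ha', hb, h3.mono ha.1.le hb'.1.le, h3'.mono ha.2.le hb'.2.le⟩

lemma IsTame.mid (hS : S.ShortExact) (h1 : IsTame Z S.X₁) (h3 : IsTame Z S.X₃)
    (h2 : ∀ p, FiniteDimensional K (S.X₂.obj p)) : IsTame Z S.X₂ where
  finite := h2
  gap i := (h1.gap i).mid hS (h3.gap i)
  acc q := by
    obtain ⟨i, j, hi, hj, h, h'⟩ := h1.exists_common h3 q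
    exact ⟨i, j, hi, hj, h.mid hS h'⟩

lemma IsDiscreteNakayama.left (hS : S.ShortExact) (h2 : IsDiscreteNakayama Z S.X₂)
    (h3 : IsDiscreteNakayama Z S.X₃) : IsDiscreteNakayama Z S.X₁ where
  finite p := by
    have := h2.finite p
    exact Module.Finite.of_injective _ (shortExact_app hS p).1
  gap i := (h2.gap i).left hS (h3.gap i)
  acc q := by
    obtain ⟨i, j, hi, hj, h, h'⟩ := h2.toIsTame.exists_common h3.toIsTame q
    exact ⟨i, j, hi, hj, h.left hS h'⟩
  act_eq_zero i c h hc := by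
    ext v
    refine (shortExact_app hS _).1 ?_
    rw [act_naturality, h2.act_eq_zero i c h hc]
    simp

lemma IsDiscreteNakayama.right (hS : S.ShortExact) (h1 : IsDiscreteNakayama Z S.X₁)
    (h2 : IsDiscreteNakayama Z S.X₂) : IsDiscreteNakayama Z S.X₃ where
  finite p := by
    have := h2.finite p
    exact Module.Finite.of_surjective _ (shortExact_app hS p).2.2
  gap i := (h1.gap i).right hS (h2.gap i)
  acc q := by
    obtain ⟨i, j, hi, hj, h, h'⟩ := h1.toIsTame.exists_common h2.toIsTame q
    exact ⟨i, j, hi, hj, h.right hS h'⟩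
  act_eq_zero i c h hc := by
    ext v
    obtain ⟨v, rfl⟩ := (shortExact_app hS _).2.2 v
    rw [← act_naturality, h2.act_eq_zero i c h hc]
    simp

end ShortExact

lemma isDiscreteNakayama_of_isZero {M : CircleRep K} (hM : IsZero M) : IsDiscreteNakayama Z M := by
  have h0 : ∀ p, Subsingleton (M.obj p) := fun p =>
    ModuleCat.subsingleton_of_isZero ((Functor.isZero_iff _).1 hM p)
  have h1 : ∀ a b, IsoOn M a b := fun a b x y h _ _ =>
    ⟨fun v w _ => Subsingleton.elim v w, fun w => ⟨0, Subsingleton.elim _ _⟩⟩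
  refine ⟨⟨fun p => inferInstance, fun i => h1 _ _, fun q => ?_⟩, fun i c h _ => ?_⟩
  · obtain ⟨i, -, hi⟩ := Z.exists_pt_lt q (sub_one_lt _)
    obtain ⟨j, hj, -⟩ := Z.exists_pt_gt q (lt_add_one _)
    exact ⟨i, j, hi, hj, h1 _ _⟩
  · ext v
    exact Subsingleton.elim _ _

lemma IsDiscreteNakayama.biprod {M N : CircleRep K} (hM : IsDiscreteNakayama Z M)
    (hN : IsDiscreteNakayama Z N) : IsDiscreteNakayama Z (M ⊞ N) where
  toIsTame := by
    refine IsTame.mid (ShortComplex.Splitting.ofHasBinaryBiproduct M N).shortExact hM.toIsTame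
      hN.toIsTame fun p => ?_
    have := hM.finite p
    have := hN.finite p
    refine Module.Finite.of_injective (((biprod.fst : M ⊞ N ⟶ M).app p).hom.prod
      ((biprod.snd : M ⊞ N ⟶ N).app p).hom) ((injective_iff_map_eq_zero _).2 fun v hv => ?_)
    have h1 : ((biprod.fst : M ⊞ N ⟶ M).app p).hom v = 0 := congrArg Prod.fst hv
    have h2 : ((biprod.snd : M ⊞ N ⟶ N).app p).hom v = 0 := congrArg Prod.snd hv
    have h3 : ((biprod.inl : M ⟶ M ⊞ N).app p).hom (((biprod.fst : M ⊞ N ⟶ M).app p).hom v) +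
        ((biprod.inr : N ⟶ M ⊞ N).app p).hom (((biprod.snd : M ⊞ N ⟶ N).app p).hom v) = v :=
      congrArg (fun f : M ⊞ N ⟶ M ⊞ N => (f.app p).hom v) biprod.total
    refine h3.symm.trans ?_
    rw [h1, h2]
    simp
  act_eq_zero i c h hc := act_eq_zero_of_bicone (BinaryBiproduct.bicone M N) biprod.total h
    (hM.act_eq_zero i c h hc) (hN.act_eq_zero i c h hc)

instance isAbelianSubcategory_rep : IsAbelianSubcategory (Z.rep K) where
  zero := by
    obtain ⟨O, hO⟩ := HasZeroObject.zero (C := CircleRep K)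
    exact ⟨O, hO, rep_iff.2 (isDiscreteNakayama_of_isZero hO)⟩
  biprod _ _ hX hY := rep_iff.2 ((rep_iff.1 hX).biprod (rep_iff.1 hY))
  kernel _ hS h2 h3 := rep_iff.2 (.left hS (rep_iff.1 h2) (rep_iff.1 h3))
  cokernel _ hS h1 h2 := rep_iff.2 (.right hS (rep_iff.1 h1) (rep_iff.1 h2))

instance isStableUnderRetracts_rep : (Z.rep K).IsStableUnderRetracts where
  of_retract e h := rep_iff.2 ((rep_iff.1 h).of_retract e)

lemma finiteDimensional_hom_rep (X Y : (Z.rep K).FullSubcategory) :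
    FiniteDimensional K (X ⟶ Y) := by
  have : FiniteDimensional K ((Z.rep K).ι.obj X ⟶ (Z.rep K).ι.obj Y) :=
    (isTame_of_rep X.2).finiteDimensional_hom (isTame_of_rep Y.2)
  exact Module.Finite.of_injective ((Z.rep K).ι.mapLinearMap K : (X ⟶ Y) →ₗ[K] _)
    (Z.rep K).ι.map_injective

end Rep

section Frobenius

open CircleCat InfinityGon

variable {K : Type u} [Field K] {m : ℕ} {Z : InfinityGon m}

/-! ### Truncations of strings -/

namespace StringRep

variable {U U' : Set ℝ}

/-- The morphism of strings which is the identity on the common basis vectors. -/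
noncomputable def trunc (hU : U.OrdConnected) (hU' : U'.OrdConnected)
    (h1 : ∀ b c, b ≤ c → b ∈ U → b ∈ U' → c ∈ U' → c ∈ U)
    (h2 : ∀ b c, b ≤ c → b ∈ U → b ∉ U' → c ∈ U → c ∉ U') :
    stringRep K hU ⟶ stringRep K hU' :=
  desc hU (fun b => e hU' (ofReal b) b)
    (fun b c h hb hc => by
      by_cases hb' : b ∈ U'
      · exact act_e rfl rfl h hb'
      · rw [e_of_notMem hb', e_of_notMem (h2 b c h hb hb' hc), map_zero])
    (fun b c h hb hc => by
      by_cases hb' : b ∈ U'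
      · rw [act_e rfl rfl h hb', e_of_notMem fun hc' => hc (h1 b c h hb hb' hc')]
      · rw [e_of_notMem hb', map_zero])

variable {hU : U.OrdConnected} {hU' : U'.OrdConnected}
  {h1 : ∀ b c, b ≤ c → b ∈ U → b ∈ U' → c ∈ U' → c ∈ U}
  {h2 : ∀ b c, b ≤ c → b ∈ U → b ∉ U' → c ∈ U → c ∉ U'}

lemma trunc_app_e {p : CircleCat} {b : ℝ} (hb : b ∈ U) (hp : ofReal b = p) :
    ((trunc (K := K) hU hU' h1 h2).app p).hom (e hU p b) = e hU' p b := by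
  subst hp
  exact desc_app_e hb

lemma epi_trunc (h : U' ⊆ U) : Epi (trunc (K := K) hU hU' h1 h2) := by
  have (p : CircleCat) : Epi ((trunc (K := K) hU hU' h1 h2).app p) := by
    rw [ModuleCat.epi_iff_surjective]
    change Function.Surjective ((trunc (K := K) hU hU' h1 h2).app p).hom
    rw [← LinearMap.range_eq_top, ← Submodule.ker_mkQ (LinearMap.range _), LinearMap.ker_eq_top]
    refine lhom_ext fun b hb hp => ?_
    rw [LinearMap.zero_apply, Submodule.mkQ_apply, Submodule.Quotient.mk_eq_zero]
    exact ⟨e hU p b, trunc_app_e (h hb) hp⟩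
  exact NatTrans.epi_of_epi_app _

lemma mono_trunc (h : U ⊆ U') : Mono (trunc (K := K) hU hU' h1 h2) := by
  have (p : CircleCat) : Mono ((trunc (K := K) hU hU' h1 h2).app p) := by
    rw [ModuleCat.mono_iff_injective]
    refine (injective_iff_map_eq_zero ((trunc (K := K) hU hU' h1 h2).app p).hom).2 fun w hw => ?_
    refine ext fun b hb hp => ?_
    have h3 : cf hU' p b ∘ₗ ((trunc (K := K) hU hU' h1 h2).app p).hom = cf hU p b :=
      lhom_ext fun c hc hp' => by
        rw [LinearMap.comp_apply, trunc_app_e hc hp']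
        by_cases hcb : c = b
        · subst hcb
          rw [cf_e_self hb hp, cf_e_self (h hb) hp]
        · rw [cf_e_of_ne hcb, cf_e_of_ne hcb]
    rw [← h3, LinearMap.comp_apply, hw, map_zero, map_zero]
  exact NatTrans.mono_of_mono_app _

end StringRep

/-! ### The strings as objects of `rep(Z_m, κ)` -/

variable (Z) in
/-- The pairs `(i, j)` of lifted points for which the string of `(i, j]` belongs to
`rep(Z_m, κ)`. -/
abbrev StringIdx := {x : (ℤ × Fin m × ℤ) × (ℤ × Fin m × ℤ) //
  Z.pt x.1 < Z.pt x.2 ∧ Z.pt x.2 ≤ Z.pt (next x.1) + 2 * Real.pi}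

/-- The first point of the `∞`-gon in the interval `(i, j]`. -/
noncomputable abbrev StringIdx.s (x : StringIdx Z) : ℝ := Z.pt (next x.1.1)

/-- The last point of the interval `(i, j]`. -/
noncomputable abbrev StringIdx.y (x : StringIdx Z) : ℝ := Z.pt x.1.2

/-- The intervals of maximal length, which define the projective strings. -/
def StringIdx.IsMaximal (x : StringIdx Z) : Prop := Z.pt x.1.2 = Z.pt (next x.1.1) + 2 * Real.pi

variable (K) in
/-- The string of `(i, j]` as an object of `rep(Z_m, κ)`. -/
noncomputable def strObj (x : StringIdx Z) : (Z.rep K).FullSubcategory :=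
  ⟨iocRep K (Z.pt x.1.1) (Z.pt x.1.2), rep_iff.2 (isDiscreteNakayama_iocRep x.2.2)⟩

/-- The first basis vector over a point of the `∞`-gon. -/
noncomputable def strE (x : StringIdx Z) : (strObj K x).obj.obj (ofReal x.s) :=
  iocE (ofReal x.s) x.s

/-- The coefficients of a vector of a string. -/
noncomputable def strCf (x : StringIdx Z) (p : CircleCat) (b : ℝ) :
    (strObj K x).obj.obj p →ₗ[K] K := iocCf p b

namespace StringIdx

variable (x : StringIdx Z)

lemma s_mem : x.s ∈ Set.Ioc (Z.pt x.1.1) (Z.pt x.1.2) := ⟨Z.pt_lt_next _, Z.next_le_of_lt x.2.1⟩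

lemma y_mem : x.y ∈ Set.Ioc (Z.pt x.1.1) (Z.pt x.1.2) := ⟨x.2.1, le_rfl⟩

variable {x}

lemma IsMaximal.ofReal_eq (hx : x.IsMaximal) : ofReal x.y = ofReal x.s :=
  ofReal_eq_iff.2 ⟨1, by simpa [IsMaximal] using hx⟩

end StringIdx

lemma isDiscreteNakayama_obj (X : (Z.rep K).FullSubcategory) : IsDiscreteNakayama Z X.obj :=
  rep_iff.1 X.2

variable {x : StringIdx Z} {M : (Z.rep K).FullSubcategory}

/-- Morphisms from a string are determined by the image of its first basis vector. -/
lemma strObj_hom_ext {f g : strObj K x ⟶ M}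
    (h : (f.hom.app _).hom (strE x) = (g.hom.app _).hom (strE x)) : f = g :=
  ObjectProperty.hom_ext _ ((isDiscreteNakayama_obj M).iocRep_hom_ext x.2.1 h)

/-- Morphisms to a string are determined by their last coefficient. -/
lemma hom_strObj_ext {f g : M ⟶ strObj K x}
    (h : ∀ v, strCf x (ofReal x.y) x.y ((f.hom.app _).hom v) =
      strCf x (ofReal x.y) x.y ((g.hom.app _).hom v)) : f = g :=
  ObjectProperty.hom_ext _ (hom_iocRep_ext x.2.1 h)

/-- The functor `Hom(S, -)` for a string `S` of maximal length is the evaluation at the first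
point. -/
lemma exists_hom_of_isMaximal (hx : x.IsMaximal) (v : M.obj.obj (ofReal x.s)) :
    ∃ f : strObj K x ⟶ M, (f.hom.app _).hom (strE x) = v := by
  obtain ⟨f, hf⟩ := (isDiscreteNakayama_obj M).exists_iocRep_hom x.2.1 v fun c h hc => by
    rw [(isDiscreteNakayama_obj M).act_eq_zero _ c h (by rw [← hx]; exact hc)]
    rfl
  exact ⟨ObjectProperty.homMk f, hf⟩

/-- The functor `Hom(-, S)` for a string `S` of maximal length is the dual of the evaluation at the
last point. -/
lemma exists_hom_to_of_isMaximal (hx : x.IsMaximal) (l : M.obj.obj (ofReal x.y) →ₗ[K] K) :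
    ∃ f : M ⟶ strObj K x, ∀ p (hp : ofReal x.y = p) (v : M.obj.obj p),
      strCf x p x.y ((f.hom.app p).hom v) = l (act M.obj hp rfl le_rfl v) := by
  have h0 : ∀ v, l (act M.obj rfl rfl x.2.1.le v) = 0 := fun v => by
    rw [(isDiscreteNakayama_obj M).act_eq_zero _ _ _ (by
      rw [hx]; linarith [Z.pt_lt_next x.1.1])]
    simp
  exact ⟨ObjectProperty.homMk (iocLift x.2.1.le l h0), fun p hp v =>
    iocCf_iocLift (hxy := x.2.1.le) (hl := h0) x.y_mem hp v⟩

/-- Lift the image of the first basis vector. -/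
lemma isProj_strObj (hx : x.IsMaximal) : IsProj (strObj K x) := fun Y₁ Y₂ Y₃ f g ⟨_, hS⟩ h => by
  obtain ⟨v, hv⟩ := (shortExact_app hS (ofReal x.s)).2.2 ((h.hom.app _).hom (strE x))
  obtain ⟨k, hk⟩ := exists_hom_of_isMaximal hx (M := Y₂) v
  refine ⟨k, strObj_hom_ext ?_⟩
  rw [← hv, ← hk]
  rfl

/-- Extend the last coefficient to a linear form. -/
lemma isInj_strObj (hx : x.IsMaximal) : IsInj (strObj K x) := fun Y₁ Y₂ Y₃ f g ⟨_, hS⟩ h => by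
  obtain ⟨r, hr⟩ := LinearMap.exists_leftInverse_of_injective (f.hom.app (ofReal x.y)).hom
    (LinearMap.ker_eq_bot.2 (shortExact_app hS (ofReal x.y)).1)
  obtain ⟨k, hk⟩ := exists_hom_to_of_isMaximal hx (M := Y₂)
    (strCf x _ x.y ∘ₗ (h.hom.app (ofReal x.y)).hom ∘ₗ r)
  refine ⟨k, hom_strObj_ext fun v => ?_⟩
  have h1 := hk _ rfl ((f.hom.app _).hom v)
  rw [act_self] at h1
  refine h1.trans ?_
  have h2 : r ((f.hom.app (ofReal x.y)).hom v) = v := LinearMap.congr_fun hr v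
  change strCf x _ x.y ((h.hom.app (ofReal x.y)).hom (r _)) = _
  rw [h2]

lemma not_isZero_strObj : ¬ IsZero (strObj K x) := fun h =>
  not_isZero_iocRep (K := K) x.2.1 ((IsZero.iff_id_eq_zero _).2
    (congrArg (·.hom) ((IsZero.iff_id_eq_zero _).1 h)))

lemma exists_strObj_retract (X : (Z.rep K).FullSubcategory) (hX : ¬ IsZero X) :
    ∃ (x : StringIdx Z) (i : strObj K x ⟶ X) (r : X ⟶ strObj K x), i ≫ r = 𝟙 (strObj K x) := by
  obtain ⟨i, j, h1, h2, ⟨e⟩⟩ := (isDiscreteNakayama_obj X).exists_retract fun h => hX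
    ((IsZero.iff_id_eq_zero _).2 (ObjectProperty.hom_ext _ ((IsZero.iff_id_eq_zero _).1 h)))
  exact ⟨⟨(i, j), h1, h2⟩, ObjectProperty.homMk e.i, ObjectProperty.homMk e.r,
    ObjectProperty.hom_ext _ e.retract⟩

/-- The string of `(i, j]` is a quotient of the one of `(i, i⁺ + 2π]`. -/
lemma exists_strObj_cover (x : StringIdx Z) :
    ∃ (z : StringIdx Z) (q : strObj K z ⟶ strObj K x), z.IsMaximal ∧ Epi q.hom := by
  have h0 : Z.pt (turn 1 (next x.1.1)) = Z.pt (next x.1.1) + 2 * Real.pi := by simp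
  have h1 := Z.pt_lt_next x.1.1
  have h2 := Real.two_pi_pos
  have h3 := x.2.2
  let z : StringIdx Z := ⟨(x.1.1, turn 1 (next x.1.1)), by linarith, h0.le⟩
  have h4 : Set.Ioc (Z.pt x.1.1) (Z.pt x.1.2) ⊆ Set.Ioc (Z.pt z.1.1) (Z.pt z.1.2) :=
    Set.Ioc_subset_Ioc_right (h3.trans h0.ge)
  let q : iocRep K (Z.pt z.1.1) (Z.pt z.1.2) ⟶ iocRep K (Z.pt x.1.1) (Z.pt x.1.2) :=
    StringRep.trunc Set.ordConnected_Ioc Set.ordConnected_Ioc (fun _ _ _ _ _ hc => h4 hc)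
      fun _ _ hbc hb hb' _ hc => hb' ⟨hb.1, hbc.trans hc.2⟩
  have hq : Epi q := StringRep.epi_trunc h4
  exact ⟨z, ObjectProperty.homMk q, h0, hq⟩

/-- The string of `(i, j]` is a subobject of the one of `(j⁻ - 2π, j]`. -/
lemma exists_strObj_envelope (x : StringIdx Z) :
    ∃ (z : StringIdx Z) (q : strObj K x ⟶ strObj K z), z.IsMaximal ∧ Mono q.hom := by
  have h0 : Z.pt (next (turn (-1) (prev x.1.2))) = Z.pt x.1.2 - 2 * Real.pi := by
    rw [next_turn, next_prev, pt_turn]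
    push_cast
    ring
  have h2 := Real.two_pi_pos
  have h3 : Z.pt (turn (-1) (prev x.1.2)) ≤ Z.pt x.1.1 := by
    rw [← Z.pt_next_le_iff, h0]
    linarith [x.2.2]
  let z : StringIdx Z := ⟨(turn (-1) (prev x.1.2), x.1.2), h3.trans_lt x.2.1, by rw [h0]; linarith⟩
  have hz : z.IsMaximal := by
    change Z.pt x.1.2 = Z.pt (next (turn (-1) (prev x.1.2))) + _
    rw [h0]
    ring
  have h4 : Set.Ioc (Z.pt x.1.1) (Z.pt x.1.2) ⊆ Set.Ioc (Z.pt z.1.1) (Z.pt z.1.2) :=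
    Set.Ioc_subset_Ioc_left h3
  let q : iocRep K (Z.pt x.1.1) (Z.pt x.1.2) ⟶ iocRep K (Z.pt z.1.1) (Z.pt z.1.2) :=
    StringRep.trunc Set.ordConnected_Ioc Set.ordConnected_Ioc
      (fun _ _ hbc hb _ hc => ⟨hb.1.trans_le hbc, hc.2⟩)
      fun _ _ _ hb hb' _ _ => hb' (h4 hb)
  have hq : Mono q := StringRep.mono_trunc h4
  exact ⟨z, ObjectProperty.homMk q, hz, hq⟩

/-- The endomorphisms of a string which is not of maximal length are scalars. -/
lemma finrank_end_strObj (hx : ¬ x.IsMaximal) :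
    Module.finrank K (strObj K x ⟶ strObj K x) = 1 := by
  have hlt : x.y < x.s + 2 * Real.pi := lt_of_le_of_ne x.2.2 hx
  refine (finrank_eq_one_iff_of_nonzero' (𝟙 (strObj K x)) fun h =>
    not_isZero_strObj (K := K) ((IsZero.iff_id_eq_zero _).2 h)).2 fun f => ?_
  refine ⟨strCf x _ x.s ((f.hom.app _).hom (strE x)), strObj_hom_ext ?_⟩
  refine StringRep.ext (hU := Set.ordConnected_Ioc) fun c hc hp => ?_
  have hsc := next_le_of_ofReal_eq hp hc.1
  -- the interval contains only one element over its first point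
  have hcs : c = x.s := by
    obtain ⟨l, hl⟩ := ofReal_eq_iff.1 hp
    have hpi := Real.two_pi_pos
    have h1 : l < 1 := by
      by_contra! h
      have : (1 : ℝ) ≤ l := by exact_mod_cast h
      nlinarith [hc.2]
    have h2 : (l : ℝ) ≤ 0 := by exact_mod_cast (by omega : l ≤ 0)
    exact le_antisymm (by nlinarith) hsc
  subst hcs
  have h1 : StringRep.cf Set.ordConnected_Ioc (ofReal x.s) x.s
    (iocE (ofReal x.s) x.s : (iocRep K (Z.pt x.1.1) (Z.pt x.1.2)).obj _) = 1 :=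
    StringRep.cf_e_self x.s_mem rfl
  set a := strCf x _ x.s ((f.hom.app _).hom (strE x)) with ha
  change StringRep.cf Set.ordConnected_Ioc (ofReal x.s) x.s (a • iocE (ofReal x.s) x.s :
    (iocRep K (Z.pt x.1.1) (Z.pt x.1.2)).obj _) = a
  rw [map_smul, h1, smul_eq_mul, mul_one]

/-! ### The symmetric form on the strings of maximal length -/

variable (K) in
/-- The linear form which sends an endomorphism of the string of `(i, i⁺ + 2π]` to its coefficient
from the first to the last point of the `∞`-gon in the interval; these lie over the same point of
the circle. -/
noncomputable def strForm (x : StringIdx Z) : (strObj K x ⟶ strObj K x) →ₗ[K] K where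
  toFun f := strCf x (ofReal x.s) x.y ((f.hom.app _).hom (strE x))
  map_add' f g := map_add (strCf x (ofReal x.s) x.y) ((f.hom.app _).hom (strE x))
    ((g.hom.app _).hom (strE x))
  map_smul' c f := map_smul (strCf x (ofReal x.s) x.y) c ((f.hom.app _).hom (strE x))

lemma strForm_comp (u : strObj K x ⟶ M) (v : M ⟶ strObj K x) :
    strForm K x (u ≫ v) =
      strCf x (ofReal x.s) x.y ((v.hom.app _).hom ((u.hom.app _).hom (strE x))) := rfl

/-- A linear form which does not vanish on the image of the first basis vector defines a morphism
back to the string. -/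
lemma strForm_left (hx : x.IsMaximal) (u : strObj K x ⟶ M)
    (hu : ∀ v : M ⟶ strObj K x, strForm K x (u ≫ v) = 0) : u = 0 := by
  refine strObj_hom_ext ?_
  change (u.hom.app _).hom (strE x) = 0
  rw [← Module.forall_dual_apply_eq_zero_iff K]
  intro l
  obtain ⟨v, hv⟩ := exists_hom_to_of_isMaximal hx (l ∘ₗ act M.obj rfl hx.ofReal_eq le_rfl)
  have h1 := hu v
  rw [strForm_comp, hv _ hx.ofReal_eq, LinearMap.comp_apply, act_act, act_self] at h1
  exact h1

/-- A vector on which the last coefficient does not vanish defines a morphism from the string. -/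
lemma strForm_right (hx : x.IsMaximal) (v : M ⟶ strObj K x)
    (hv : ∀ u : strObj K x ⟶ M, strForm K x (u ≫ v) = 0) : v = 0 := by
  refine hom_strObj_ext fun w => ?_
  obtain ⟨u, hu⟩ := exists_hom_of_isMaximal hx (act M.obj rfl hx.ofReal_eq le_rfl w)
  have h1 := hv u
  rw [strForm_comp, hu, act_naturality] at h1
  have h2 := StringRep.cf_act (K := K) (hU := Set.ordConnected_Ioc) rfl hx.ofReal_eq le_rfl x.y_mem
    ((v.hom.app _).hom w)
  exact h2.symm.trans (h1.trans (map_zero _).symm)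

/-- A vector of a string is the sum of its components. -/
lemma sum_iocCf_smul {a b : ℝ} {p : CircleCat} [Fintype (Fibre (Set.Ioc a b) p)]
    (w : (iocRep K a b).obj p) :
    ∑ c : Fibre (Set.Ioc a b) p, iocCf p c.1 w • (iocE p c.1 : (iocRep K a b).obj p) = w := by
  refine StringRep.ext fun d hd hp => ?_
  rw [map_sum, Finset.sum_eq_single ⟨d, hd, hp⟩]
  · rw [map_smul, StringRep.cf_e_self hd hp, smul_eq_mul, mul_one]
  · intro c _ hc
    rw [map_smul, StringRep.cf_e_of_ne fun h => hc (Subtype.ext h), smul_zero]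
  · simp

/-- The product of the matrices of two morphisms between strings of maximal length: since the
coefficients only depend on the length of the path, this is a convolution. -/
lemma strForm_comp_eq_sum {x z : StringIdx Z} (hx : x.IsMaximal)
    [Fintype (Fibre (Set.Ioc (Z.pt z.1.1) (Z.pt z.1.2)) (ofReal x.s))]
    (u : strObj K x ⟶ strObj K z) (v : strObj K z ⟶ strObj K x) :
    strForm K x (u ≫ v) = ∑ b : Fibre (Set.Ioc (Z.pt z.1.1) (Z.pt z.1.2)) (ofReal x.s),
      strCf z (ofReal x.s) b.1 ((u.hom.app _).hom (strE x)) *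
        strCf x (ofReal z.s) (x.s + z.s + 2 * Real.pi - b.1) ((v.hom.app _).hom (strE z)) := by
  have h1 : ∀ w : (strObj K z).obj.obj (ofReal x.s), (v.hom.app _).hom w =
      ∑ b : Fibre (Set.Ioc (Z.pt z.1.1) (Z.pt z.1.2)) (ofReal x.s),
        strCf z (ofReal x.s) b.1 w • (v.hom.app _).hom
          (iocE (ofReal x.s) b.1 : (iocRep K (Z.pt z.1.1) (Z.pt z.1.2)).obj _) := by
    intro w
    refine (congrArg (v.hom.app _).hom (sum_iocCf_smul (K := K) w)).symm.trans ?_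
    exact (map_sum (v.hom.app _).hom _ _).trans
      (Finset.sum_congr rfl fun b _ => map_smul (v.hom.app _).hom _ _)
  rw [strForm_comp, h1, map_sum]
  refine Finset.sum_congr rfl fun b _ => ?_
  rw [map_smul, smul_eq_mul]
  congr 1
  have h2 := next_le_of_ofReal_eq b.2.2 b.2.1.1
  have h3 := StringRep.act_e (K := K) (hU := Set.ordConnected_Ioc) (rfl : ofReal z.s = _) b.2.2 h2
    z.s_mem
  have h4 : ofReal (x.s + z.s + 2 * Real.pi - b.1) = ofReal z.s := by
    obtain ⟨l, hl⟩ := ofReal_eq_iff.1 b.2.2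
    exact ofReal_eq_iff.2 ⟨1 - l, by rw [hl]; push_cast; ring⟩
  have hy : x.y = x.s + 2 * Real.pi := hx
  rw [iocE, ← h3]
  refine (congrArg (strCf x (ofReal x.s) x.y) (act_naturality v.hom _ _ _ _)).trans ?_
  rw [act_congr _ (hb' := h4) (hc' := hx.ofReal_eq) (h' := by linarith) (by rw [hy]; ring)]
  exact StringRep.cf_act (K := K) (hU := Set.ordConnected_Ioc) h4 hx.ofReal_eq _ x.y_mem _

/-- The reflection which exchanges the fibres indexing the two convolutions. -/
noncomputable def fibreReflect {x z : StringIdx Z} (hx : x.IsMaximal) (hz : z.IsMaximal)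
    (b : Fibre (Set.Ioc (Z.pt z.1.1) (Z.pt z.1.2)) (ofReal x.s)) :
    Fibre (Set.Ioc (Z.pt x.1.1) (Z.pt x.1.2)) (ofReal z.s) :=
  ⟨x.s + z.s + 2 * Real.pi - b.1, by
    have h1 := next_le_of_ofReal_eq b.2.2 b.2.1.1
    have h2 := b.2.1.2
    have h3 := Z.pt_lt_next x.1.1
    unfold StringIdx.IsMaximal at hx hz
    refine ⟨⟨?_, ?_⟩, ?_⟩
    · simp only [StringIdx.s]; linarith
    · simp only [StringIdx.s]; linarith
    · obtain ⟨l, hl⟩ := ofReal_eq_iff.1 b.2.2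
      exact ofReal_eq_iff.2 ⟨1 - l, by rw [hl]; push_cast; ring⟩⟩

/-- The two convolutions have the same summands. -/
lemma strForm_symm {x z : StringIdx Z} (hx : x.IsMaximal) (hz : z.IsMaximal)
    (u : strObj K x ⟶ strObj K z) (v : strObj K z ⟶ strObj K x) :
    strForm K x (u ≫ v) = strForm K z (v ≫ u) := by
  have := Fintype.ofFinite (Fibre (Set.Ioc (Z.pt z.1.1) (Z.pt z.1.2)) (ofReal x.s))
  have := Fintype.ofFinite (Fibre (Set.Ioc (Z.pt x.1.1) (Z.pt x.1.2)) (ofReal z.s))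
  rw [strForm_comp_eq_sum hx, strForm_comp_eq_sum hz]
  refine Fintype.sum_equiv ⟨fibreReflect hx hz, fibreReflect hz hx, fun b => Subtype.ext ?_,
    fun b => Subtype.ext ?_⟩ _ _ fun b => ?_
  · simp only [fibreReflect]; ring
  · simp only [fibreReflect]; ring
  · rw [mul_comm]
    congr 2
    simp only [fibreReflect, Equiv.coe_fn_mk]
    congr 1
    ring

variable (K Z) in
/-- The strings in `rep(Z_m, κ)`. -/
noncomputable def stringSystem : StringSystem (Z.rep K) K where
  J := StringIdx Z
  S := strObj K
  pr := StringIdx.IsMaximal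
  not_isZero _ := not_isZero_strObj
  exists_retract := exists_strObj_retract
  isProj := isProj_strObj
  isInj := isInj_strObj
  cover := exists_strObj_cover
  envelope := exists_strObj_envelope
  finrank_end _ := or_iff_not_imp_left.2 finrank_end_strObj
  t := strForm K
  symm := strForm_symm
  left := strForm_left
  right := strForm_right

/-- The category `rep(Z_m, κ)` is a Frobenius subcategory of the category of continuous Nakayama
representations. -/
theorem isFrobeniusSubcategory_rep :
    IsFrobeniusSubcategory (Z.rep K) (IsContinuousNakayama Z.kupisch) where
  le _ h := h.1
  zero _ h := rep_iff.2 (isDiscreteNakayama_of_isZero h)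
  iso _ _ := fun ⟨e⟩ h => (Z.rep K).prop_of_retract e.symm.retract h
  biprod _ _ hX hY := rep_iff.2 ((rep_iff.1 hX).biprod (rep_iff.1 hY))
  summand _ _ h := (Z.rep K).prop_of_retract ⟨biprod.inl, biprod.fst, by simp⟩ h
  extension _ hS h1 h3 h2 := rep_of_isTame
    (IsTame.mid hS (isTame_of_rep h1) (isTame_of_rep h3) h2.1) h2
  projectiveCover X := by
    obtain ⟨Q, q, -, h1, -, h3⟩ := (stringSystem K Z).exists_proj_epi finiteDimensional_hom_rep X
    exact exists_isProjectiveCover (K := K) finiteDimensional_hom_rep X ⟨Q, q, h1, h3⟩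
  injectiveEnvelope X := by
    obtain ⟨Q, q, -, h1, h3⟩ := (stringSystem K Z).exists_inj_mono finiteDimensional_hom_rep X
    exact exists_isInjectiveEnvelope (K := K) finiteDimensional_hom_rep X ⟨Q, q, h1, h3⟩
  proj_iff_inj := ((stringSystem K Z).isFrobeniusAbelian finiteDimensional_hom_rep).proj_iff_inj

end Frobenius

end NakayamaCY

theorem mainTheorem1 {K : Type u} [Field K] {m : ℕ} (hm : 1 ≤ m) (Z : InfinityGon m) :
    IsFrobeniusSubcategory (Z.rep K) (IsContinuousNakayama Z.kupisch) ∧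
    IsKrullSchmidt (NegCYCategory Z K) ∧
    IsHomFinite (NegCYCategory Z K) K ∧
    ∀ D : CosyzygyChoice (Z.rep K),
      ∃ (_ : HasZeroObject (NegCYCategory Z K)) (_ : HasShift (NegCYCategory Z K) ℤ)
        (_ : ∀ n : ℤ, (shiftFunctor (NegCYCategory Z K) n).Additive)
        (_ : Pretriangulated (NegCYCategory Z K)),
        IsTriangulated (NegCYCategory Z K) ∧
        IsInducedTriangulation D ∧
        (∀ n : ℤ, (shiftFunctor (NegCYCategory Z K) n).Linear K) ∧
        IsSerreFunctor K (shiftFunctor (NegCYCategory Z K) (-1 : ℤ)) ∧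
        (∀ X : NegCYCategory Z K, IsIndecomposable X →
          Module.finrank K (X ⟶ (shiftFunctor (NegCYCategory Z K) (-1 : ℤ)).obj X) = 1) ∧
        ∀ (n : ℕ) (X : Fin n → NegCYCategory Z K) (B : Bicone X), Nonempty B.IsBilimit →
          (∀ i, IsIndecomposable (X i)) →
          ∀ (θ : ∀ i, (X i ⟶ (shiftFunctor (NegCYCategory Z K) (-1 : ℤ)).obj (X i)) ≃ₗ[K] K)
            (b : NegCYCategory Z K),
            (tracePairing K (shiftFunctor (NegCYCategory Z K) (-1 : ℤ)) B θ b).Nondegenerate := by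
  have hP := (stringSystem K Z).isFrobeniusAbelian finiteDimensional_hom_rep
  exact ⟨isFrobeniusSubcategory_rep, (stringSystem K Z).isKrullSchmidt finiteDimensional_hom_rep,
    stableCategory_isHomFinite finiteDimensional_hom_rep,
    exists_serre_triangulation finiteDimensional_hom_rep
      ((stringSystem K Z).symmetricForm finiteDimensional_hom_rep)
      ((stringSystem K Z).finrank_end_of_isIndecomposable finiteDimensional_hom_rep)⟩
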